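/- Let $a<b$ be real, let $U:[a,b]\to\mathbb R$ be $C^\infty$ and let $\alpha>0$. Let $K\subset(a,b)$ be compact and $r>0$, and suppose that $U$ has an extension (still denoted $U$) to $[a,b]\cup\{z\in\mathbb C: d(z,K)<r\}$ which is holomorphic on $\{z\in\mathbb C: d(z,K)<r\}$. Let $m:\mathbb R\to\mathbb R$ be $C^\infty$, supported in $K$, with $|m|<r$, and let $$M_{a,b}=\{x+i\,m(x): x\in(a,b)\},\qquad \overline M_{a,b}=\{x+i\,m(x): x\in[a,b]\}$$ be the deformed segment, parametrized by $\gamma(x)=x+i\,m(x)$. Functions and distributions on $M_{a,b}$ are identified, through $\gamma$, with functions and distributions on $(a,b)$; the derivative $\partial_x$ along $M_{a,b}$ is then $(1+i\,m')^{-1}\frac{d}{dx}$. For $c\in\mathbb C$ and $\epsilon>0$ let $$P_{c,\epsilon}=i\alpha^{-1}\epsilon^2(\partial_x^2-\alpha^2)^2+(U-c)(\partial_x^2-\alpha^2)-U'',$$ acting on distributions on $(a,b)$ (the case $m=0$) or on $M_{a,b}$ (where $U$ and $U''$ denote the restrictions of the extended $U$ and of its second derivative). For $s\in\mathbb R$,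 $H^s(M_{a,b})$ is the space of restrictions to $(a,b)$ (in the coordinate $x$) of elements of $H^s(\mathbb R)$, with the quotient norm, and for $s>3/2$ $$H^s_{\mathrm{DN}}(M_{a,b})=\{u\in H^s(M_{a,b}): u(a)=u(b)=\partial_xu(a)=\partial_xu(b)=0\}.$$ For $m=0$ one writes $H^s(a,b)$; in particular $H^4_{\mathrm{DN}}(a,b)=H^4(a,b)\cap H^2_0(a,b)$. Let $\Sigma_\epsilon$ be the set of $c\in\mathbb C$ such that $P_{c,\epsilon}:H^4(a,b)\cap H^2_0(a,b)\to L^2(a,b)$ (on the undeformed segment) is not invertible. Let $\mathfrak S_{c,\epsilon}([a,b])$ be the smallest linear subspace $S$ of $C^\infty([a,b])$ with the following property: if $\psi\in C^\infty([a,b])$ and $\phi\in S$ satisfy $P_{c,\epsilon}\psi=(\partial_x^2-\alpha^2)\phi$ and $\psi(a)=\psi(b)=\partial_x\psi(a)=\partial_x\psi(b)=0$, then $\psi\in S$. Let $\mathfrak S_{c,\epsilon}(\overline M_{a,b})$ be the smallest linear subspace of $C^\infty(\overline M_{a,b})$ with the same property on $\overline M_{a,b}$. **Proposition.** Let $\epsilon>0$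 and let $k>-5/2$ be real. Then: 1. $\Sigma_\epsilon$ is a closed discrete subset of $\mathbb C$; 2. for every $c\in\mathbb C$, $P_{c,\epsilon}$ defines a bounded operator $H^{k+4}_{\mathrm{DN}}(M_{a,b})\to H^k(M_{a,b})$ which is Fredholm of index zero, and it is invertible if and only if $c\notin\Sigma_\epsilon$; 3. for every $c\in\mathbb C$, the spaces $\mathfrak S_{c,\epsilon}([a,b])$ and $\mathfrak S_{c,\epsilon}(\overline M_{a,b})$ are finite dimensional, they have the same dimension, and this dimension is non-zero if and only if $c\in\Sigma_\epsilon$. -/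

import Mathlib

open Set MeasureTheory
open scoped SchwartzMap ContDiff Topology

noncomputable section

namespace OrrSommerfeld

/-! ### Distributions and Sobolev spaces on an interval

Functions and distributions on a curve parametrized by `[a, b]` are identified with functions and
distributions on `(a, b)` through the parametrization. -/

/-- Complex test functions on `(a, b)`: smooth functions on `ℝ` whose (automatically compact)
support is contained in `(a, b)`. -/
def TestFun (a b : ℝ) : Submodule ℂ 𝓢(ℝ, ℂ) where
  carrier := {φ | tsupport φ ⊆ Ioo a b}
  zero_mem' := by
    have h : ((0 : 𝓢(ℝ, ℂ)) : ℝ → ℂ) = 0 := rfl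
    simp [h]
  add_mem' := by
    intro φ ψ hφ hψ
    exact (tsupport_add (φ : ℝ → ℂ) ψ).trans (union_subset hφ hψ)
  smul_mem' := by
    intro c φ hφ
    exact (tsupport_smul_subset_right (fun _ : ℝ => c) (φ : ℝ → ℂ)).trans hφ

/-- Functionals on the test functions on `(a, b)`. All the functionals used below are restrictions
to `(a, b)` of tempered distributions on `ℝ`, hence distributions on `(a, b)`. -/
abbrev Func (a b : ℝ) : Type := TestFun a b →ₗ[ℂ] ℂ

/-- Restriction to `(a, b)` of a tempered distribution on `ℝ`. -/
def restrict (a b : ℝ) : 𝓢'(ℝ, ℂ) →ₗ[ℂ] Func a b where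
  toFun u :=
    { toFun := fun φ => u φ
      map_add' := fun φ ψ => map_add u (φ : 𝓢(ℝ, ℂ)) ψ
      map_smul' := fun c φ => map_smul u c (φ : 𝓢(ℝ, ℂ)) }
  map_add' _ _ := rfl
  map_smul' _ _ := rfl

/-- The isometric parametrization of `H^s(ℝ)` by `L²(ℝ)` through the Bessel potential of
order `-s`. -/
def ofL2 (s : ℝ) : Lp ℂ 2 (volume : Measure ℝ) →L[ℂ] 𝓢'(ℝ, ℂ) :=
  (TemperedDistribution.besselPotential ℝ ℂ (-s)).comp (Lp.toTemperedDistributionCLM ℂ volume 2)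

/-- The elements of `H^s(ℝ)` (parametrized by `L²(ℝ)`) that vanish on `(a, b)`. -/
def vanishing (a b s : ℝ) : Submodule ℂ (Lp ℂ 2 (volume : Measure ℝ)) :=
  LinearMap.ker ((restrict a b).comp (ofL2 s).toLinearMap)

instance isClosed_vanishing (a b s : ℝ) :
    IsClosed (vanishing a b s : Set (Lp ℂ 2 (volume : Measure ℝ))) := by
  have h : (vanishing a b s : Set (Lp ℂ 2 (volume : Measure ℝ))) =
      ⋂ φ : TestFun a b, {v | ofL2 s v (φ : 𝓢(ℝ, ℂ)) = 0} := by
    ext v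
    simp only [vanishing, SetLike.mem_coe, LinearMap.mem_ker, mem_iInter, mem_ofPred_eq]
    exact LinearMap.ext_iff
  rw [h]
  refine isClosed_iInter fun φ => isClosed_eq ?_ continuous_const
  exact (PointwiseConvergenceCLM.evalCLM (RingHom.id ℂ) ℂ (φ : 𝓢(ℝ, ℂ))).continuous.comp
    (ofL2 s).continuous

/-- The Sobolev space `H^s(a, b)`, `s ∈ ℝ`, of restrictions to `(a, b)` of elements of `H^s(ℝ)`,
with the quotient norm (the infimum of the `H^s(ℝ)` norms of the extensions). It is realized as the
quotient of `H^s(ℝ)` by the closed subspace of elements that vanish on `(a, b)`. -/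
abbrev Sob (a b s : ℝ) : Type := Lp ℂ 2 (volume : Measure ℝ) ⧸ vanishing a b s

/-- The distribution on `(a, b)` given by an element of `H^s(a, b)`. -/
def Sob.toFunc {a b s : ℝ} : Sob a b s →ₗ[ℂ] Func a b :=
  (vanishing a b s).liftQ ((restrict a b).comp (ofL2 s).toLinearMap) le_rfl

theorem Sob.toFunc_injective {a b s : ℝ} :
    Function.Injective (Sob.toFunc (a := a) (b := b) (s := s)) := by
  rw [← LinearMap.ker_eq_bot]
  exact Submodule.ker_liftQ_eq_bot _ _ _ le_rfl

/-- `H^s(a, b)` consists exactly of the restrictions of the elements of `H^s(ℝ)`. -/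
theorem Sob.range_toFunc (a b s : ℝ) :
    Set.range (Sob.toFunc (a := a) (b := b) (s := s)) =
      restrict a b '' {u | TemperedDistribution.MemSobolev s 2 u} := by
  ext w
  constructor
  · rintro ⟨u, rfl⟩
    obtain ⟨v, rfl⟩ := Submodule.Quotient.mk_surjective _ u
    refine ⟨ofL2 s v, ⟨v, ?_⟩, rfl⟩
    simp [ofL2]
  · rintro ⟨u, ⟨v, hv⟩, rfl⟩
    refine ⟨Submodule.Quotient.mk v, ?_⟩
    have h : ofL2 s v = u := by
      simp [ofL2, ← hv]
    rw [← h]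
    rfl

/-- The distribution `u` on `(a, b)` is given by the function `f`. -/
def Represents {a b : ℝ} (u : Func a b) (f : ℝ → ℂ) : Prop :=
  ∀ φ : TestFun a b, u φ = ∫ x in Ioo a b, (φ : 𝓢(ℝ, ℂ)) x * f x

theorem integrableOn_testFun_mul {a b : ℝ} (φ : TestFun a b) {f : ℝ → ℂ}
    (hf : ContDiffOn ℝ 1 f (Icc a b)) :
    IntegrableOn (fun x => (φ : 𝓢(ℝ, ℂ)) x * f x) (Ioo a b) :=
  ((((φ : 𝓢(ℝ, ℂ)).continuous.continuousOn.mul hf.continuousOn).integrableOn_Icc).mono_set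
    Ioo_subset_Icc_self)

/-- The elements of `H^s(a, b)`, `s > 3/2`, that satisfy the Dirichlet and the Neumann boundary
conditions `u = u' = 0` at `a` and `b`. (For such `s` every element of `H^s(a, b)` is given by
exactly one `C^1` function on `[a, b]`, so that the boundary values make sense.) For `s = 4` this
is the space `H^4(a, b) ∩ H^2_0(a, b)`. -/
def SobDN (a b s : ℝ) : Submodule ℂ (Sob a b s) where
  carrier := {u | ∃ f : ℝ → ℂ, ContDiffOn ℝ 1 f (Icc a b) ∧ Represents u.toFunc f ∧
    f a = 0 ∧ f b = 0 ∧ derivWithin f (Icc a b) a = 0 ∧ derivWithin f (Icc a b) b = 0}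
  zero_mem' := by
    refine ⟨0, contDiffOn_const, fun φ => ?_, rfl, rfl, ?_, ?_⟩ <;> simp
  add_mem' := by
    rintro u v ⟨f, hf, huf, fa, fb, fa', fb'⟩ ⟨g, hg, hvg, ga, gb, ga', gb'⟩
    have key : ∀ x ∈ Icc a b, derivWithin f (Icc a b) x = 0 → derivWithin g (Icc a b) x = 0 →
        derivWithin (f + g) (Icc a b) x = 0 := by
      intro x hx h1 h2
      rw [derivWithin_add ((hf.differentiableOn one_ne_zero) x hx)
        ((hg.differentiableOn one_ne_zero) x hx), h1, h2, add_zero]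
    refine ⟨f + g, hf.add hg, fun φ => ?_, by simp [fa, ga], by simp [fb, gb], ?_, ?_⟩
    · rw [map_add, LinearMap.add_apply, huf φ, hvg φ,
        ← integral_add (integrableOn_testFun_mul φ hf) (integrableOn_testFun_mul φ hg)]
      simp [mul_add]
    · by_cases h : a ≤ b
      · exact key a (left_mem_Icc.2 h) fa' ga'
      · exact derivWithin_zero_of_notMem_closure (by simp [Icc_eq_empty h])
    · by_cases h : a ≤ b
      · exact key b (right_mem_Icc.2 h) fb' gb'
      · exact derivWithin_zero_of_notMem_closure (by simp [Icc_eq_empty h])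
  smul_mem' := by
    rintro k u ⟨f, hf, huf, fa, fb, fa', fb'⟩
    refine ⟨k • f, hf.const_smul k, fun φ => ?_, by simp [fa], by simp [fb], ?_, ?_⟩
    · rw [map_smul, LinearMap.smul_apply, huf φ, smul_eq_mul, ← integral_const_mul]
      simp [mul_left_comm]
    · simp [derivWithin_const_smul_field, fa']
    · simp [derivWithin_const_smul_field, fb']

/-! ### Differential operators on a curve

The curve is parametrized by `γ : [a, b] → ℂ`; a function on the curve is identified with the
function `f` of the parameter. -/

/-- The derivative along the curve, `∂ = (γ')⁻¹ d/dx`. -/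
def curveDeriv (a b : ℝ) (γ f : ℝ → ℂ) (x : ℝ) : ℂ :=
  derivWithin f (Icc a b) x / derivWithin γ (Icc a b) x

/-- The formal transpose of `∂ = (γ')⁻¹ d/dx` with respect to the pairing `∫ f φ dx`, namely
`φ ↦ - d/dx ((γ')⁻¹ φ)`. -/
def curveDerivT (a b : ℝ) (γ φ : ℝ → ℂ) (x : ℝ) : ℂ :=
  - derivWithin (fun y => φ y / derivWithin γ (Icc a b) y) (Icc a b) x

/-- The operator `∂² - α²` along the curve. -/
def lap (a b α : ℝ) (γ f : ℝ → ℂ) (x : ℝ) : ℂ :=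
  curveDeriv a b γ (curveDeriv a b γ f) x - (α : ℂ) ^ 2 * f x

/-- The formal transpose of `∂² - α²`. -/
def lapT (a b α : ℝ) (γ φ : ℝ → ℂ) (x : ℝ) : ℂ :=
  curveDerivT a b γ (curveDerivT a b γ φ) x - (α : ℂ) ^ 2 * φ x

/-- The Orr--Sommerfeld operator
`P = i α⁻¹ ε² (∂² - α²)² + (U - c) (∂² - α²) - U''` along the curve, acting on functions; `W` is
the shear profile `U` along the curve (as a function of the parameter), and `U'' = ∂² U`. -/
def orrSommerfeld (a b α ε : ℝ) (c : ℂ) (γ W f : ℝ → ℂ) (x : ℝ) : ℂ :=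
  Complex.I * (α : ℂ)⁻¹ * (ε : ℂ) ^ 2 * lap a b α γ (lap a b α γ f) x
    + (W x - c) * lap a b α γ f x
    - curveDeriv a b γ (curveDeriv a b γ W) x * f x

/-- The formal transpose of the Orr--Sommerfeld operator. -/
def orrSommerfeldT (a b α ε : ℝ) (c : ℂ) (γ W φ : ℝ → ℂ) (x : ℝ) : ℂ :=
  Complex.I * (α : ℂ)⁻¹ * (ε : ℂ) ^ 2 * lapT a b α γ (lapT a b α γ φ) x
    + lapT a b α γ (fun y => (W y - c) * φ y) x
    - curveDeriv a b γ (curveDeriv a b γ W) x * φ x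

/-- `P u = w` in the sense of distributions: `w φ = u (Pᵀ φ)` for every test function `φ`. -/
def WeakEq {a b : ℝ} (α ε : ℝ) (c : ℂ) (γ W : ℝ → ℂ) (u w : Func a b) : Prop :=
  ∀ φ ψ : TestFun a b,
    (∀ x, (ψ : 𝓢(ℝ, ℂ)) x = orrSommerfeldT a b α ε c γ W (φ : 𝓢(ℝ, ℂ)) x) → w φ = u ψ

/-- The bounded operator `T : H^s_DN → H^t` is the Orr--Sommerfeld operator `P` (acting in the
sense of distributions on `(a, b)`). -/
def IsOrrSommerfeld {a b : ℝ} (α ε : ℝ) (c : ℂ) (γ W : ℝ → ℂ) {s t : ℝ}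
    (T : SobDN a b s →L[ℂ] Sob a b t) : Prop :=
  ∀ u : SobDN a b s, WeakEq α ε c γ W (u : Sob a b s).toFunc (T u).toFunc

/-- The set `Σ_ε` of the `c ∈ ℂ` such that
`P_{c,ε} : H^4(a, b) ∩ H^2_0(a, b) → L^2(a, b)` (on the undeformed segment) is not invertible. -/
def eigenvalues (a b α ε : ℝ) (U : ℝ → ℝ) : Set ℂ :=
  {c | ¬ ∃ T : SobDN a b 4 →L[ℂ] Sob a b 0,
    IsOrrSommerfeld α ε c (fun x => (x : ℂ)) (fun x => (U x : ℂ)) T ∧ T.IsInvertible}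

/-! ### Generalized eigenspaces -/

/-- The space `C^∞([a, b])`. A function on `[a, b]` is represented by its extension by zero
to `ℝ`, so that the elements are determined by their values on `[a, b]`. -/
def Smooth (a b : ℝ) : Submodule ℂ (ℝ → ℂ) where
  carrier := {f | ContDiffOn ℝ ∞ f (Icc a b) ∧ ∀ x ∉ Icc a b, f x = 0}
  zero_mem' := ⟨contDiffOn_const, fun _ _ => rfl⟩
  add_mem' := fun hf hg => ⟨hf.1.add hg.1, fun x hx => by simp [hf.2 x hx, hg.2 x hx]⟩
  smul_mem' := fun k _ hf => ⟨hf.1.const_smul k, fun x hx => by simp [hf.2 x hx]⟩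

/-- The space of generalized eigenfunctions: the smallest subspace `S` of the space of smooth
functions on the curve such that every smooth `ψ` with `P ψ = (∂² - α²) φ` for some `φ ∈ S` and
`ψ = ∂ψ = 0` at both endpoints belongs to `S`. -/
def genEigenspace (a b α ε : ℝ) (c : ℂ) (γ W : ℝ → ℂ) : Submodule ℂ (ℝ → ℂ) :=
  sInf {S | S ≤ Smooth a b ∧ ∀ ψ ∈ Smooth a b, ∀ φ ∈ S,
    (∀ x ∈ Icc a b, orrSommerfeld a b α ε c γ W ψ x = lap a b α γ φ x) →
    ψ a = 0 → ψ b = 0 → curveDeriv a b γ ψ a = 0 → curveDeriv a b γ ψ b = 0 → ψ ∈ S}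

end OrrSommerfeld

end

open Set MeasureTheory
open scoped SchwartzMap ContDiff Topology

noncomputable section

namespace OrrSommerfeld

open scoped FourierTransform LineDeriv

variable {a b : ℝ}

/-! ### Weighted `L²` norms of Schwartz functions -/

/-! The leading coefficient `iα⁻¹ε²` does not vanish, so `P u = f` is equivalent to a linear first
order system for `(u, ∂u, (∂² - α²)u, ∂(∂² - α²)u)` with smooth coefficients. Multiplication by the
inverse of a fundamental matrix reduces such a system to `w' = h`, even for distributions. The
equation `w' = h` is solved in Sobolev spaces of every real order by duality: membership in `H^s(a,
b)` means `|w(φ)| ≤ C ‖φ‖_{-s}` on test functions, and a Poincaré inequality in all orders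
(`exists_sobNorm_le_derivTest`) bounds `φ` by `φ'`. Hence `P : H^{k+4} → H^k` is onto
(`exists_osF_eq`), and its kernel consists of smooth classical solutions
(`exists_classical_of_osF_eq_zero`), parametrized by the four Cauchy data at `a`.

For `k > -5/2` the four boundary values are continuous and independent on `H^{k+4}`. Restriction to
their common kernel lowers the index from 4 to 0, and the restricted operator is invertible if and
only if no non-zero smooth solution satisfies the boundary conditions
(`IsShearCurve.exists_isFredholm`). This criterion does not involve `k`, and it holds on the segment
and on the curve alike.

The spectral statements are proved on the undeformed segment. For `c = iτ` with `τ` large, pairing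
`P f = (∂² - α²) g` with `f` and taking imaginary parts bounds `‖f'‖` by `‖g‖` in `L²`
(`exists_energy_estimate`). So `A = P⁻¹(∂² - α²)` exists on the smooth functions with the boundary
conditions; it maps `L²` boundedly to bounded functions, hence it is Hilbert--Schmidt. The problem
at an arbitrary `c` becomes the eigenvalue problem of `A` at `(c - iτ)⁻¹`. On an invariant subspace
of dimension `d` the trace of `A` is at most the Hilbert--Schmidt bound times `√d`. This one
inequality bounds both the dimension of a generalized eigenspace (`finiteDimensional_genS`) and the
number of eigenvalues near a non-zero number (`isClosed_and_isDiscrete`).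

The segment and the curve are compared by analytic continuation. Where they differ the coefficients
are holomorphic, so solutions on the segment continue to solutions on the curve
(`exists_continued_solution`). The identity theorem makes continuation injective, and uniqueness for
the Cauchy problem at `a` makes it surjective. The boundary conditions are preserved because the
curve is not deformed near the endpoints. Continuation therefore identifies the two spaces of
generalized eigenfunctions (`IsDeformedPair.exists_genS_equiv`), and finiteness and invertibility
transfer without any estimate on the curve. -/

/-- The symbol `(1 + ξ²)^(t/2)` of the Bessel potential. -/
def weight (t ξ : ℝ) : ℂ := (((1 + ‖ξ‖ ^ 2) ^ (t / 2) : ℝ) : ℂ)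

@[fun_prop]
theorem weight_hasTemperateGrowth (t : ℝ) : (weight t).HasTemperateGrowth := by
  unfold weight; fun_prop

theorem norm_weight (t ξ : ℝ) : ‖weight t ξ‖ = (1 + ‖ξ‖ ^ 2) ^ (t / 2) := by
  rw [weight, Complex.norm_real, Real.norm_of_nonneg (by positivity)]

/-- The Fourier transform of `φ` multiplied by the weight of order `t`. -/
def weighted (t : ℝ) : 𝓢(ℝ, ℂ) →L[ℂ] 𝓢(ℝ, ℂ) :=
  SchwartzMap.smulLeftCLM ℂ (weight t) ∘L FourierTransform.fourierInvCLM ℂ 𝓢(ℝ, ℂ)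

theorem weighted_apply (t : ℝ) (φ : 𝓢(ℝ, ℂ)) (ξ : ℝ) :
    weighted t φ ξ = weight t ξ * 𝓕⁻ φ ξ := by
  simp [weighted, SchwartzMap.smulLeftCLM_apply_apply (weight_hasTemperateGrowth t)]

/-- The weighted Fourier transform as a map to `L²`. -/
def weightedL2 (t : ℝ) : 𝓢(ℝ, ℂ) →ₗ[ℂ] Lp ℂ 2 (volume : Measure ℝ) :=
  ((SchwartzMap.toLpCLM ℂ ℂ 2 volume).comp (weighted t)).toLinearMap

theorem weightedL2_coe (t : ℝ) (φ : 𝓢(ℝ, ℂ)) :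
    weightedL2 t φ =ᵐ[volume] fun ξ => weight t ξ * 𝓕⁻ φ ξ := by
  have : weightedL2 t φ = (weighted t φ).toLp 2 := rfl
  rw [this]
  filter_upwards [(weighted t φ).coeFn_toLp 2] with ξ hξ
  rw [hξ, weighted_apply]

/-- The `H^t(ℝ)` norm of a Schwartz function. -/
def sobNorm (t : ℝ) (φ : 𝓢(ℝ, ℂ)) : ℝ := ‖weightedL2 t φ‖

theorem sobNorm_nonneg (t : ℝ) (φ : 𝓢(ℝ, ℂ)) : 0 ≤ sobNorm t φ := norm_nonneg _

theorem sobNorm_le_of_forall_le {t t' C : ℝ} {φ ψ : 𝓢(ℝ, ℂ)}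
    (h : ∀ ξ, ‖weight t ξ * 𝓕⁻ φ ξ‖ ≤ C * ‖weight t' ξ * 𝓕⁻ ψ ξ‖) :
    sobNorm t φ ≤ C * sobNorm t' ψ := by
  refine Lp.norm_le_mul_norm_of_ae_le_mul ?_
  filter_upwards [weightedL2_coe t φ, weightedL2_coe t' ψ] with ξ h1 h2
  rw [h1, h2]
  exact h ξ

theorem sobNorm_mono {t t' : ℝ} (h : t ≤ t') (φ : 𝓢(ℝ, ℂ)) : sobNorm t φ ≤ sobNorm t' φ := by
  rw [← one_mul (sobNorm t' φ)]
  refine sobNorm_le_of_forall_le fun ξ => ?_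
  rw [norm_mul, norm_mul, norm_weight, norm_weight, one_mul]
  gcongr
  nlinarith [sq_nonneg ‖ξ‖]

theorem fourierInv_deriv (φ : 𝓢(ℝ, ℂ)) (ξ : ℝ) :
    𝓕⁻ (SchwartzMap.derivCLM ℂ ℂ φ) ξ = -(2 * Real.pi * Complex.I * ξ) * 𝓕⁻ φ ξ := by
  have : SchwartzMap.derivCLM ℂ ℂ φ = ∂_{(1 : ℝ)} φ := by
    ext x; simp [SchwartzMap.lineDerivOp_apply_eq_fderiv, SchwartzMap.derivCLM_apply]
  rw [this, SchwartzMap.fourierInv_lineDerivOp_eq]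
  simp
  rw [SchwartzMap.smulLeftCLM_apply_apply (by fun_prop)]
  simp; ring

theorem norm_weight_add_one (t ξ : ℝ) :
    ‖weight (t + 1) ξ‖ = (1 + ‖ξ‖ ^ 2) ^ (1 / 2 : ℝ) * ‖weight t ξ‖ := by
  rw [norm_weight, norm_weight, ← Real.rpow_add (by positivity)]
  ring_nf

theorem sobNorm_deriv_le (t : ℝ) (φ : 𝓢(ℝ, ℂ)) :
    sobNorm t (SchwartzMap.derivCLM ℂ ℂ φ) ≤ 2 * Real.pi * sobNorm (t + 1) φ := by
  refine sobNorm_le_of_forall_le fun ξ => ?_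
  rw [fourierInv_deriv, norm_mul, norm_mul, norm_mul, norm_weight_add_one]
  have h1 : ‖-(2 * (Real.pi : ℂ) * Complex.I * ξ)‖ = 2 * Real.pi * ‖ξ‖ := by
    simp [abs_of_pos Real.pi_pos]
  have h2 : ‖ξ‖ ≤ (1 + ‖ξ‖ ^ 2) ^ (1 / 2 : ℝ) := by
    rw [← Real.sqrt_eq_rpow]
    exact Real.le_sqrt_of_sq_le (by linarith)
  rw [h1]
  have := Real.pi_pos
  calc _ = 2 * Real.pi * (‖ξ‖ * ‖weight t ξ‖ * ‖𝓕⁻ φ ξ‖) := by ring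
    _ ≤ _ := by gcongr

theorem inner_weightedL2 (t : ℝ) (φ ψ : 𝓢(ℝ, ℂ)) :
    inner ℂ (weightedL2 t φ) (weightedL2 t ψ) =
      ∫ ξ, inner ℂ (weighted t φ ξ) (weighted t ψ ξ) := by
  rw [MeasureTheory.L2.inner_def]
  refine integral_congr_ae ?_
  filter_upwards [weightedL2_coe t φ, weightedL2_coe t ψ] with ξ h1 h2
  rw [h1, h2, weighted_apply, weighted_apply]

/-- On the Fourier side differentiation is multiplication by a purely imaginary symbol, which
commutes with the weight. Integration by parts is thus available in every order `t`, which is what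
the Poincaré inequality needs. -/
theorem inner_weightedL2_deriv (t : ℝ) (φ ψ : 𝓢(ℝ, ℂ)) :
    inner ℂ (weightedL2 t (SchwartzMap.derivCLM ℂ ℂ φ)) (weightedL2 t ψ) =
      -inner ℂ (weightedL2 t φ) (weightedL2 t (SchwartzMap.derivCLM ℂ ℂ ψ)) := by
  rw [inner_weightedL2, inner_weightedL2, ← integral_neg]
  refine integral_congr_ae (Filter.Eventually.of_forall fun ξ => ?_)
  simp only [weighted_apply, fourierInv_deriv, RCLike.inner_apply]
  simp only [neg_mul, mul_neg, map_neg, map_mul, Complex.conj_ofReal, Complex.conj_I, map_ofNat]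
  ring

/-- `‖φ‖_{t+1} ≤ ‖φ‖_t + ‖φ'‖_t`. -/
theorem sobNorm_add_one_le (t : ℝ) (φ : 𝓢(ℝ, ℂ)) :
    sobNorm (t + 1) φ ≤ sobNorm t φ + sobNorm t (SchwartzMap.derivCLM ℂ ℂ φ) := by
  have h : ‖weightedL2 (t + 1) φ‖ ^ 2 ≤
      ‖weightedL2 t φ‖ ^ 2 + ‖weightedL2 t (SchwartzMap.derivCLM ℂ ℂ φ)‖ ^ 2 := by
    have key : ∀ (s : ℝ) (χ : 𝓢(ℝ, ℂ)), ‖weightedL2 s χ‖ ^ 2 = ∫ ξ, ‖weighted s χ ξ‖ ^ 2 := by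
      intro s χ
      have := inner_self_eq_norm_sq_to_K (𝕜 := ℂ) (weightedL2 s χ)
      rw [inner_weightedL2] at this
      simp_rw [inner_self_eq_norm_sq_to_K] at this
      have h3 : ((∫ ξ, ‖weighted s χ ξ‖ ^ 2 : ℝ) : ℂ) = ((‖weightedL2 s χ‖ ^ 2 : ℝ) : ℂ) := by
        rw [← integral_complex_ofReal]; push_cast; exact this
      exact_mod_cast h3.symm
    have hi : ∀ (s : ℝ) (χ : 𝓢(ℝ, ℂ)), Integrable fun ξ => ‖weighted s χ ξ‖ ^ 2 := fun s χ =>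
      (memLp_two_iff_integrable_sq_norm (weighted s χ).continuous.aestronglyMeasurable).1
        ((weighted s χ).memLp 2)
    rw [key, key, key, ← integral_add (hi _ _) (hi _ _)]
    refine integral_mono (hi _ _) ((hi _ _).add (hi _ _)) fun ξ => ?_
    simp only [weighted_apply, fourierInv_deriv, norm_mul, norm_weight_add_one]
    have h1 : ‖-(2 * (Real.pi : ℂ) * Complex.I * ξ)‖ = 2 * Real.pi * ‖ξ‖ := by
      simp [abs_of_pos Real.pi_pos]
    rw [← norm_mul, h1, ← Real.sqrt_eq_rpow, mul_pow, mul_pow, Real.sq_sqrt (by positivity),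
      mul_pow, mul_pow, norm_mul, mul_pow]
    -- The symbol of the derivative has modulus `2π|ξ| ≥ |ξ|`, so no constant is lost.
    have hpi : 1 ≤ (2 * Real.pi) ^ 2 := by nlinarith [Real.pi_gt_three]
    have : 0 ≤ ‖ξ‖ ^ 2 * (‖weight t ξ‖ ^ 2 * ‖𝓕⁻ φ ξ‖ ^ 2) := by positivity
    nlinarith
  refine abs_le_of_sq_le_sq' ?_ (add_nonneg (norm_nonneg _) (norm_nonneg _)) |>.2
  unfold sobNorm
  nlinarith [norm_nonneg (weightedL2 t φ),
    norm_nonneg (weightedL2 t (SchwartzMap.derivCLM ℂ ℂ φ))]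

/-! ### Multiplication by smooth functions -/

/-- Young's inequality `‖k ∗ b‖₂ ≤ ‖k‖₁ ‖b‖₂`. -/
theorem lintegral_sq_convolution_le {k b : ℝ → ENNReal} (hk : Measurable k) (hb : Measurable b) :
    ∫⁻ ξ, (∫⁻ η, k (ξ - η) * b η) ^ 2 ≤ (∫⁻ ξ, k ξ) ^ 2 * ∫⁻ η, b η ^ 2 := by
  have cs : ∀ ξ, (∫⁻ η, k (ξ - η) * b η) ^ 2 ≤
      (∫⁻ ξ, k ξ) * ∫⁻ η, k (ξ - η) * b η ^ 2 := by
    intro ξ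
    have hk' : Measurable fun η => k (ξ - η) := by fun_prop
    -- Cauchy--Schwarz with the kernel split as `k^(1/2) · k^(1/2)`, only one half going with `b`;
    -- Tonelli then finishes.
    have h := ENNReal.lintegral_mul_le_Lp_mul_Lq volume Real.HolderConjugate.two_two
      (f := fun η => k (ξ - η) ^ (1 / 2 : ℝ)) (g := fun η => k (ξ - η) ^ (1 / 2 : ℝ) * b η)
      (by fun_prop) (by fun_prop)
    have e1 : ∀ x : ENNReal, x ^ (1 / 2 : ℝ) * x ^ (1 / 2 : ℝ) = x := by
      intro x
      rw [← ENNReal.rpow_add_of_nonneg _ _ (by norm_num) (by norm_num)]; norm_num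
    have e2 : ∀ x : ENNReal, (x ^ (1 / 2 : ℝ)) ^ (2 : ℝ) = x := by
      intro x
      rw [← ENNReal.rpow_mul]; norm_num
    have e3 : ∀ x : ENNReal, (x ^ (1 / 2 : ℝ)) ^ 2 = x := by
      intro x
      rw [← ENNReal.rpow_natCast]; exact e2 x
    simp only [Pi.mul_apply, ← mul_assoc, e1] at h
    simp only [ENNReal.mul_rpow_of_nonneg _ _ (zero_le_two (α := ℝ)), e2] at h
    calc _ ≤ _ := pow_le_pow_left' h 2
      _ = _ := by
        rw [mul_pow, e3, e3, lintegral_sub_left_eq_self (fun x => k x) ξ]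
        simp
  calc _ ≤ ∫⁻ ξ, (∫⁻ ξ, k ξ) * ∫⁻ η, k (ξ - η) * b η ^ 2 := lintegral_mono cs
    _ = (∫⁻ ξ, k ξ) * ∫⁻ ξ, ∫⁻ η, k (ξ - η) * b η ^ 2 := by
        rw [lintegral_const_mul _ (by fun_prop)]
    _ = (∫⁻ ξ, k ξ) * ∫⁻ η, ∫⁻ ξ, k (ξ - η) * b η ^ 2 := by
        rw [lintegral_lintegral_swap (by fun_prop)]
    _ = _ := by
        have : ∀ η, ∫⁻ ξ, k (ξ - η) * b η ^ 2 = (∫⁻ ξ, k ξ) * b η ^ 2 := by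
          intro η
          rw [lintegral_mul_const _ (by fun_prop), lintegral_sub_right_eq_self (fun x => k x) η]
        simp_rw [this]
        rw [lintegral_const_mul _ (by fun_prop), sq, mul_assoc]

/-- Peetre's inequality. -/
theorem norm_weight_le (t ξ η : ℝ) :
    ‖weight t ξ‖ ≤ 2 ^ (|t| / 2) * (‖weight |t| (ξ - η)‖ * ‖weight t η‖) := by
  have h : ∀ x y : ℝ, 1 + ‖x‖ ^ 2 ≤ 2 * ((1 + ‖x - y‖ ^ 2) * (1 + ‖y‖ ^ 2)) := by
    intro x y
    simp only [Real.norm_eq_abs, sq_abs]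
    nlinarith [sq_nonneg (x - 2 * y), sq_nonneg ((x - y) * y), sq_nonneg (x - y), sq_nonneg y]
  simp only [norm_weight]
  rcases le_total 0 t with ht | ht
  · rw [abs_of_nonneg ht, ← Real.mul_rpow (by positivity) (by positivity),
      ← Real.mul_rpow (by positivity) (by positivity)]
    exact Real.rpow_le_rpow (by positivity) (h ξ η) (by linarith)
  -- For a negative exponent, exchange `ξ` and `η`, use the positive exponent `-t`, and take
  -- inverses.
  · have h1 : (1 + ‖η‖ ^ 2) ^ (-t / 2) ≤
        2 ^ (-t / 2) * ((1 + ‖ξ - η‖ ^ 2) ^ (-t / 2) * (1 + ‖ξ‖ ^ 2) ^ (-t / 2)) := by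
      rw [← Real.mul_rpow (by positivity) (by positivity),
        ← Real.mul_rpow (by positivity) (by positivity), norm_sub_rev]
      exact Real.rpow_le_rpow (by positivity) (h η ξ) (by linarith)
    have e : ∀ x : ℝ, (1 + ‖x‖ ^ 2) ^ (t / 2) = ((1 + ‖x‖ ^ 2) ^ (-t / 2))⁻¹ := by
      intro x
      rw [← Real.rpow_neg (by positivity)]; ring_nf
    rw [abs_of_nonpos ht, e ξ, e η, ← div_eq_mul_inv, ← mul_div_assoc, inv_eq_one_div,
      div_le_div_iff₀ (by positivity) (by positivity)]
    linarith

/-- A function which is `C^n` on a compact interval has a `C^n` extension to the line. -/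
theorem exists_contDiff_eqOn_Icc {a b : ℝ} (hab : a < b) (n : ℕ) (g : ℝ → ℂ)
    (hg : ContDiffOn ℝ n g (Icc a b)) : ∃ G : ℝ → ℂ, ContDiff ℝ n G ∧ EqOn G g (Icc a b) := by
  induction n generalizing g with
  | zero =>
    refine ⟨IccExtend hab.le (Set.domRestrict (Icc a b) g), ?_, fun x hx => ?_⟩
    · exact contDiff_zero.2 (hg.continuousOn.domRestrict.Icc_extend')
    · exact IccExtend_of_mem _ _ hx
  | succ n ih =>
    push_cast at hg
    have hd := (contDiffOn_succ_iff_derivWithin (uniqueDiffOn_Icc hab)).1 hg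
    -- Extend the derivative by induction and integrate the extension from `a`.
    obtain ⟨G, hG, hGg⟩ := ih _ hd.2.2
    have hder : ∀ x, HasDerivAt (fun x => g a + ∫ y in a..x, G y) (G x) x := fun x =>
      (intervalIntegral.integral_hasDerivAt_right (hG.continuous.intervalIntegrable _ _)
        (hG.continuous.stronglyMeasurableAtFilter _ _) hG.continuous.continuousAt).const_add _
    refine ⟨fun x => g a + ∫ y in a..x, G y, ?_, ?_⟩
    · push_cast
      rw [contDiff_succ_iff_deriv]
      refine ⟨fun x => (hder x).differentiableAt, by simp, ?_⟩
      have : deriv (fun x => g a + ∫ y in a..x, G y) = G := funext fun x => (hder x).deriv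
      rwa [this]
    · refine eq_of_derivWithin_eq (fun x _ => (hder x).differentiableAt.differentiableWithinAt)
        hd.1 (fun x hx => ?_) (by simp)
      rw [(hder x).hasDerivWithinAt.derivWithin (uniqueDiffOn_Icc hab x (Ico_subset_Icc_self hx)),
        hGg (Ico_subset_Icc_self hx)]

theorem exists_compactSupport_eqOn_Icc {a b : ℝ} (hab : a < b) (n : ℕ) (g : ℝ → ℂ)
    (hg : ContDiffOn ℝ n g (Icc a b)) :
    ∃ G : ℝ → ℂ, ContDiff ℝ n G ∧ HasCompactSupport G ∧ EqOn G g (Icc a b) := by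
  obtain ⟨G, hG, hGg⟩ := exists_contDiff_eqOn_Icc hab n g hg
  -- The bump equals 1 within distance `b - a` of the midpoint, which covers `[a, b]`.
  obtain ⟨χ, hχ⟩ : ∃ χ : ContDiffBump ((a + b) / 2 : ℝ), χ.rIn = b - a :=
    ⟨⟨b - a, 2 * (b - a), by linarith, by linarith⟩, rfl⟩
  refine ⟨fun x => (χ x : ℂ) * G x, ?_, ?_, fun x hx => ?_⟩
  · exact (Complex.ofRealCLM.contDiff.comp χ.contDiff).mul hG
  · refine HasCompactSupport.mul_right ?_
    exact χ.hasCompactSupport.comp_left (g := fun x : ℝ => (x : ℂ)) (by simp)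
  · have : χ x = 1 := by
      refine χ.one_of_mem_closedBall ?_
      rw [hχ, Metric.mem_closedBall, Real.dist_eq, abs_le]
      constructor <;> linarith [hx.1, hx.2]
    simp [this, hGg hx]

/-- Each integrable derivative gains a power of `|ξ|`. A finite order of smoothness is enough here,
so extensions of order `2p` suffice and no smooth extension of the multiplier is required. -/
theorem exists_norm_fourierInv_le {G : ℝ → ℂ} (p : ℕ) (hG : ContDiff ℝ (2 * p : ℕ) G)
    (hc : HasCompactSupport G) :
    ∃ C, 0 ≤ C ∧ ∀ ξ, (1 + ‖ξ‖ ^ 2) ^ p * ‖𝓕⁻ G ξ‖ ≤ C := by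
  have hint : ∀ n : ℕ, (n : ℕ∞) ≤ (2 * p : ℕ) → Integrable (iteratedDeriv n G) := by
    intro n hn
    refine Continuous.integrable_of_hasCompactSupport ?_ ?_
    · exact hG.continuous_iteratedDeriv n (by exact_mod_cast hn)
    · rw [iteratedDeriv_eq_equiv_comp]
      exact (hc.iteratedFDeriv n).comp_left (map_zero _)
  have hbd : ∀ (f : ℝ → ℂ) (ξ : ℝ), ‖𝓕 f ξ‖ ≤ ∫ x, ‖f x‖ := fun f ξ =>
    VectorFourier.norm_fourierIntegral_le_integral_norm _ _ _ _ _
  have h1 : ∀ ξ : ℝ, ‖ξ‖ ^ (2 * p) * ‖𝓕 G ξ‖ ≤ ∫ x, ‖iteratedDeriv (2 * p) G x‖ := by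
    intro ξ
    have := congrFun (Real.fourier_iteratedDeriv (N := (2 * p : ℕ)) (n := 2 * p)
      (by exact_mod_cast hG) hint le_rfl) ξ
    have h2 := hbd (iteratedDeriv (2 * p) G) ξ
    rw [this, norm_smul, norm_pow] at h2
    refine le_trans ?_ h2
    gcongr
    have : ‖2 * (Real.pi : ℂ) * Complex.I * ξ‖ = 2 * Real.pi * ‖ξ‖ := by
      simp [abs_of_pos Real.pi_pos]
    rw [this]
    nlinarith [Real.pi_gt_three, norm_nonneg ξ]
  refine ⟨2 ^ p * ((∫ x, ‖G x‖) + ∫ x, ‖iteratedDeriv (2 * p) G x‖), by positivity, fun ξ => ?_⟩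
  rw [Real.fourierInv_eq_fourier_neg]
  have h2 : (1 + ‖ξ‖ ^ 2) ^ p ≤ 2 ^ p * (1 + ‖ξ‖ ^ (2 * p)) := by
    have := add_pow_le (zero_le_one (α := ℝ)) (sq_nonneg ‖ξ‖) p
    rw [one_pow, ← pow_mul] at this
    refine this.trans ?_
    gcongr
    · norm_num
    · omega
  have h3 := h1 (-ξ)
  rw [norm_neg] at h3
  calc _ ≤ 2 ^ p * (1 + ‖ξ‖ ^ (2 * p)) * ‖𝓕 G (-ξ)‖ := by gcongr
    _ = 2 ^ p * (‖𝓕 G (-ξ)‖ + ‖ξ‖ ^ (2 * p) * ‖𝓕 G (-ξ)‖) := by ring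
    _ ≤ _ := by
      gcongr
      exact hbd _ _

/-- This is the symmetry `∫ 𝓕f · g = ∫ f · 𝓕g` for `f = 𝓕⁻ φ` and `g` equal to `G` times the
character of frequency `ξ`; the modulation turns the transform of `g` into the translate `𝓕⁻ G (ξ -
η)`. -/
theorem fourierInv_mul_eq_convolution {G : ℝ → ℂ} (hG : Integrable G) (φ ψ : 𝓢(ℝ, ℂ))
    (h : ∀ x, ψ x = G x * φ x) (ξ : ℝ) :
    𝓕⁻ ψ ξ = ∫ η, 𝓕⁻ G (ξ - η) * 𝓕⁻ φ η := by
  have e : ∀ x η : ℝ, (Real.fourierChar (-(inner ℝ x η)) : ℂ) * (Real.fourierChar (inner ℝ x ξ) : ℂ)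
      = Real.fourierChar (inner ℝ x (ξ - η)) := by
    intro x η
    rw [inner_sub_right, sub_eq_neg_add, AddChar.map_add_eq_mul, Circle.coe_mul]
  have hg : Integrable fun x => (Real.fourierChar (inner ℝ x ξ) : ℂ) * G x := by
    refine hG.bdd_mul (c := 1) ?_ ?_
    · exact (Real.continuous_fourierChar.comp (by fun_prop)).subtype_val.aestronglyMeasurable
    · exact Filter.Eventually.of_forall fun x => (Circle.norm_coe _).le
  have key := VectorFourier.integral_fourierIntegral_smul_eq_flip (μ := volume) (ν := volume)
    (L := innerₗ ℝ) (f := fun η => 𝓕⁻ φ η)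
    (g := fun x => (Real.fourierChar (inner ℝ x ξ) : ℂ) * G x)
    Real.continuous_fourierChar continuous_inner (𝓕⁻ φ).integrable hg
  have h1 : ∀ x, VectorFourier.fourierIntegral Real.fourierChar volume (innerₗ ℝ)
      (fun η => 𝓕⁻ φ η) x = φ x := by
    intro x
    have : 𝓕 (𝓕⁻ φ) x = φ x := by rw [FourierTransform.fourier_fourierInv_eq]
    rw [← this, SchwartzMap.fourier_coe]
    rfl
  have h2 : ∀ η, VectorFourier.fourierIntegral Real.fourierChar volume (innerₗ ℝ).flip
      (fun x => (Real.fourierChar (inner ℝ x ξ) : ℂ) * G x) η = 𝓕⁻ G (ξ - η) := by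
    intro η
    rw [Real.fourierInv_eq, VectorFourier.fourierIntegral]
    congr 1
    ext x
    simp only [Circle.smul_def, smul_eq_mul, ← mul_assoc]
    congr 1
    rw [← e x η, LinearMap.flip_apply, innerₗ_apply_apply, real_inner_comm]
  simp_rw [h1, h2] at key
  rw [SchwartzMap.fourierInv_coe, Real.fourierInv_eq]
  refine Eq.trans ?_ (key.trans ?_)
  · congr 1
    ext x
    simp only [Circle.smul_def, smul_eq_mul, h]
    ring
  · congr 1
    ext η
    simp [mul_comm]

theorem sobNorm_sq (t : ℝ) (φ : 𝓢(ℝ, ℂ)) :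
    ENNReal.ofReal (sobNorm t φ) ^ 2 = ∫⁻ ξ, (‖weight t ξ‖ₑ * ‖𝓕⁻ φ ξ‖ₑ) ^ 2 := by
  rw [sobNorm, ofReal_norm, Lp.enorm_def, eLpNorm_congr_ae (weightedL2_coe t φ),
    eLpNorm_eq_lintegral_rpow_enorm_toReal (by norm_num) (by norm_num), ← ENNReal.rpow_natCast,
    ← ENNReal.rpow_mul]
  simp

/-- Only the values of `g` on the support of `φ` matter, so `g` may be replaced by a compactly
supported extension `G`. Multiplication becomes convolution with `𝓕⁻ G`; Peetre's inequality
distributes the weight over both factors, and Young's inequality bounds the result by the `L¹` norm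
of the weighted kernel. -/
theorem sobNorm_mul_le {a b : ℝ} (hab : a < b) {g : ℝ → ℂ} (hg : ContDiffOn ℝ ∞ g (Icc a b))
    (t : ℝ) : ∃ C, 0 ≤ C ∧ ∀ φ ψ : 𝓢(ℝ, ℂ), tsupport φ ⊆ Ioo a b → (∀ x, ψ x = g x * φ x) →
      sobNorm t ψ ≤ C * sobNorm t φ := by
  -- Decay of order `(1 + ξ²)^(-p)` absorbs the weight `(1 + ξ²)^(|t|/2)` and leaves the integrable
  -- factor `(1 + ξ²)⁻¹`.
  obtain ⟨p, hp⟩ := exists_nat_ge (|t| / 2 + 1)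
  obtain ⟨G, hG, hGc, hGg⟩ := exists_compactSupport_eqOn_Icc hab (2 * p) g
    (contDiffOn_infty.1 hg (2 * p))
  have hGi : Integrable G := hG.continuous.integrable_of_hasCompactSupport hGc
  obtain ⟨C, hC0, hC⟩ := exists_norm_fourierInv_le p hG hGc
  have hGcont : Continuous (𝓕⁻ G) := by
    have : 𝓕⁻ G = fun ξ => 𝓕 G (-ξ) := funext fun ξ => Real.fourierInv_eq_fourier_neg _ _
    rw [this]
    exact (VectorFourier.fourierIntegral_continuous Real.continuous_fourierChar
      (by fun_prop) hGi).comp continuous_neg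
  set k : ℝ → ENNReal := fun ξ => ‖weight |t| ξ‖ₑ * ‖𝓕⁻ G ξ‖ₑ with hk
  have hkm : Measurable k := by
    have := (weight_hasTemperateGrowth |t|).1.continuous
    fun_prop
  have hkint : ∫⁻ ξ, k ξ < ⊤ := by
    have hint : Integrable fun ξ : ℝ => C * (1 + ‖ξ‖ ^ 2) ^ (-2 / 2 : ℝ) :=
      (integrable_rpow_neg_one_add_norm_sq (by simp)).const_mul C
    refine lt_of_le_of_lt (lintegral_mono fun ξ => ?_) hint.lintegral_lt_top
    rw [hk]
    simp only [← enorm_mul]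
    rw [← ofReal_norm]
    refine ENNReal.ofReal_le_ofReal ?_
    rw [norm_mul, norm_weight]
    have h1 : (1 + ‖ξ‖ ^ 2) ^ (|t| / 2) ≤ (1 + ‖ξ‖ ^ 2) ^ p * (1 + ‖ξ‖ ^ 2) ^ (-2 / 2 : ℝ) := by
      rw [← Real.rpow_natCast _ p, ← Real.rpow_add (by positivity)]
      exact Real.rpow_le_rpow_of_exponent_le (by nlinarith [sq_nonneg ‖ξ‖]) (by linarith)
    calc _ ≤ (1 + ‖ξ‖ ^ 2) ^ p * (1 + ‖ξ‖ ^ 2) ^ (-2 / 2 : ℝ) * ‖𝓕⁻ G ξ‖ := by gcongr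
      _ = ((1 + ‖ξ‖ ^ 2) ^ p * ‖𝓕⁻ G ξ‖) * (1 + ‖ξ‖ ^ 2) ^ (-2 / 2 : ℝ) := by ring
      _ ≤ _ := by gcongr; exact hC ξ
  refine ⟨2 ^ (|t| / 2) * (∫⁻ ξ, k ξ).toReal, by positivity, fun φ ψ hφ hψ => ?_⟩
  have hψG : ∀ x, ψ x = G x * φ x := by
    intro x
    by_cases hx : x ∈ Icc a b
    · rw [hψ, hGg hx]
    · have : φ x = 0 := by
        by_contra h
        exact hx (Ioo_subset_Icc_self (hφ (subset_tsupport _ h)))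
      rw [hψ, this, mul_zero, mul_zero]
  have hb : Measurable fun η => ‖weight t η‖ₑ * ‖𝓕⁻ φ η‖ₑ := by
    have := (weight_hasTemperateGrowth t).1.continuous
    have := (𝓕⁻ φ).continuous
    fun_prop
  have hpt : ∀ ξ, ‖weight t ξ‖ₑ * ‖𝓕⁻ ψ ξ‖ₑ ≤
      ENNReal.ofReal (2 ^ (|t| / 2)) * ∫⁻ η, k (ξ - η) * (‖weight t η‖ₑ * ‖𝓕⁻ φ η‖ₑ) := by
    intro ξ
    rw [fourierInv_mul_eq_convolution hGi φ ψ hψG ξ]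
    calc _ ≤ ‖weight t ξ‖ₑ * ∫⁻ η, ‖𝓕⁻ G (ξ - η)‖ₑ * ‖𝓕⁻ φ η‖ₑ := by
          gcongr
          simp_rw [← enorm_mul]
          exact enorm_integral_le_lintegral_enorm _
      _ = ∫⁻ η, ‖weight t ξ‖ₑ * (‖𝓕⁻ G (ξ - η)‖ₑ * ‖𝓕⁻ φ η‖ₑ) := by
          rw [lintegral_const_mul' _ _ enorm_ne_top]
      _ ≤ ∫⁻ η, ENNReal.ofReal (2 ^ (|t| / 2)) *
            (k (ξ - η) * (‖weight t η‖ₑ * ‖𝓕⁻ φ η‖ₑ)) := by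
          refine lintegral_mono fun η => ?_
          have := norm_weight_le t ξ η
          have h2 : ‖weight t ξ‖ₑ ≤ ENNReal.ofReal (2 ^ (|t| / 2)) *
              (‖weight |t| (ξ - η)‖ₑ * ‖weight t η‖ₑ) := by
            simp only [← ofReal_norm]
            rw [← ENNReal.ofReal_mul (by positivity), ← ENNReal.ofReal_mul (by positivity)]
            exact ENNReal.ofReal_le_ofReal this
          calc _ ≤ (ENNReal.ofReal (2 ^ (|t| / 2)) *
              (‖weight |t| (ξ - η)‖ₑ * ‖weight t η‖ₑ)) * (‖𝓕⁻ G (ξ - η)‖ₑ * ‖𝓕⁻ φ η‖ₑ) := by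
                gcongr
            _ = _ := by rw [hk]; ring
      _ = _ := by rw [lintegral_const_mul' _ _ ENNReal.ofReal_ne_top]
  have hfin : ENNReal.ofReal (sobNorm t ψ) ^ 2 ≤
      (ENNReal.ofReal (2 ^ (|t| / 2)) * (∫⁻ ξ, k ξ) * ENNReal.ofReal (sobNorm t φ)) ^ 2 := by
    rw [sobNorm_sq]
    calc _ ≤ ∫⁻ ξ, (ENNReal.ofReal (2 ^ (|t| / 2)) *
          ∫⁻ η, k (ξ - η) * (‖weight t η‖ₑ * ‖𝓕⁻ φ η‖ₑ)) ^ 2 :=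
          lintegral_mono fun ξ => pow_le_pow_left' (hpt ξ) 2
      _ = ENNReal.ofReal (2 ^ (|t| / 2)) ^ 2 *
          ∫⁻ ξ, (∫⁻ η, k (ξ - η) * (‖weight t η‖ₑ * ‖𝓕⁻ φ η‖ₑ)) ^ 2 := by
          simp_rw [mul_pow]
          rw [lintegral_const_mul' _ _ (by finiteness)]
      _ ≤ ENNReal.ofReal (2 ^ (|t| / 2)) ^ 2 *
          ((∫⁻ ξ, k ξ) ^ 2 * ∫⁻ η, (‖weight t η‖ₑ * ‖𝓕⁻ φ η‖ₑ) ^ 2) := by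
          gcongr
          exact lintegral_sq_convolution_le hkm hb
      _ = (ENNReal.ofReal (2 ^ (|t| / 2)) * (∫⁻ ξ, k ξ) * ENNReal.ofReal (sobNorm t φ)) ^ 2 := by
          rw [mul_pow, mul_pow, sobNorm_sq, mul_assoc]
  have h4 := (ENNReal.pow_le_pow_left_iff (two_ne_zero)).1 hfin
  rw [← ENNReal.ofReal_toReal hkint.ne, ← ENNReal.ofReal_mul (by positivity),
    ← ENNReal.ofReal_mul (by positivity)] at h4
  exact (ENNReal.ofReal_le_ofReal_iff
    (mul_nonneg (by positivity) (sobNorm_nonneg t φ))).1 h4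

/-! ### Operations on test functions -/

theorem TestFun.eq_zero (φ : TestFun a b) {x : ℝ} (hx : x ∉ Ioo a b) : (φ : 𝓢(ℝ, ℂ)) x = 0 := by
  by_contra h
  exact hx (φ.2 (subset_tsupport _ h))

theorem TestFun.hasCompactSupport (φ : TestFun a b) : HasCompactSupport (φ : 𝓢(ℝ, ℂ)) :=
  isCompact_Icc.of_isClosed_subset (isClosed_tsupport _) (φ.2.trans Ioo_subset_Icc_self)

theorem TestFun.contDiff (φ : TestFun a b) : ContDiff ℝ ∞ (φ : 𝓢(ℝ, ℂ)) :=
  (φ : 𝓢(ℝ, ℂ)).smooth ⊤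

theorem TestFun.ext {φ ψ : TestFun a b} (h : ∀ x, (φ : 𝓢(ℝ, ℂ)) x = (ψ : 𝓢(ℝ, ℂ)) x) : φ = ψ :=
  Subtype.ext (SchwartzMap.ext h)

/-- A test function given by a function. -/
def TestFun.mk (f : ℝ → ℂ) (hf : ContDiff ℝ ∞ f) (hs : tsupport f ⊆ Ioo a b) : TestFun a b :=
  ⟨HasCompactSupport.toSchwartzMap (isCompact_Icc.of_isClosed_subset (isClosed_tsupport f)
    (hs.trans Ioo_subset_Icc_self)) hf, hs⟩

@[simp]
theorem TestFun.mk_apply (f : ℝ → ℂ) (hf : ContDiff ℝ ∞ f) (hs : tsupport f ⊆ Ioo a b) (x : ℝ) :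
    (TestFun.mk f hf hs : 𝓢(ℝ, ℂ)) x = f x := rfl

theorem contDiff_mul_testFun {g : ℝ → ℂ} (hg : ContDiffOn ℝ ∞ g (Icc a b)) (φ : TestFun a b) :
    ContDiff ℝ ∞ fun x => g x * (φ : 𝓢(ℝ, ℂ)) x := by
  rw [contDiff_iff_contDiffAt]
  intro x
  by_cases hx : x ∈ tsupport (φ : 𝓢(ℝ, ℂ))
  · have hx' := φ.2 hx
    exact (hg.contDiffAt (Icc_mem_nhds hx'.1 hx'.2)).mul (TestFun.contDiff φ).contDiffAt
  · refine (contDiffAt_const (c := (0 : ℂ))).congr_of_eventuallyEq ?_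
    filter_upwards [notMem_tsupport_iff_eventuallyEq.1 hx] with y hy
    rw [hy]; simp

open scoped Classical in
/-- Multiplication of test functions by a function which is smooth on `[a, b]`. -/
def mulTest (g : ℝ → ℂ) : TestFun a b →ₗ[ℂ] TestFun a b :=
  -- The default value 0 makes the operator total in `g`, so that estimates and boundedness
  -- statements hold for every `g`.
  if hg : ContDiffOn ℝ ∞ g (Icc a b) then
    { toFun := fun φ => TestFun.mk (fun x => g x * (φ : 𝓢(ℝ, ℂ)) x) (contDiff_mul_testFun hg φ)
        ((tsupport_mul_subset_right).trans φ.2)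
      map_add' := fun _ _ => TestFun.ext fun x => mul_add (g x) _ _
      map_smul' := fun c _ => TestFun.ext fun x => mul_left_comm (g x) c _ }
  else 0

theorem mulTest_apply {g : ℝ → ℂ} (hg : ContDiffOn ℝ ∞ g (Icc a b)) (φ : TestFun a b) (x : ℝ) :
    (mulTest g φ : 𝓢(ℝ, ℂ)) x = g x * (φ : 𝓢(ℝ, ℂ)) x := by
  simp [mulTest, hg]

/-- Differentiation of test functions. -/
def derivTest : TestFun a b →ₗ[ℂ] TestFun a b where
  toFun φ := ⟨SchwartzMap.derivCLM ℂ ℂ φ, by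
    have : ((SchwartzMap.derivCLM ℂ ℂ (φ : 𝓢(ℝ, ℂ)) : 𝓢(ℝ, ℂ)) : ℝ → ℂ) =
        deriv (φ : 𝓢(ℝ, ℂ)) := funext fun x => SchwartzMap.derivCLM_apply ℂ _ x
    change tsupport _ ⊆ _
    rw [this]
    exact tsupport_deriv_subset.trans φ.2⟩
  map_add' φ ψ := Subtype.ext (map_add (SchwartzMap.derivCLM ℂ ℂ) (φ : 𝓢(ℝ, ℂ)) ψ)
  map_smul' c φ := Subtype.ext (map_smul (SchwartzMap.derivCLM ℂ ℂ) c (φ : 𝓢(ℝ, ℂ)))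

theorem derivTest_apply (φ : TestFun a b) (x : ℝ) :
    (derivTest φ : 𝓢(ℝ, ℂ)) x = deriv (φ : 𝓢(ℝ, ℂ)) x := SchwartzMap.derivCLM_apply ℂ _ x

theorem contDiffOn_derivWithin (hab : a < b) {g : ℝ → ℂ} (hg : ContDiffOn ℝ ∞ g (Icc a b)) :
    ContDiffOn ℝ ∞ (derivWithin g (Icc a b)) (Icc a b) :=
  hg.derivWithin (uniqueDiffOn_Icc hab) (by simp)

theorem derivTest_mulTest (hab : a < b) {g : ℝ → ℂ} (hg : ContDiffOn ℝ ∞ g (Icc a b))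
    (φ : TestFun a b) :
    derivTest (mulTest g φ) =
      mulTest (derivWithin g (Icc a b)) φ + mulTest g (derivTest φ) := by
  refine TestFun.ext fun x => ?_
  rw [Submodule.coe_add, _root_.add_apply, mulTest_apply (contDiffOn_derivWithin hab hg),
    mulTest_apply hg, derivTest_apply, derivTest_apply]
  by_cases hx : x ∈ Ioo a b
  · have hn := Icc_mem_nhds hx.1 hx.2
    have h1 : DifferentiableAt ℝ g x := (hg.contDiffAt hn).differentiableAt (by simp)
    have h2 : DifferentiableAt ℝ (φ : 𝓢(ℝ, ℂ)) x := (TestFun.contDiff φ).contDiffAt.differentiableAt (by simp)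
    have : ((mulTest g φ : 𝓢(ℝ, ℂ)) : ℝ → ℂ) = fun x => g x * (φ : 𝓢(ℝ, ℂ)) x :=
      funext fun x => mulTest_apply hg φ x
    rw [this, deriv_fun_mul h1 h2, derivWithin_of_mem_nhds hn]
  · rw [← derivTest_apply, ← derivTest_apply, TestFun.eq_zero _ hx, TestFun.eq_zero _ hx,
      TestFun.eq_zero _ hx]
    simp

/-! ### Estimates for test functions -/

theorem exists_sobNorm_mulTest_le (hab : a < b) (g : ℝ → ℂ) (t : ℝ) :
    ∃ C, 0 ≤ C ∧ ∀ φ : TestFun a b, sobNorm t (mulTest g φ) ≤ C * sobNorm t φ := by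
  by_cases hg : ContDiffOn ℝ ∞ g (Icc a b)
  · obtain ⟨C, hC0, hC⟩ := sobNorm_mul_le hab hg t
    exact ⟨C, hC0, fun φ => hC φ _ φ.2 (mulTest_apply hg φ)⟩
  · refine ⟨0, le_rfl, fun φ => ?_⟩
    simp [mulTest, hg, sobNorm]

theorem sobNorm_derivTest_le (t : ℝ) (φ : TestFun a b) :
    sobNorm t (derivTest φ) ≤ 2 * Real.pi * sobNorm (t + 1) φ :=
  sobNorm_deriv_le t φ

/-- Poincaré's inequality in Sobolev spaces of arbitrary order. -/
theorem exists_sobNorm_le_derivTest (hab : a < b) (t : ℝ) :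
    ∃ C, 0 ≤ C ∧ ∀ φ : TestFun a b, sobNorm (t + 1) φ ≤ C * sobNorm t (derivTest φ) := by
  have hX : ContDiffOn ℝ ∞ (fun x : ℝ => (x : ℂ)) (Icc a b) :=
    Complex.ofRealCLM.contDiff.contDiffOn
  obtain ⟨C, hC0, hC⟩ := exists_sobNorm_mulTest_le hab (fun x : ℝ => (x : ℂ)) t
  refine ⟨2 * C + 1, by positivity, fun φ => ?_⟩
  -- The identity `φ = (xφ)' - xφ'`.
  have hφ : (φ : 𝓢(ℝ, ℂ)) = SchwartzMap.derivCLM ℂ ℂ (mulTest (fun x : ℝ => (x : ℂ)) φ : 𝓢(ℝ, ℂ)) -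
      (mulTest (fun x : ℝ => (x : ℂ)) (derivTest φ) : 𝓢(ℝ, ℂ)) := by
    ext x
    rw [_root_.sub_apply, SchwartzMap.derivCLM_apply, mulTest_apply hX, derivTest_apply]
    have h2 : DifferentiableAt ℝ (φ : 𝓢(ℝ, ℂ)) x :=
      (TestFun.contDiff φ).contDiffAt.differentiableAt (by simp)
    have h1 : HasDerivAt (fun x : ℝ => (x : ℂ)) 1 x := Complex.ofRealCLM.hasDerivAt
    have : ((mulTest (fun x : ℝ => (x : ℂ)) φ : 𝓢(ℝ, ℂ)) : ℝ → ℂ) =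
        fun x : ℝ => (x : ℂ) * (φ : 𝓢(ℝ, ℂ)) x := funext fun x => mulTest_apply hX φ x
    rw [this, (h1.fun_mul h2.hasDerivAt).deriv]
    ring
  have key : sobNorm t φ ≤ 2 * C * sobNorm t (derivTest φ) := by
    -- Pair the identity with `φ` and move the derivative off `xφ`. Multiplication by `x` is bounded
    -- in every order because the supports lie in `(a, b)`, so each term is at most a constant times
    -- `‖φ'‖ ‖φ‖`, and one factor `‖φ‖` cancels.
    have h1 : (‖weightedL2 t φ‖ : ℝ) ^ 2 ≤
        ‖weightedL2 t (SchwartzMap.derivCLM ℂ ℂ (φ : 𝓢(ℝ, ℂ)))‖ *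
          ‖weightedL2 t (mulTest (fun x : ℝ => (x : ℂ)) φ)‖ +
        ‖weightedL2 t φ‖ * ‖weightedL2 t (mulTest (fun x : ℝ => (x : ℂ)) (derivTest φ))‖ := by
      have h2 : ‖inner ℂ (weightedL2 t φ) (weightedL2 t φ)‖ = ‖weightedL2 t φ‖ ^ 2 := by
        rw [inner_self_eq_norm_sq_to_K]; simp
      rw [← h2]
      nth_rw 2 [hφ]
      rw [map_sub, inner_sub_right]
      refine (norm_sub_le _ _).trans (add_le_add ?_ (norm_inner_le_norm _ _))
      have h3 := inner_weightedL2_deriv t (φ : 𝓢(ℝ, ℂ)) (mulTest (fun x : ℝ => (x : ℂ)) φ)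
      rw [eq_neg_iff_add_eq_zero, add_comm, ← eq_neg_iff_add_eq_zero] at h3
      rw [h3, norm_neg]
      exact norm_inner_le_norm _ _
    change sobNorm t φ ^ 2 ≤ sobNorm t (derivTest φ) * sobNorm t (mulTest _ φ) +
      sobNorm t φ * sobNorm t (mulTest _ (derivTest φ)) at h1
    have h4 := mul_le_mul_of_nonneg_left (hC φ) (sobNorm_nonneg t (derivTest φ))
    have h5 := mul_le_mul_of_nonneg_left (hC (derivTest φ)) (sobNorm_nonneg t φ)
    rcases (sobNorm_nonneg t φ).eq_or_lt with h0 | h0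
    · rw [← h0]; exact mul_nonneg (by positivity) (sobNorm_nonneg _ _)
    · refine le_of_mul_le_mul_left ?_ h0
      nlinarith
  calc sobNorm (t + 1) φ ≤ sobNorm t φ + sobNorm t (derivTest φ) := sobNorm_add_one_le t φ
    _ ≤ _ := by linarith

/-! ### Operations on distributions -/

/-- Multiplication of distributions by a function which is smooth on `[a, b]`. -/
def mulF (g : ℝ → ℂ) : Func a b →ₗ[ℂ] Func a b := LinearMap.lcomp ℂ ℂ (mulTest g)

/-- Differentiation of distributions. -/
def derivF : Func a b →ₗ[ℂ] Func a b := -LinearMap.lcomp ℂ ℂ derivTest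

theorem mulF_apply (g : ℝ → ℂ) (w : Func a b) (φ : TestFun a b) :
    mulF g w φ = w (mulTest g φ) := rfl

theorem derivF_apply (w : Func a b) (φ : TestFun a b) : derivF w φ = -w (derivTest φ) := rfl

theorem mulTest_congr {g h : ℝ → ℂ} (hg : ContDiffOn ℝ ∞ g (Icc a b))
    (hgh : EqOn g h (Icc a b)) : (mulTest g : TestFun a b →ₗ[ℂ] TestFun a b) = mulTest h := by
  refine LinearMap.ext fun φ => TestFun.ext fun x => ?_
  rw [mulTest_apply hg, mulTest_apply (hg.congr hgh.symm)]
  by_cases hx : x ∈ Ioo a b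
  · rw [hgh (Ioo_subset_Icc_self hx)]
  · rw [TestFun.eq_zero _ hx, mul_zero, mul_zero]

theorem mulF_congr {g h : ℝ → ℂ} (hg : ContDiffOn ℝ ∞ g (Icc a b)) (hgh : EqOn g h (Icc a b))
    (w : Func a b) : mulF g w = mulF h w := by
  rw [mulF, mulF, mulTest_congr hg hgh]

theorem mulF_mulF {g h : ℝ → ℂ} (hg : ContDiffOn ℝ ∞ g (Icc a b))
    (hh : ContDiffOn ℝ ∞ h (Icc a b)) (w : Func a b) :
    mulF g (mulF h w) = mulF (fun x => g x * h x) w := by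
  refine LinearMap.ext fun φ => congrArg w (TestFun.ext fun x => ?_)
  rw [mulTest_apply hh, mulTest_apply hg, mulTest_apply (hg.mul hh)]
  ring

theorem mulF_add {g h : ℝ → ℂ} (hg : ContDiffOn ℝ ∞ g (Icc a b))
    (hh : ContDiffOn ℝ ∞ h (Icc a b)) (w : Func a b) :
    mulF (fun x => g x + h x) w = mulF g w + mulF h w := by
  refine LinearMap.ext fun φ => ?_
  rw [LinearMap.add_apply, mulF_apply, mulF_apply, mulF_apply, ← map_add]
  refine congrArg w (TestFun.ext fun x => ?_)
  rw [Submodule.coe_add, _root_.add_apply, mulTest_apply hh, mulTest_apply hg,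
    mulTest_apply (hg.add hh)]
  ring

theorem mulF_sum {ι : Type*} (s : Finset ι) {g : ι → ℝ → ℂ}
    (hg : ∀ i, ContDiffOn ℝ ∞ (g i) (Icc a b)) (w : Func a b) :
    mulF (fun x => ∑ i ∈ s, g i x) w = ∑ i ∈ s, mulF (g i) w := by
  refine LinearMap.ext fun φ => ?_
  rw [LinearMap.sum_apply, mulF_apply]
  simp_rw [mulF_apply]
  rw [← map_sum]
  refine congrArg w (TestFun.ext fun x => ?_)
  rw [mulTest_apply (ContDiffOn.sum fun i _ => hg i), AddSubmonoidClass.coe_finsetSum,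
    _root_.sum_apply, Finset.sum_mul]
  exact Finset.sum_congr rfl fun i _ => (mulTest_apply (hg i) φ x).symm

theorem mulF_const (c : ℂ) (w : Func a b) : mulF (fun _ => c) w = c • w := by
  refine LinearMap.ext fun φ => ?_
  rw [LinearMap.smul_apply, mulF_apply, ← map_smul]
  exact congrArg w (TestFun.ext fun x => mulTest_apply contDiffOn_const φ x)

theorem derivF_mulF (hab : a < b) {g : ℝ → ℂ} (hg : ContDiffOn ℝ ∞ g (Icc a b)) (w : Func a b) :
    derivF (mulF g w) = mulF (derivWithin g (Icc a b)) w + mulF g (derivF w) := by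
  refine LinearMap.ext fun φ => ?_
  have := congrArg w (derivTest_mulTest hab hg φ)
  rw [map_add] at this
  rw [LinearMap.add_apply, derivF_apply, mulF_apply, mulF_apply, mulF_apply, derivF_apply, this]
  ring

/-- The distribution given by a continuous function on `[a, b]`. -/
def funF (f : ℝ → ℂ) (hf : ContinuousOn f (Icc a b)) : Func a b where
  toFun φ := ∫ x in Ioo a b, (φ : 𝓢(ℝ, ℂ)) x * f x
  map_add' φ ψ := by
    have h : ∀ χ : TestFun a b, IntegrableOn (fun x => (χ : 𝓢(ℝ, ℂ)) x * f x) (Ioo a b) :=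
      fun χ => (((χ : 𝓢(ℝ, ℂ)).continuous.continuousOn.mul hf).integrableOn_Icc).mono_set
        Ioo_subset_Icc_self
    rw [← integral_add (h φ) (h ψ)]
    simp [add_mul]
  map_smul' c φ := by
    simp [mul_assoc, integral_const_mul]

theorem represents_iff {f : ℝ → ℂ} (hf : ContinuousOn f (Icc a b)) {w : Func a b} :
    Represents w f ↔ w = funF f hf :=
  ⟨fun h => LinearMap.ext h, fun h φ => by rw [h]; rfl⟩

theorem mulF_funF {f g : ℝ → ℂ} (hf : ContinuousOn f (Icc a b))
    (hg : ContDiffOn ℝ ∞ g (Icc a b)) :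
    mulF g (funF f hf) = funF (fun x => g x * f x) (hg.continuousOn.mul hf) := by
  refine LinearMap.ext fun φ => ?_
  change ∫ x in Ioo a b, (mulTest g φ : 𝓢(ℝ, ℂ)) x * f x = ∫ x in Ioo a b, _
  simp_rw [mulTest_apply hg]
  congr 1; ext x; ring

theorem integral_derivTest_mul (hab : a < b) {f f' : ℝ → ℂ} (hf : ContinuousOn f (Icc a b))
    (hf' : ContinuousOn f' (Icc a b)) (hd : ∀ x ∈ Ioo a b, HasDerivAt f (f' x) x)
    (φ : TestFun a b) :
    ∫ x in Ioo a b, (derivTest φ : 𝓢(ℝ, ℂ)) x * f x =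
      -∫ x in Ioo a b, (φ : 𝓢(ℝ, ℂ)) x * f' x := by
  rw [← integral_Ioc_eq_integral_Ioo, ← integral_Ioc_eq_integral_Ioo,
    ← intervalIntegral.integral_of_le hab.le, ← intervalIntegral.integral_of_le hab.le]
  simp_rw [derivTest_apply]
  have := intervalIntegral.integral_deriv_mul_eq_sub_of_hasDeriv_right (a := a) (b := b)
    (u := (φ : 𝓢(ℝ, ℂ))) (u' := deriv (φ : 𝓢(ℝ, ℂ))) (v := f) (v' := f')
    (φ : 𝓢(ℝ, ℂ)).continuous.continuousOn (by rwa [uIcc_of_le hab.le])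
    (fun x _ => ((TestFun.contDiff φ).contDiffAt.differentiableAt (by simp)).hasDerivAt.hasDerivWithinAt)
    (fun x hx => (hd x (by simpa [hab.le] using hx)).hasDerivWithinAt)
    (((TestFun.contDiff φ).continuous_deriv (by simp)).intervalIntegrable _ _)
    (ContinuousOn.intervalIntegrable (by rwa [uIcc_of_le hab.le]))
  rw [intervalIntegral.integral_add, TestFun.eq_zero φ (by simp), TestFun.eq_zero φ (by simp)] at this
  · linear_combination this
  · refine ContinuousOn.intervalIntegrable ?_
    rw [uIcc_of_le hab.le]
    exact ((TestFun.contDiff φ).continuous_deriv (by simp)).continuousOn.mul hf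
  · refine ContinuousOn.intervalIntegrable ?_
    rw [uIcc_of_le hab.le]
    exact (φ : 𝓢(ℝ, ℂ)).continuous.continuousOn.mul hf'

theorem derivF_funF (hab : a < b) {f f' : ℝ → ℂ} (hf : ContinuousOn f (Icc a b))
    (hf' : ContinuousOn f' (Icc a b)) (hd : ∀ x ∈ Ioo a b, HasDerivAt f (f' x) x) :
    derivF (funF f hf) = funF f' hf' := by
  refine LinearMap.ext fun φ => ?_
  rw [derivF_apply]
  exact neg_eq_iff_eq_neg.2 (integral_derivTest_mul hab hf hf' hd φ)

/-- A test function of integral zero is the derivative of a test function. -/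
theorem exists_derivTest_eq (hab : a < b) (φ : TestFun a b)
    (h : ∫ x in Ioo a b, (φ : 𝓢(ℝ, ℂ)) x = 0) : ∃ χ : TestFun a b, derivTest χ = φ := by
  have hder : ∀ x, HasDerivAt (fun x => ∫ y in a..x, (φ : 𝓢(ℝ, ℂ)) y) ((φ : 𝓢(ℝ, ℂ)) x) x :=
    fun x => intervalIntegral.integral_hasDerivAt_right
      ((φ : 𝓢(ℝ, ℂ)).continuous.intervalIntegrable _ _)
      ((φ : 𝓢(ℝ, ℂ)).continuous.stronglyMeasurableAtFilter _ _)
      (φ : 𝓢(ℝ, ℂ)).continuous.continuousAt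
  have hderiv : deriv (fun x => ∫ y in a..x, (φ : 𝓢(ℝ, ℂ)) y) = (φ : 𝓢(ℝ, ℂ)) :=
    funext fun x => (hder x).deriv
  have hcd : ContDiff ℝ ∞ fun x => ∫ y in a..x, (φ : 𝓢(ℝ, ℂ)) y := by
    rw [contDiff_infty_iff_deriv]
    exact ⟨fun x => (hder x).differentiableAt, by rw [hderiv]; exact (TestFun.contDiff φ)⟩
  -- The primitive from `a` vanishes to the left of `c` trivially, and to the right of `d` because
  -- the total integral is zero; hence its support stays in `[c, d] ⊆ (a, b)`.
  obtain ⟨c, d, hac, hdb, hcd'⟩ : ∃ c d, a < c ∧ d < b ∧ tsupport (φ : 𝓢(ℝ, ℂ)) ⊆ Icc c d := by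
    rcases (tsupport (φ : 𝓢(ℝ, ℂ))).eq_empty_or_nonempty with h0 | hne
    · exact ⟨(a + b) / 2, (a + b) / 2, by linarith, by linarith, by simp [h0]⟩
    · have hc : IsCompact (tsupport (φ : 𝓢(ℝ, ℂ))) := TestFun.hasCompactSupport φ
      exact ⟨_, _, (φ.2 (hc.sInf_mem hne)).1, (φ.2 (hc.sSup_mem hne)).2, fun x hx =>
        ⟨csInf_le hc.bddBelow hx, le_csSup hc.bddAbove hx⟩⟩
  have hz : ∀ x, x ∉ Icc c d → (φ : 𝓢(ℝ, ℂ)) x = 0 := fun x hx => by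
    by_contra h'
    exact hx (hcd' (subset_tsupport _ h'))
  have hsupp : tsupport (fun x => ∫ y in a..x, (φ : 𝓢(ℝ, ℂ)) y) ⊆ Icc c d := by
    refine closure_minimal (fun x hx => ?_) isClosed_Icc
    by_contra hx'
    refine hx ?_
    rcases lt_or_ge x c with h1 | h1
    · change ∫ y in a..x, (φ : 𝓢(ℝ, ℂ)) y = 0
      rw [intervalIntegral.integral_congr (g := fun _ => (0 : ℂ)), intervalIntegral.integral_zero]
      intro y hy
      refine hz y fun hy' => ?_
      have : y < c := lt_of_le_of_lt hy.2 (max_lt hac h1)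
      linarith [hy'.1]
    · have h2 : d < x := by
        by_contra h3
        exact hx' ⟨h1, not_lt.1 h3⟩
      change ∫ y in a..x, (φ : 𝓢(ℝ, ℂ)) y = 0
      rw [← intervalIntegral.integral_add_adjacent_intervals (b := b)
        ((φ : 𝓢(ℝ, ℂ)).continuous.intervalIntegrable _ _)
        ((φ : 𝓢(ℝ, ℂ)).continuous.intervalIntegrable _ _),
        intervalIntegral.integral_of_le hab.le, integral_Ioc_eq_integral_Ioo, h, zero_add,
        intervalIntegral.integral_congr (g := fun _ => (0 : ℂ)), intervalIntegral.integral_zero]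
      intro y hy
      refine hz y fun hy' => ?_
      have : d < y := lt_of_lt_of_le (lt_min hdb h2) hy.1
      linarith [hy'.2]
  refine ⟨TestFun.mk _ hcd (hsupp.trans fun x hx => ⟨hac.trans_le hx.1, hx.2.trans_lt hdb⟩),
    TestFun.ext fun x => ?_⟩
  rw [derivTest_apply, ← (hder x).deriv]
  rfl

theorem exists_testFun_integral_eq_one (hab : a < b) :
    ∃ η : TestFun a b, ∫ x in Ioo a b, (η : 𝓢(ℝ, ℂ)) x = 1 := by
  obtain ⟨χ, hχ⟩ : ∃ χ : ContDiffBump ((a + b) / 2 : ℝ), χ.rOut = (b - a) / 4 :=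
    ⟨⟨(b - a) / 8, (b - a) / 4, by linarith, by linarith⟩, rfl⟩
  have hcd : ContDiff ℝ ∞ fun x => ((χ.normed volume x : ℝ) : ℂ) :=
    Complex.ofRealCLM.contDiff.comp χ.contDiff_normed
  have hs : tsupport (fun x => ((χ.normed volume x : ℝ) : ℂ)) ⊆ Ioo a b := by
    have h1 : tsupport (fun x => ((χ.normed volume x : ℝ) : ℂ)) ⊆ tsupport (χ.normed volume) := by
      refine closure_mono fun x hx => ?_
      intro h
      exact hx (by simp [h])
    refine h1.trans ?_
    rw [χ.tsupport_normed_eq, hχ]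
    intro x hx
    rw [Metric.mem_closedBall, Real.dist_eq, abs_le] at hx
    constructor <;> linarith [hx.1, hx.2]
  refine ⟨TestFun.mk _ hcd hs, ?_⟩
  simp_rw [TestFun.mk_apply]
  rw [setIntegral_eq_integral_of_forall_compl_eq_zero, integral_complex_ofReal, χ.integral_normed]
  · simp
  · intro x hx
    by_contra h
    exact hx (hs (subset_tsupport _ h))

/-- The lemma of du Bois-Reymond. -/
theorem eq_const_of_derivF_eq_zero (hab : a < b) {w : Func a b} (h : derivF w = 0) :
    ∃ c : ℂ, w = c • funF (fun _ => 1) continuousOn_const := by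
  obtain ⟨η, hη⟩ := exists_testFun_integral_eq_one hab
  refine ⟨w η, LinearMap.ext fun φ => ?_⟩
  have hI : ∀ χ : TestFun a b, funF (a := a) (b := b) (fun _ => 1) continuousOn_const χ =
      ∫ x in Ioo a b, (χ : 𝓢(ℝ, ℂ)) x := fun χ => by
    change ∫ x in Ioo a b, (χ : 𝓢(ℝ, ℂ)) x * 1 = _
    simp
  -- Subtracting a multiple of `η`, whose integral is 1, leaves a test function of integral zero,
  -- which is a derivative and is therefore annihilated by `w`.
  obtain ⟨χ, hχ⟩ := exists_derivTest_eq hab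
    (φ - (funF (a := a) (b := b) (fun _ => 1) continuousOn_const φ) • η) (by
      rw [← hI, map_sub, map_smul, hI η, hη]; simp)
  have h2 : w (derivTest χ) = 0 := by
    have := LinearMap.congr_fun h χ
    rw [derivF_apply] at this
    simpa using this
  rw [hχ, map_sub, map_smul] at h2
  rw [LinearMap.smul_apply, smul_eq_mul, mul_comm]
  exact sub_eq_zero.1 h2

/-! ### Sobolev regularity of distributions on an interval -/

/-- The Fourier transform of the weighted Fourier transform, as an element of `L²`: the Bessel
potential of order `t`. -/
def besselL2 (t : ℝ) : 𝓢(ℝ, ℂ) →ₗ[ℂ] Lp ℂ 2 (volume : Measure ℝ) :=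
  ((SchwartzMap.toLpCLM ℂ ℂ 2 volume).comp
    ((FourierTransform.fourierCLM ℂ 𝓢(ℝ, ℂ)).comp (weighted t))).toLinearMap

theorem norm_besselL2 (t : ℝ) (φ : 𝓢(ℝ, ℂ)) : ‖besselL2 t φ‖ = sobNorm t φ :=
  SchwartzMap.norm_fourier_toL2_eq (weighted t φ)

theorem besselL2_coe (t : ℝ) (φ : 𝓢(ℝ, ℂ)) : besselL2 t φ =ᵐ[volume] (𝓕 (weighted t φ) : 𝓢(ℝ, ℂ)) :=
  (𝓕 (weighted t φ)).coeFn_toLp 2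

theorem norm_star_L2 (v : Lp ℂ 2 (volume : Measure ℝ)) : ‖star v‖ = ‖v‖ := by
  rw [Lp.norm_def, Lp.norm_def, eLpNorm_congr_ae (Lp.coeFn_star v), eLpNorm_star]

theorem ofL2_apply (s : ℝ) (v : Lp ℂ 2 (volume : Measure ℝ)) (φ : 𝓢(ℝ, ℂ)) :
    ofL2 s v φ = ∫ x, 𝓕 (weighted (-s) φ) x * v x := by
  have h : ofL2 s v φ = (v : 𝓢'(ℝ, ℂ)) (𝓕 (SchwartzMap.smulLeftCLM ℂ
    (fun x : ℝ => (((1 + ‖x‖ ^ 2) ^ (-s / 2) : ℝ) : ℂ)) (𝓕⁻ φ))) := rfl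
  rw [h, Lp.toTemperedDistribution_apply]
  rfl

/-- The pairing of distributions is bilinear and the `L²` inner product is conjugate-linear on the
left, hence the conjugate. In this form Cauchy--Schwarz and the Riesz representation become
applicable. -/
theorem ofL2_eq_inner (s : ℝ) (v : Lp ℂ 2 (volume : Measure ℝ)) (φ : 𝓢(ℝ, ℂ)) :
    ofL2 s v φ = inner ℂ (star v) (besselL2 (-s) φ) := by
  rw [ofL2_apply, MeasureTheory.L2.inner_def]
  refine integral_congr_ae ?_
  filter_upwards [Lp.coeFn_star v, besselL2_coe (-s) φ] with x h1 h2
  rw [h1, h2]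
  simp

theorem norm_ofL2_le (s : ℝ) (v : Lp ℂ 2 (volume : Measure ℝ)) (φ : 𝓢(ℝ, ℂ)) :
    ‖ofL2 s v φ‖ ≤ ‖v‖ * sobNorm (-s) φ := by
  rw [ofL2_eq_inner, ← norm_besselL2, ← norm_star_L2 v]
  exact norm_inner_le_norm _ _

theorem Sob.toFunc_mk {s : ℝ} (v : Lp ℂ 2 (volume : Measure ℝ)) (φ : TestFun a b) :
    Sob.toFunc (Submodule.Quotient.mk v : Sob a b s) φ = ofL2 s v φ := rfl

theorem Sob.norm_toFunc_le {s : ℝ} (u : Sob a b s) (φ : TestFun a b) :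
    ‖u.toFunc φ‖ ≤ ‖u‖ * sobNorm (-s) φ := by
  refine le_of_forall_pos_le_add fun δ hδ => ?_
  -- The quotient norm is an infimum, approached up to an error; the added 1 covers the case of norm
  -- zero.
  have hδ' : 0 < δ / (sobNorm (-s) φ + 1) :=
    div_pos hδ (by linarith [sobNorm_nonneg (-s) (φ : 𝓢(ℝ, ℂ))])
  obtain ⟨v, rfl, hv⟩ := Submodule.Quotient.norm_mk_lt u hδ'
  rw [Sob.toFunc_mk]
  have h0 := sobNorm_nonneg (-s) (φ : 𝓢(ℝ, ℂ))
  refine (norm_ofL2_le s v φ).trans ?_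
  have h1 : δ / (sobNorm (-s) φ + 1) * sobNorm (-s) φ ≤ δ := by
    rw [div_mul_eq_mul_div, div_le_iff₀ (by linarith)]
    nlinarith
  nlinarith [mul_le_mul_of_nonneg_right hv.le h0]

/-- A functional which is bounded in the dual norm on a space of test functions extends to an
element of the Sobolev space. -/
theorem exists_sob_extension {s C : ℝ} (hC : 0 ≤ C) {V : Type*} [AddCommGroup V] [Module ℂ V]
    (J : V →ₗ[ℂ] TestFun a b) (ℓ : V →ₗ[ℂ] ℂ) (h : ∀ v, ‖ℓ v‖ ≤ C * sobNorm (-s) (J v)) :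
    ∃ u : Sob a b s, (∀ v, u.toFunc (J v) = ℓ v) ∧ ‖u‖ ≤ C := by
  set j : V →ₗ[ℂ] Lp ℂ 2 (volume : Measure ℝ) :=
    (besselL2 (-s)) ∘ₗ (TestFun a b).subtype ∘ₗ J with hj
  have hjn : ∀ v, ‖j v‖ = sobNorm (-s) (J v) := fun v => norm_besselL2 _ _
  -- The estimate makes `ℓ` well defined on the image of `j` in `L²`; Hahn--Banach extends it with
  -- the same norm, and the Riesz vector of the extension, conjugated, represents the required
  -- element.
  have hker : LinearMap.ker j ≤ LinearMap.ker ℓ := by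
    intro v hv
    rw [LinearMap.mem_ker] at hv ⊢
    have := h v
    rw [← hjn, hv, norm_zero, mul_zero] at this
    exact norm_le_zero_iff.1 this
  set f₀ : LinearMap.range j →ₗ[ℂ] ℂ :=
    (LinearMap.ker j).liftQ ℓ hker ∘ₗ j.quotKerEquivRange.symm.toLinearMap with hf₀
  have hf : ∀ v, f₀ ⟨j v, LinearMap.mem_range_self j v⟩ = ℓ v := by
    intro v
    rw [hf₀, LinearMap.comp_apply, LinearEquiv.coe_coe, LinearMap.quotKerEquivRange_symm_apply_image]
    rfl
  have hbd : ∀ x, ‖f₀ x‖ ≤ C * ‖x‖ := by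
    rintro ⟨_, v, rfl⟩
    rw [hf, Submodule.coe_norm, hjn]
    exact h v
  obtain ⟨g, hg, hgn⟩ := exists_extension_norm_eq _ (f₀.mkContinuous C hbd)
  set y := (InnerProductSpace.toDual ℂ (Lp ℂ 2 (volume : Measure ℝ))).symm g with hy
  have hyg : ∀ x, inner ℂ y x = g x := fun x => InnerProductSpace.toDual_symm_apply
  refine ⟨Submodule.Quotient.mk (star y), fun v => ?_, ?_⟩
  · rw [Sob.toFunc_mk, ofL2_eq_inner, star_star, hyg, ← hf v]
    exact hg ⟨j v, LinearMap.mem_range_self j v⟩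
  · calc _ ≤ ‖star y‖ := Submodule.Quotient.norm_mk_le _ _
      _ = ‖g‖ := by rw [norm_star_L2, hy, LinearIsometryEquiv.norm_map]
      _ ≤ C := by rw [hgn]; exact LinearMap.mkContinuous_norm_le _ hC _

/-- Membership of a distribution in `H^s(a, b)`, in terms of the dual estimate. -/
def MemSob (s : ℝ) (w : Func a b) : Prop := ∃ C, 0 ≤ C ∧ ∀ φ, ‖w φ‖ ≤ C * sobNorm (-s) φ

theorem memSob_toFunc {s : ℝ} (u : Sob a b s) : MemSob s u.toFunc :=
  ⟨‖u‖, norm_nonneg _, u.norm_toFunc_le⟩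

theorem exists_sob_of_le {s C : ℝ} (hC : 0 ≤ C) {w : Func a b}
    (h : ∀ φ, ‖w φ‖ ≤ C * sobNorm (-s) φ) : ∃ u : Sob a b s, u.toFunc = w ∧ ‖u‖ ≤ C := by
  obtain ⟨u, hu, hn⟩ := exists_sob_extension hC LinearMap.id w h
  exact ⟨u, LinearMap.ext hu, hn⟩

theorem MemSob.exists_sob {s : ℝ} {w : Func a b} (h : MemSob s w) :
    ∃ u : Sob a b s, u.toFunc = w := by
  obtain ⟨C, hC0, hC⟩ := h
  obtain ⟨u, hu, -⟩ := exists_sob_of_le hC0 hC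
  exact ⟨u, hu⟩

theorem MemSob.add {s : ℝ} {w₁ w₂ : Func a b} (h₁ : MemSob s w₁) (h₂ : MemSob s w₂) :
    MemSob s (w₁ + w₂) := by
  obtain ⟨C₁, h10, h1⟩ := h₁
  obtain ⟨C₂, h20, h2⟩ := h₂
  refine ⟨C₁ + C₂, by positivity, fun φ => ?_⟩
  rw [add_mul]
  exact (norm_add_le _ _).trans (add_le_add (h1 φ) (h2 φ))

theorem MemSob.smul {s : ℝ} {w : Func a b} (h : MemSob s w) (c : ℂ) : MemSob s (c • w) := by
  obtain ⟨C, h0, h1⟩ := h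
  refine ⟨‖c‖ * C, by positivity, fun φ => ?_⟩
  rw [LinearMap.smul_apply, norm_smul, mul_assoc]
  gcongr
  exact h1 φ

theorem MemSob.zero {s : ℝ} : MemSob s (0 : Func a b) := ⟨0, le_rfl, fun φ => by simp⟩

theorem MemSob.sum {s : ℝ} {ι : Type*} (S : Finset ι) {w : ι → Func a b}
    (h : ∀ i, MemSob s (w i)) : MemSob s (∑ i ∈ S, w i) :=
  Finset.sum_induction _ _ (fun _ _ => MemSob.add) MemSob.zero fun i _ => h i

theorem MemSob.mono {s s' : ℝ} (hs : s' ≤ s) {w : Func a b} (h : MemSob s w) : MemSob s' w := by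
  obtain ⟨C, h0, h1⟩ := h
  exact ⟨C, h0, fun φ => (h1 φ).trans
    (mul_le_mul_of_nonneg_left (sobNorm_mono (by linarith) _) h0)⟩

theorem MemSob.mulF (hab : a < b) {s : ℝ} {w : Func a b} (h : MemSob s w) (g : ℝ → ℂ) :
    MemSob s (mulF g w) := by
  obtain ⟨C, h0, h1⟩ := h
  obtain ⟨C', h0', h1'⟩ := exists_sobNorm_mulTest_le hab g (-s)
  refine ⟨C * C', by positivity, fun φ => ?_⟩
  rw [mulF_apply, mul_assoc]
  exact (h1 _).trans (mul_le_mul_of_nonneg_left (h1' φ) h0)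

theorem MemSob.derivF {s : ℝ} {w : Func a b} (h : MemSob s w) : MemSob (s - 1) (derivF w) := by
  obtain ⟨C, h0, h1⟩ := h
  refine ⟨C * (2 * Real.pi), by positivity, fun φ => ?_⟩
  rw [derivF_apply, norm_neg, mul_assoc]
  refine (h1 _).trans (mul_le_mul_of_nonneg_left ?_ h0)
  rw [show -(s - 1) = -s + 1 by ring]
  exact sobNorm_derivTest_le _ φ

/-- Every element of `H^s(a, b)` has a primitive in `H^{s+1}(a, b)`. -/
theorem MemSob.exists_primitive (hab : a < b) {s : ℝ} {w : Func a b} (h : MemSob s w) :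
    ∃ u : Func a b, OrrSommerfeld.derivF u = w ∧ MemSob (s + 1) u := by
  obtain ⟨C, h0, h1⟩ := h
  obtain ⟨C', h0', h1'⟩ := exists_sobNorm_le_derivTest hab (-s - 1)
  -- A primitive is prescribed on derivatives only: `u(φ') = -w(φ)`. Poincaré's inequality is
  -- exactly the bound that allows this functional to be extended to all test functions.
  obtain ⟨u, hu, -⟩ := exists_sob_extension (s := s + 1) (C := C * C') (by positivity) derivTest
    (-w) (fun φ => by
      rw [LinearMap.neg_apply, norm_neg, mul_assoc, show -(s + 1) = -s - 1 by ring]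
      refine (h1 φ).trans (mul_le_mul_of_nonneg_left ?_ h0)
      have := h1' φ
      rwa [sub_add_cancel] at this)
  refine ⟨u.toFunc, LinearMap.ext fun φ => ?_, memSob_toFunc u⟩
  rw [derivF_apply, hu]
  simp

/-- On `(a, b)` the constant 1 coincides with a smooth cutoff, which is a Schwartz function and so
belongs to every `H^s(ℝ)`. Multiplication then yields all smooth functions on `[a, b]`. -/
theorem memSob_one (hab : a < b) (s : ℝ) :
    MemSob s (funF (a := a) (b := b) (fun _ => 1) continuousOn_const) := by
  obtain ⟨G, hG, hGc, hG1⟩ : ∃ G : ℝ → ℂ, ContDiff ℝ ∞ G ∧ HasCompactSupport G ∧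
      ∀ x ∈ Icc a b, G x = 1 := by
    obtain ⟨χ, hχ⟩ : ∃ χ : ContDiffBump ((a + b) / 2 : ℝ), χ.rIn = b - a :=
      ⟨⟨b - a, 2 * (b - a), by linarith, by linarith⟩, rfl⟩
    refine ⟨fun x => (χ x : ℂ), Complex.ofRealCLM.contDiff.comp χ.contDiff,
      χ.hasCompactSupport.comp_left (g := fun x : ℝ => (x : ℂ)) (by simp), fun x hx => ?_⟩
    have : χ x = 1 := by
      refine χ.one_of_mem_closedBall ?_
      rw [hχ, Metric.mem_closedBall, Real.dist_eq, abs_le]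
      constructor <;> linarith [hx.1, hx.2]
    simp [this]
  have h : restrict a b ((hGc.toSchwartzMap hG : 𝓢(ℝ, ℂ)) : 𝓢'(ℝ, ℂ)) ∈
      Set.range (Sob.toFunc (a := a) (b := b) (s := s)) := by
    rw [Sob.range_toFunc]
    exact ⟨_, SchwartzMap.memSobolev _, rfl⟩
  obtain ⟨u, hu⟩ := h
  have : funF (a := a) (b := b) (fun _ => 1) continuousOn_const = u.toFunc := by
    rw [hu]
    refine LinearMap.ext fun φ => ?_
    change ∫ x in Ioo a b, (φ : 𝓢(ℝ, ℂ)) x * 1 = ((hGc.toSchwartzMap hG : 𝓢(ℝ, ℂ)) : 𝓢'(ℝ, ℂ)) φ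
    rw [SchwartzMap.toTemperedDistributionCLM_apply_apply volume]
    refine Eq.trans ?_ (setIntegral_eq_integral_of_forall_compl_eq_zero (s := Ioo a b)
      fun x hx => by rw [TestFun.eq_zero φ hx, zero_smul])
    refine setIntegral_congr_fun measurableSet_Ioo fun x hx => ?_
    change _ = (φ : 𝓢(ℝ, ℂ)) x • G x
    rw [hG1 x (Ioo_subset_Icc_self hx)]
    rfl
  rw [this]
  exact memSob_toFunc u

/-- Smooth functions on `[a, b]` belong to all Sobolev spaces. -/
theorem memSob_funF (hab : a < b) (s : ℝ) {g : ℝ → ℂ} (hg : ContDiffOn ℝ ∞ g (Icc a b)) :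
    MemSob s (funF g hg.continuousOn) := by
  have := (memSob_one hab s).mulF hab g
  rw [mulF_funF _ hg] at this
  simpa using this

/-- A distribution whose derivative belongs to `H^s(a, b)` belongs to `H^{s+1}(a, b)`. -/
theorem MemSob.of_derivF (hab : a < b) {s : ℝ} {w : Func a b}
    (h : MemSob s (OrrSommerfeld.derivF w)) : MemSob (s + 1) w := by
  obtain ⟨u, hu, hs⟩ := h.exists_primitive hab
  obtain ⟨c, hc⟩ := eq_const_of_derivF_eq_zero hab (w := w - u) (by rw [map_sub, hu, sub_self])
  rw [← sub_add_cancel w u, hc]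
  exact ((memSob_one hab _).smul c).add hs

/-! ### The Sobolev embedding and the traces at the endpoints -/

theorem memLp_weight {r : ℝ} (hr : 1 / 2 < r) : MemLp (weight (-r)) 2 (volume : Measure ℝ) := by
  have hc := (weight_hasTemperateGrowth (-r)).1.continuous
  rw [memLp_two_iff_integrable_sq_norm hc.aestronglyMeasurable]
  have h : Integrable fun ξ : ℝ => (1 + ‖ξ‖ ^ 2) ^ (-(2 * r) / 2 : ℝ) :=
    integrable_rpow_neg_one_add_norm_sq (by simp; linarith)
  refine h.congr (Filter.Eventually.of_forall fun ξ => ?_)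
  simp only [norm_weight]
  rw [← Real.rpow_mul_natCast (by positivity)]
  congr 1
  push_cast; ring

/-- Cauchy--Schwarz, since the weight of order `-r` is square integrable for `r > 1/2`. It is used
with `r = s` for the values and with `r = s - 1` for the derivative, which accounts for the
threshold `s > 3/2`. -/
theorem exists_integral_weight_mul_le {r : ℝ} (hr : 1 / 2 < r) :
    ∃ C, 0 ≤ C ∧ ∀ y : Lp ℂ 2 (volume : Measure ℝ),
      Integrable (fun ξ => ‖weight (-r) ξ‖ * ‖y ξ‖) ∧ ∫ ξ, ‖weight (-r) ξ‖ * ‖y ξ‖ ≤ C * ‖y‖ := by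
  refine ⟨(eLpNorm (weight (-r)) 2 volume).toReal, by positivity, fun y => ?_⟩
  have hw := memLp_weight hr
  have hy := Lp.memLp y
  have h1 : MemLp (weight (-r) • (y : ℝ → ℂ)) 1 volume := MemLp.smul hy hw
  have h2 : eLpNorm (weight (-r) • (y : ℝ → ℂ)) 1 volume ≤
      eLpNorm (weight (-r)) 2 volume * eLpNorm y 2 volume :=
    eLpNorm_smul_le_mul_eLpNorm hy.1 hw.1
  have h3 := memLp_one_iff_integrable.1 h1
  refine ⟨by simpa [norm_smul] using h3.norm, ?_⟩
  rw [Lp.norm_def, ← ENNReal.toReal_mul]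
  calc _ = (eLpNorm (weight (-r) • (y : ℝ → ℂ)) 1 volume).toReal := by
        rw [eLpNorm_one_eq_lintegral_enorm, ← integral_norm_eq_lintegral_enorm h1.1]
        simp
    _ ≤ _ := ENNReal.toReal_mono (ENNReal.mul_ne_top hw.2.ne hy.2.ne) h2

/-- An element of `H^s` is the Fourier transform of a function `h` for which both `h` and `ξ h` are
integrable. Its transform is therefore `C¹`, with bounds by the norm of `v`. -/
theorem exists_ofL2_eq_integral {s : ℝ} (hs : 3 / 2 < s) :
    ∃ C, 0 ≤ C ∧ ∀ v : Lp ℂ 2 (volume : Measure ℝ), ∃ f : ℝ → ℂ, ContDiff ℝ 1 f ∧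
      (∀ φ : 𝓢(ℝ, ℂ), ofL2 s v φ = ∫ x, φ x * f x) ∧
      ∀ x, ‖f x‖ ≤ C * ‖v‖ ∧ ‖deriv f x‖ ≤ C * ‖v‖ := by
  obtain ⟨C₀, hC₀, H₀⟩ := exists_integral_weight_mul_le (r := s) (by linarith)
  obtain ⟨C₁, hC₁, H₁⟩ := exists_integral_weight_mul_le (r := s - 1) (by linarith)
  refine ⟨C₀ + 2 * Real.pi * C₁, by positivity, fun v => ?_⟩
  set y : Lp ℂ 2 (volume : Measure ℝ) := 𝓕⁻ (star v) with hy
  have hyv : ‖y‖ = ‖v‖ := by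
    rw [← norm_star_L2 v, hy, ← MeasureTheory.Lp.norm_fourier_eq,
      FourierTransform.fourier_fourierInv_eq]
  obtain ⟨hi₀, hb₀⟩ := H₀ y
  obtain ⟨hi₁, hb₁⟩ := H₁ y
  rw [hyv] at hb₀ hb₁
  set k : ℝ → ℂ := fun ξ => star (y ξ) * weight (-s) ξ with hk
  have hkm : AEStronglyMeasurable k volume :=
    ((Lp.aestronglyMeasurable y).star).mul
      (weight_hasTemperateGrowth (-s)).1.continuous.aestronglyMeasurable
  have hkn : ∀ ξ, ‖k ξ‖ = ‖weight (-s) ξ‖ * ‖y ξ‖ := fun ξ => by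
    rw [hk]; simp [mul_comm]
  have hξk : ∀ ξ : ℝ, ‖ξ‖ * ‖k ξ‖ ≤ ‖weight (-(s - 1)) ξ‖ * ‖y ξ‖ := fun ξ => by
    rw [hkn, ← mul_assoc, show -(s - 1) = -s + 1 by ring, norm_weight_add_one]
    gcongr
    rw [← Real.sqrt_eq_rpow]
    exact Real.le_sqrt_of_sq_le (by linarith)
  have hki : Integrable k := hi₀.mono' hkm (Filter.Eventually.of_forall fun ξ => (hkn ξ).le)
  have hki' : Integrable fun ξ : ℝ => ‖ξ‖ * ‖k ξ‖ := by
    refine hi₁.mono' (continuous_norm.aestronglyMeasurable.mul hkm.norm)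
      (Filter.Eventually.of_forall fun ξ => ?_)
    rw [Real.norm_of_nonneg (by positivity)]
    exact hξk ξ
  -- The reflection turns `𝓕⁻ φ` into `𝓕 φ`, so that the symmetry of the Fourier transform moves it
  -- onto `h`.
  set h : ℝ → ℂ := fun ξ => k (-ξ) with hh
  have hhi : Integrable h := hki.comp_neg
  have hhi' : Integrable fun ξ : ℝ => ‖ξ‖ * ‖h ξ‖ := by
    have := hki'.comp_neg
    simpa [hh] using this
  have hhξ : Integrable fun ξ : ℝ => ξ • h ξ := by
    refine hhi'.mono' (continuous_id.aestronglyMeasurable.smul hhi.1)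
      (Filter.Eventually.of_forall fun ξ => ?_)
    rw [norm_smul]
  have hbd : ∀ (g : ℝ → ℂ) (x : ℝ), ‖𝓕 g x‖ ≤ ∫ ξ, ‖g ξ‖ := fun g x =>
    VectorFourier.norm_fourierIntegral_le_integral_norm _ _ _ _ _
  refine ⟨𝓕 h, ?_, fun φ => ?_, fun x => ⟨?_, ?_⟩⟩
  · refine Real.contDiff_fourier (N := 1) fun n hn => ?_
    have hn' : n ≤ 1 := by exact_mod_cast hn
    interval_cases n
    · simpa using hhi.norm
    · simpa using hhi'
  · rw [ofL2_eq_inner]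
    have h1 : besselL2 (-s) φ = 𝓕 (weightedL2 (-s) φ) :=
      (SchwartzMap.toLp_fourier_eq (weighted (-s) φ)).symm
    have h2 : star v = 𝓕 y := by rw [hy, FourierTransform.fourier_fourierInv_eq]
    rw [h1, h2, MeasureTheory.Lp.inner_fourier_eq, MeasureTheory.L2.inner_def]
    have h3 : ∫ ξ, inner ℂ (y ξ) (weightedL2 (-s) φ ξ) = ∫ ξ, k ξ * 𝓕⁻ φ ξ := by
      refine integral_congr_ae ?_
      filter_upwards [weightedL2_coe (-s) φ] with ξ hξ
      rw [hξ]
      simp [hk]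
      ring
    have h4 : ∫ ξ, k ξ * 𝓕⁻ φ ξ = ∫ ξ, 𝓕 φ ξ * h ξ := by
      rw [← integral_neg_eq_self]
      refine integral_congr_ae (Filter.Eventually.of_forall fun ξ => ?_)
      simp only [hh]
      rw [mul_comm, SchwartzMap.fourierInv_apply_eq]
      simp
    have h5 := VectorFourier.integral_fourierIntegral_smul_eq_flip (μ := volume) (ν := volume)
      (L := innerₗ ℝ) (f := φ) (g := h) Real.continuous_fourierChar continuous_inner
      φ.integrable hhi
    rw [h3, h4]
    refine Eq.trans ?_ (h5.trans ?_)
    · rfl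
    · rw [flip_innerₗ]
      rfl
  · refine (hbd h x).trans ?_
    have : ∫ ξ, ‖h ξ‖ = ∫ ξ, ‖weight (-s) ξ‖ * ‖y ξ‖ := by
      rw [hh]
      refine (integral_neg_eq_self (fun ξ => ‖k ξ‖) volume).trans ?_
      simp_rw [hkn]
    rw [this, add_mul]
    exact hb₀.trans (le_add_of_nonneg_right (by positivity))
  · rw [Real.deriv_fourier hhi hhξ]
    refine (hbd _ x).trans ?_
    have h1 : ∀ ξ : ℝ, ‖(-2 * Real.pi * Complex.I * ξ : ℂ) • h ξ‖ = 2 * Real.pi * (‖ξ‖ * ‖h ξ‖) := by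
      intro ξ
      rw [norm_smul]
      simp [abs_of_pos Real.pi_pos]
      ring
    simp_rw [h1]
    have h2 : ∫ ξ : ℝ, ‖ξ‖ * ‖h ξ‖ = ∫ ξ : ℝ, ‖ξ‖ * ‖k ξ‖ := by
      rw [hh, ← integral_neg_eq_self (fun ξ : ℝ => ‖ξ‖ * ‖k ξ‖)]
      simp
    rw [integral_const_mul, h2, add_mul, mul_assoc (2 * Real.pi)]
    refine le_trans ?_ (le_add_of_nonneg_left (by positivity))
    have := Real.pi_pos
    gcongr
    exact (integral_mono hki' hi₁ hξk).trans hb₁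

/-- Testing against real bump functions gives equality almost everywhere; continuity upgrades it to
the open interval and then to the endpoints. The latter is essential for boundary values. -/
theorem eqOn_of_funF_eq (hab : a < b) {f g : ℝ → ℂ} (hf : ContinuousOn f (Icc a b))
    (hg : ContinuousOn g (Icc a b)) (h : funF f hf = funF g hg) : EqOn f g (Icc a b) := by
  have hfg : ContinuousOn (fun x => f x - g x) (Icc a b) := hf.sub hg
  have key : ∀ᵐ x, x ∈ Ioo a b → f x - g x = 0 := by
    refine isOpen_Ioo.ae_eq_zero_of_integral_contDiff_smul_eq_zero
      ((hfg.mono Ioo_subset_Icc_self).locallyIntegrableOn measurableSet_Ioo) ?_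
    intro χ hχ hχc hχs
    have hs : tsupport (fun x => (χ x : ℂ)) ⊆ Ioo a b := by
      refine (closure_mono fun x hx => ?_).trans hχs
      intro h
      exact hx (by simp [h])
    set φ : TestFun a b := TestFun.mk (fun x => (χ x : ℂ)) (Complex.ofRealCLM.contDiff.comp hχ) hs
    have h1 : funF _ hfg φ = 0 := by
      have h2 : funF _ hfg φ = funF f hf φ - funF g hg φ := by
        have hint : ∀ {f : ℝ → ℂ}, ContinuousOn f (Icc a b) →
            IntegrableOn (fun x => (φ : 𝓢(ℝ, ℂ)) x * f x) (Ioo a b) := fun hf =>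
          (((φ : 𝓢(ℝ, ℂ)).continuous.continuousOn.mul hf).integrableOn_Icc).mono_set
            Ioo_subset_Icc_self
        change ∫ x in Ioo a b, _ = (∫ x in Ioo a b, _) - ∫ x in Ioo a b, _
        rw [← integral_sub (hint hf) (hint hg)]
        simp [mul_sub]
      rw [h2, h, sub_self]
    rw [← h1]
    refine (setIntegral_eq_integral_of_forall_compl_eq_zero (s := Ioo a b)
      fun x hx => ?_).symm
    have : χ x = 0 := by
      by_contra h'
      exact hx (hχs (subset_tsupport _ h'))
    simp [this]
  have h2 : EqOn f g (Ioo a b) := by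
    refine Measure.eqOn_open_of_ae_eq (μ := volume) ?_ isOpen_Ioo
      (hf.mono Ioo_subset_Icc_self) (hg.mono Ioo_subset_Icc_self)
    rw [Filter.EventuallyEq, ae_restrict_iff' measurableSet_Ioo]
    filter_upwards [key] with x hx hx'
    exact sub_eq_zero.1 (hx hx')
  refine h2.of_subset_closure hf hg Ioo_subset_Icc_self ?_
  rw [closure_Ioo hab.ne]

theorem Sob.exists_contDiff {s : ℝ} (hab : a < b) (hs : 3 / 2 < s) :
    ∃ C, 0 ≤ C ∧ ∀ u : Sob a b s, ∃ f : ℝ → ℂ, ContDiffOn ℝ 1 f (Icc a b) ∧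
      Represents u.toFunc f ∧
      ∀ x ∈ Icc a b, ‖f x‖ ≤ C * ‖u‖ ∧ ‖derivWithin f (Icc a b) x‖ ≤ C * ‖u‖ := by
  obtain ⟨C, hC0, hC⟩ := exists_ofL2_eq_integral hs
  refine ⟨C * 2, by positivity, fun u => ?_⟩
  rcases eq_or_ne u 0 with rfl | hu
  · exact ⟨0, contDiffOn_const, fun φ => by simp, fun x _ => by simp⟩
  -- A representative of norm less than `2‖u‖` exists because `u ≠ 0`; this is the factor 2 in the
  -- constant.
  obtain ⟨v, rfl, hv⟩ := Submodule.Quotient.norm_mk_lt u (norm_pos_iff.2 hu)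
  obtain ⟨f, hf, hrep, hb⟩ := hC v
  have hv' : C * ‖v‖ ≤ C * 2 * ‖(Submodule.Quotient.mk v : Sob a b s)‖ := by
    rw [mul_assoc]
    gcongr
    linarith
  refine ⟨f, hf.contDiffOn, fun φ => ?_, fun x hx => ⟨(hb x).1.trans hv', ?_⟩⟩
  · rw [Sob.toFunc_mk, hrep]
    exact (setIntegral_eq_integral_of_forall_compl_eq_zero (s := Ioo a b)
      fun x hx => by rw [TestFun.eq_zero φ hx, zero_mul]).symm
  · rw [(hf.differentiable one_ne_zero x).derivWithin (uniqueDiffOn_Icc hab x hx)]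
    exact (hb x).2.trans hv'

/-- The values and the first derivatives at the endpoints. -/
def bdry (a b : ℝ) (f : ℝ → ℂ) : Fin 4 → ℂ :=
  ![f a, f b, derivWithin f (Icc a b) a, derivWithin f (Icc a b) b]

/-- The trace map on `H^s(a, b)`, `s > 3/2`. -/
theorem Sob.exists_trace {s : ℝ} (hab : a < b) (hs : 3 / 2 < s) :
    ∃ τ : Sob a b s →L[ℂ] (Fin 4 → ℂ),
      (∀ (u : Sob a b s) (f : ℝ → ℂ), ContDiffOn ℝ 1 f (Icc a b) → Represents u.toFunc f →
        τ u = bdry a b f) ∧ SobDN a b s = LinearMap.ker τ.toLinearMap := by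
  obtain ⟨C, hC0, hC⟩ := Sob.exists_contDiff (s := s) hab hs
  choose F hF hrep hbd using hC
  have ha := left_mem_Icc.2 hab.le
  have hb := right_mem_Icc.2 hab.le
  have huniq : ∀ f g : ℝ → ℂ, EqOn f g (Icc a b) → bdry a b f = bdry a b g := by
    intro f g h
    simp only [bdry, h ha, h hb, derivWithin_congr h (h ha), derivWithin_congr h (h hb)]
  -- The trace is read off from a chosen representative. Independence of the choice gives linearity,
  -- although the choice itself is not linear.
  have hτ : ∀ (u : Sob a b s) (f : ℝ → ℂ), ContDiffOn ℝ 1 f (Icc a b) → Represents u.toFunc f →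
      bdry a b (F u) = bdry a b f := by
    intro u f hf hr
    refine huniq _ _ (eqOn_of_funF_eq hab (hF u).continuousOn hf.continuousOn ?_)
    rw [← (represents_iff (hF u).continuousOn).1 (hrep u),
      ← (represents_iff hf.continuousOn).1 hr]
  have hadd : ∀ f g : ℝ → ℂ, ContDiffOn ℝ 1 f (Icc a b) → ContDiffOn ℝ 1 g (Icc a b) →
      bdry a b (f + g) = bdry a b f + bdry a b g := by
    intro f g hf hg
    have key : ∀ x ∈ Icc a b, derivWithin (f + g) (Icc a b) x =
        derivWithin f (Icc a b) x + derivWithin g (Icc a b) x := fun x hx =>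
      derivWithin_add ((hf.differentiableOn one_ne_zero) x hx)
        ((hg.differentiableOn one_ne_zero) x hx)
    ext i
    fin_cases i <;> simp [bdry, key a ha, key b hb]
  have hsmul : ∀ (c : ℂ) (f : ℝ → ℂ), bdry a b (c • f) = c • bdry a b f := by
    intro c f
    ext i
    fin_cases i <;> simp [bdry, derivWithin_const_smul_field]
  let τ₀ : Sob a b s →ₗ[ℂ] (Fin 4 → ℂ) :=
    { toFun := fun u => bdry a b (F u)
      map_add' := fun u v => by
        rw [← hadd _ _ (hF u) (hF v)]
        refine hτ _ _ ((hF u).add (hF v)) fun φ => ?_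
        rw [map_add, LinearMap.add_apply, hrep u φ, hrep v φ,
          ← integral_add (integrableOn_testFun_mul φ (hF u)) (integrableOn_testFun_mul φ (hF v))]
        simp [mul_add]
      map_smul' := fun c u => by
        rw [RingHom.id_apply, ← hsmul]
        refine hτ _ _ ((hF u).const_smul c) fun φ => ?_
        rw [map_smul, LinearMap.smul_apply, hrep u φ, smul_eq_mul, ← integral_const_mul]
        simp [mul_left_comm] }
  refine ⟨τ₀.mkContinuous C fun u => ?_, fun u f hf hr => hτ u f hf hr, ?_⟩
  · rw [pi_norm_le_iff_of_nonneg (by positivity)]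
    intro i
    change ‖bdry a b (F u) i‖ ≤ _
    fin_cases i
    · exact (hbd u a ha).1
    · exact (hbd u b hb).1
    · exact (hbd u a ha).2
    · exact (hbd u b hb).2
  · ext u
    have h0 : ∀ f : ℝ → ℂ, bdry a b f = 0 ↔ f a = 0 ∧ f b = 0 ∧
        derivWithin f (Icc a b) a = 0 ∧ derivWithin f (Icc a b) b = 0 := by
      intro f
      rw [funext_iff, Fin.forall_fin_succ, Fin.forall_fin_succ, Fin.forall_fin_succ,
        Fin.forall_fin_succ]
      simp [bdry]
    change (∃ f : ℝ → ℂ, _) ↔ bdry a b (F u) = 0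
    constructor
    · rintro ⟨f, hf, hr, h⟩
      rw [hτ u f hf hr, h0]
      exact h
    · intro h
      exact ⟨F u, hF u, hrep u, (h0 _).1 h⟩

/-! ### Linear ordinary differential equations, real and complex -/

section Picard

variable {𝕜 E : Type*} [RCLike 𝕜] [NormedAddCommGroup E] [NormedSpace ℝ E] [NormedSpace 𝕜 E]
  [IsScalarTower ℝ 𝕜 E]

/-- One step of the Picard estimate: restrict to the segment from `z₀` to `z` and compare with the
explicit majorant, whose derivative is the assumed bound. Working along the segment treats the real
and the complex case together. -/
theorem norm_le_of_norm_deriv_le_pow {z₀ z : 𝕜} {F F' : 𝕜 → E} {C M R : ℝ}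
    (hz : z ∈ Metric.ball z₀ R) (n : ℕ)
    (hF : ∀ z ∈ Metric.ball z₀ R, HasDerivAt F (F' z) z) (h0 : F z₀ = 0)
    (hb : ∀ z ∈ Metric.ball z₀ R, ‖F' z‖ ≤ M * (C * (M * ‖z - z₀‖) ^ n / n.factorial)) :
    ‖F z‖ ≤ C * (M * ‖z - z₀‖) ^ (n + 1) / (n + 1).factorial := by
  set ℓ : ℝ → 𝕜 := fun t => z₀ + (t : 𝕜) * (z - z₀) with hℓ
  have hmem : ∀ t ∈ Icc (0 : ℝ) 1, ℓ t ∈ Metric.ball z₀ R := by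
    intro t ht
    rw [Metric.mem_ball, dist_eq_norm] at hz ⊢
    simp only [hℓ, add_sub_cancel_left, norm_mul, RCLike.norm_ofReal, abs_of_nonneg ht.1]
    exact (mul_le_of_le_one_left (norm_nonneg _) ht.2).trans_lt hz
  have hℓd : ∀ t, HasDerivAt ℓ (z - z₀) t := fun t => by
    simpa [hℓ] using ((RCLike.ofRealCLM (K := 𝕜)).hasDerivAt.mul_const (z - z₀)).const_add z₀
  have hd : ∀ t ∈ Icc (0 : ℝ) 1, HasDerivAt (F ∘ ℓ) ((z - z₀) • F' (ℓ t)) t := fun t ht =>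
    (hF _ (hmem t ht)).scomp t (hℓd t)
  have hB : ∀ t : ℝ, HasDerivAt
      (fun t : ℝ => C * (M * (t * ‖z - z₀‖)) ^ (n + 1) / (n + 1).factorial)
      (‖z - z₀‖ * (M * (C * (M * (t * ‖z - z₀‖)) ^ n / n.factorial))) t := by
    intro t
    have h1 := (((((hasDerivAt_id t).mul_const ‖z - z₀‖).const_mul M).pow (n + 1)).const_mul
      C).div_const ((n + 1).factorial : ℝ)
    refine h1.congr_deriv ?_
    rw [Nat.factorial_succ]
    push_cast
    field_simp
    simp only [id_eq]
    ring
  have := image_norm_le_of_norm_deriv_right_le_deriv_boundary (f := F ∘ ℓ) (a := 0) (b := 1)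
    (f' := fun t => (z - z₀) • F' (ℓ t))
    (fun t ht => (hd t ht).continuousAt.continuousWithinAt)
    (fun t ht => (hd t (Ico_subset_Icc_self ht)).hasDerivWithinAt) (by simp [hℓ, h0]) hB
    (fun t ht => by
      rw [norm_smul]
      gcongr
      refine (hb _ (hmem t (Ico_subset_Icc_self ht))).trans_eq ?_
      simp [hℓ, abs_of_nonneg ht.1]) (right_mem_Icc.2 zero_le_one)
  simpa [hℓ] using this

/-- The Picard series of a linear equation, in a class of functions that have primitives. -/
theorem exists_solution_of_primitives [CompleteSpace E] {z₀ : 𝕜} {R C M : ℝ}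
    {nice : (𝕜 → E) → Prop} (A : 𝕜 → E →L[𝕜] E)
    (hprim : ∀ f, nice f → ∃ F, nice F ∧ F z₀ = 0 ∧
      ∀ z ∈ Metric.ball z₀ R, HasDerivAt F (f z) z)
    (hA : ∀ f, nice f → nice fun z => A z (f z)) (hM : ∀ z ∈ Metric.ball z₀ R, ‖A z‖ ≤ M)
    {y h : 𝕜 → E} (hy : nice y) (hyC : ∀ z ∈ Metric.ball z₀ R, ‖y z‖ ≤ C)
    (hyh : ∀ z ∈ Metric.ball z₀ R, HasDerivAt y (h z) z) :
    ∃ Y : 𝕜 → E, Y z₀ = y z₀ ∧ ∀ z ∈ Metric.ball z₀ R, HasDerivAt Y (A z (Y z) + h z) z := by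
  rcases le_or_gt R 0 with hR | hR
  · exact ⟨y, rfl, by simp [Metric.ball_eq_empty.2 hR]⟩
  have hz₀ : z₀ ∈ Metric.ball z₀ R := Metric.mem_ball_self hR
  have hM0 : 0 ≤ M := (norm_nonneg _).trans (hM z₀ hz₀)
  have hC0 : 0 ≤ C := (norm_nonneg _).trans (hyC z₀ hz₀)
  choose J hJ hJ0 hJd using hprim
  -- The terms are `q₀ = y` and `q_{n+1} = ∫ A qₙ`, and the solution is their sum. They carry the
  -- property `nice` so that a primitive is available at each stage.
  let p : ℕ → {f : 𝕜 → E // nice f} := fun n =>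
    Nat.rec ⟨y, hy⟩ (fun _ f => ⟨J _ (hA f.1 f.2), hJ _ _⟩) n
  set q : ℕ → 𝕜 → E := fun n => (p n).1 with hq
  have hqd : ∀ n, ∀ z ∈ Metric.ball z₀ R, HasDerivAt (q (n + 1)) (A z (q n z)) z := fun n =>
    hJd _ (hA (p n).1 (p n).2)
  have hq0 : ∀ n, q (n + 1) z₀ = 0 := fun n => hJ0 _ (hA (p n).1 (p n).2)
  have hb : ∀ n, ∀ z ∈ Metric.ball z₀ R, ‖q n z‖ ≤ C * (M * ‖z - z₀‖) ^ n / n.factorial := by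
    intro n
    induction n with
    | zero => intro z hz; simpa [hq, p] using hyC z hz
    | succ n ih =>
      intro z hz
      refine norm_le_of_norm_deriv_le_pow hz n (hqd n) (hq0 n) fun z hz => ?_
      exact ((A z).le_opNorm _).trans (mul_le_mul (hM z hz) (ih z hz) (norm_nonneg _) hM0)
  have hsum : Summable fun n : ℕ => C * (M * R) ^ n / n.factorial := by
    simpa [mul_div_assoc] using (Real.summable_pow_div_factorial (M * R)).mul_left C
  have hb' : ∀ n, ∀ z ∈ Metric.ball z₀ R, ‖q n z‖ ≤ C * (M * R) ^ n / n.factorial := by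
    intro n z hz
    refine (hb n z hz).trans ?_
    rw [Metric.mem_ball, dist_eq_norm] at hz
    gcongr
  have hqs : ∀ z ∈ Metric.ball z₀ R, Summable fun n => q n z := fun z hz =>
    .of_norm_bounded hsum fun n => hb' n z hz
  refine ⟨fun z => y z + ∑' n, q (n + 1) z, by simp [hq0], fun z hz => ?_⟩
  have h1 := hasDerivAt_tsum_of_isPreconnected (hsum.mul_left M) Metric.isOpen_ball
    (convex_ball z₀ R).isPreconnected (g := fun n => q (n + 1)) (g' := fun n z => A z (q n z))
    (fun n z hz => hqd n z hz)
    (fun n z hz => ((A z).le_opNorm _).trans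
      (mul_le_mul (hM z hz) (hb' n z hz) (norm_nonneg _) hM0)) hz₀
    (by simp [hq0]) hz
  refine ((hyh z hz).add h1).congr_deriv ?_
  have h2 : y z + ∑' n, q (n + 1) z = ∑' n, q n z := ((hqs z hz).tsum_eq_zero_add).symm
  beta_reduce
  rw [h2, (A z).map_tsum (hqs z hz), add_comm]

end Picard

/-! ### Linear systems: existence, smoothness and fundamental matrices. -/

section LinearSystem

variable {ι : Type*} [Fintype ι]

theorem contDiffOn_mulVec {s : Set ℝ} {n : ℕ∞} {A : ℝ → Matrix ι ι ℂ} {Y : ℝ → ι → ℂ}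
    (hA : ∀ i j, ContDiffOn ℝ n (fun x => A x i j) s) (hY : ContDiffOn ℝ n Y s) :
    ContDiffOn ℝ n (fun x => (A x).mulVec (Y x)) s := by
  rw [contDiffOn_pi] at hY ⊢
  intro i
  simp only [Matrix.mulVec, dotProduct]
  exact ContDiffOn.sum fun j _ => (hA i j).mul (hY j)

/-- Bootstrapping: if `Y` is `C^n`, then so is the right-hand side, hence `Y` is `C^{n+1}`. -/
theorem contDiffOn_solution (hab : a < b) {A : ℝ → Matrix ι ι ℂ} {h Y : ℝ → ι → ℂ}
    (hA : ∀ i j, ContDiffOn ℝ ∞ (fun x => A x i j) (Icc a b)) (hh : ContDiffOn ℝ ∞ h (Icc a b))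
    (hY : ∀ x ∈ Icc a b, HasDerivWithinAt Y ((A x).mulVec (Y x) + h x) (Icc a b) x) :
    ContDiffOn ℝ ∞ Y (Icc a b) := by
  rw [contDiffOn_infty]
  intro n
  induction n with
  | zero => exact contDiffOn_zero.2 fun x hx => (hY x hx).continuousWithinAt
  | succ n ih =>
    push_cast
    rw [contDiffOn_succ_iff_derivWithin (uniqueDiffOn_Icc hab)]
    refine ⟨fun x hx => (hY x hx).differentiableWithinAt, by simp, ?_⟩
    refine ((contDiffOn_mulVec (n := n) (fun i j => contDiffOn_infty.1 (hA i j) n) ih).add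
      (contDiffOn_infty.1 hh n)).congr fun x hx => ?_
    exact (hY x hx).derivWithin (uniqueDiffOn_Icc hab x hx)

variable [DecidableEq ι]

theorem exists_matrix_toCLM (ι : Type*) [Fintype ι] [DecidableEq ι] :
    ∃ L : Matrix ι ι ℂ →L[ℂ] ((ι → ℂ) →L[ℂ] (ι → ℂ)), ∀ A v, L A v = A.mulVec v := by
  let L₀ : Matrix ι ι ℂ →ₗ[ℂ] ((ι → ℂ) →L[ℂ] (ι → ℂ)) :=
    LinearMap.toContinuousLinearMap.toLinearMap.comp (Matrix.toLin' : _ ≃ₗ[ℂ] _).toLinearMap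
  exact ⟨⟨L₀, L₀.continuous_of_finiteDimensional⟩, fun A v => rfl⟩

/-- Linear holomorphic equations on a disc. -/
theorem exists_holomorphic_solution {z₀ : ℂ} {R C : ℝ} {A : ℂ → Matrix ι ι ℂ} {h : ℂ → ι → ℂ}
    (hA : ∀ i j, DifferentiableOn ℂ (fun z => A z i j) (Metric.ball z₀ R))
    (hh : DifferentiableOn ℂ h (Metric.ball z₀ R))
    (hAC : ∀ z ∈ Metric.ball z₀ R, ∀ i j, ‖A z i j‖ ≤ C)
    (hhC : ∀ z ∈ Metric.ball z₀ R, ‖h z‖ ≤ C) (v : ι → ℂ) :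
    ∃ Y : ℂ → ι → ℂ, Y z₀ = v ∧
      ∀ z ∈ Metric.ball z₀ R, HasDerivAt Y ((A z).mulVec (Y z) + h z) z := by
  rcases le_or_gt R 0 with hR | hR
  · exact ⟨fun _ => v, rfl, by simp [Metric.ball_eq_empty.2 hR]⟩
  have hz₀ : z₀ ∈ Metric.ball z₀ R := Metric.mem_ball_self hR
  have hC0 : 0 ≤ C := (norm_nonneg _).trans (hhC z₀ hz₀)
  obtain ⟨L, hL⟩ := exists_matrix_toCLM ι
  obtain ⟨y, hy0, hy⟩ := hh.isExactOn_ball.with_val_at z₀ v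
  have hprim : ∀ f : ℂ → ι → ℂ, DifferentiableOn ℂ f (Metric.ball z₀ R) →
      ∃ F, DifferentiableOn ℂ F (Metric.ball z₀ R) ∧ F z₀ = 0 ∧
        ∀ z ∈ Metric.ball z₀ R, HasDerivAt F (f z) z := by
    intro f hf
    obtain ⟨F, hF0, hF⟩ := hf.isExactOn_ball.with_val_at z₀ 0
    exact ⟨F, fun z hz => (hF z hz).differentiableAt.differentiableWithinAt, hF0, hF⟩
  have hLA : ∀ f : ℂ → ι → ℂ, DifferentiableOn ℂ f (Metric.ball z₀ R) →
      DifferentiableOn ℂ (fun z => L (A z) (f z)) (Metric.ball z₀ R) := by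
    intro f hf
    simp only [hL]
    rw [differentiableOn_pi] at hf ⊢
    intro i
    simp only [Matrix.mulVec, dotProduct]
    exact DifferentiableOn.fun_sum fun j _ => (hA i j).mul (hf j)
  have hLM : ∀ z ∈ Metric.ball z₀ R, ‖L (A z)‖ ≤ Fintype.card ι * C := by
    intro z hz
    refine ContinuousLinearMap.opNorm_le_bound _ (by positivity) fun w => ?_
    rw [hL, pi_norm_le_iff_of_nonneg (by positivity)]
    intro i
    simp only [Matrix.mulVec, dotProduct]
    refine (norm_sum_le_of_le (n := fun _ => C * ‖w‖) _ fun j _ => ?_).trans_eq (by simp [mul_assoc])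
    rw [norm_mul]
    exact mul_le_mul (hAC z hz i j) (norm_le_pi_norm w j) (norm_nonneg _) hC0
  have hyb : ∀ z ∈ Metric.ball z₀ R, ‖y z‖ ≤ ‖v‖ + C * R := by
    intro z hz
    have h1 := (convex_ball z₀ R).norm_image_sub_le_of_norm_hasDerivWithin_le
      (fun z hz => (hy z hz).hasDerivWithinAt) hhC hz₀ hz
    rw [hy0] at h1
    rw [Metric.mem_ball, dist_eq_norm] at hz
    calc ‖y z‖ ≤ ‖v‖ + ‖y z - v‖ := norm_le_norm_add_norm_sub' _ _
      _ ≤ ‖v‖ + C * R := by gcongr; exact h1.trans (by gcongr)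
  obtain ⟨Y, hY0, hY⟩ := exists_solution_of_primitives
    (nice := fun f => DifferentiableOn ℂ f (Metric.ball z₀ R)) (fun z => L (A z)) hprim hLA hLM
    (fun z hz => (hy z hz).differentiableAt.differentiableWithinAt) hyb hy
  exact ⟨Y, hY0.trans hy0, fun z hz => by simpa [hL] using hY z hz⟩

/-- Linear equations on a compact interval. -/
theorem exists_real_solution (hab : a < b) {A : ℝ → Matrix ι ι ℂ} {h : ℝ → ι → ℂ}
    (hA : ContinuousOn A (Icc a b)) (hh : ContinuousOn h (Icc a b)) (v : ι → ℂ) :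
    ∃ Y : ℝ → ι → ℂ, Y a = v ∧
      ∀ x ∈ Icc a b, HasDerivWithinAt Y ((A x).mulVec (Y x) + h x) (Icc a b) x := by
  obtain ⟨L, hL⟩ := exists_matrix_toCLM ι
  -- Freezing the coefficients outside `[a, b]` makes them continuous on the line, so that all
  -- integrals have two-sided derivatives; the ball of radius `b - a + 1` about `a` contains `[a,
  -- b]`.
  have hA' : Continuous fun x => L (A (projIcc a b hab.le x)) :=
    L.continuous.comp (hA.domRestrict.comp continuous_projIcc)
  have hh' : Continuous fun x => h (projIcc a b hab.le x) :=
    hh.domRestrict.comp continuous_projIcc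
  have hprim : ∀ (f : ℝ → ι → ℂ), Continuous f → ∀ x, HasDerivAt (fun x => ∫ t in a..x, f t) (f x) x :=
    fun f hf x => intervalIntegral.integral_hasDerivAt_right (hf.intervalIntegrable _ _)
      (hf.stronglyMeasurableAtFilter _ _) hf.continuousAt
  set y : ℝ → ι → ℂ := fun x => v + ∫ t in a..x, h (projIcc a b hab.le t)
  have hyd : ∀ x, HasDerivAt y (h (projIcc a b hab.le x)) x := fun x =>
    (hprim _ hh' x).const_add v
  have hyc : Continuous y := continuous_iff_continuousAt.2 fun x => (hyd x).continuousAt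
  have hbd : ∀ {F : Type _} [NormedAddCommGroup F] (f : ℝ → F), Continuous f →
      ∃ C, ∀ x ∈ Metric.ball a (b - a + 1), ‖f x‖ ≤ C := by
    intro F _ f hf
    obtain ⟨C, hC⟩ := (isCompact_closedBall a (b - a + 1)).exists_bound_of_continuousOn
      hf.continuousOn
    exact ⟨C, fun x hx => hC x (Metric.ball_subset_closedBall hx)⟩
  let A' : ℝ → (ι → ℂ) →L[ℝ] (ι → ℂ) := fun x =>
    (L (A (projIcc a b hab.le x))).restrictScalars ℝ
  have hA'' : Continuous A' :=
    (ContinuousLinearMap.restrictScalarsL ℂ (ι → ℂ) (ι → ℂ) ℝ ℝ).continuous.comp hA'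
  obtain ⟨M, hM⟩ := hbd A' hA''
  obtain ⟨C, hC⟩ := hbd y hyc
  obtain ⟨Y, hY0, hY⟩ := exists_solution_of_primitives (nice := Continuous) A'
    (fun f hf => ⟨_, continuous_iff_continuousAt.2 fun x => (hprim f hf x).continuousAt,
      by simp, fun x _ => hprim f hf x⟩)
    (fun f hf => hA''.clm_apply hf) hM hyc hC fun x _ => hyd x
  refine ⟨Y, by simp [hY0, y], fun x hx => ?_⟩
  have hx' : x ∈ Metric.ball a (b - a + 1) := by
    rw [Metric.mem_ball, Real.dist_eq, abs_of_nonneg (by linarith [hx.1])]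
    linarith [hx.2]
  refine (hY x hx').hasDerivWithinAt.congr_deriv ?_
  simp [A', hL, projIcc_of_mem hab.le hx]

/-- A smooth linear system has a smooth invertible fundamental matrix `Φ`, with inverse `Ψ`. -/
theorem exists_fundamental_matrix (hab : a < b) {A : ℝ → Matrix ι ι ℂ}
    (hA : ∀ i j, ContDiffOn ℝ ∞ (fun x => A x i j) (Icc a b)) :
    ∃ Φ Ψ : ℝ → Matrix ι ι ℂ, (∀ i j, ContDiffOn ℝ ∞ (fun x => Φ x i j) (Icc a b)) ∧
      (∀ i j, ContDiffOn ℝ ∞ (fun x => Ψ x i j) (Icc a b)) ∧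
      (∀ x ∈ Icc a b, ∀ i j,
        HasDerivWithinAt (fun x => Φ x i j) ((A x * Φ x) i j) (Icc a b) x) ∧
      (∀ x ∈ Icc a b, ∀ i j,
        HasDerivWithinAt (fun x => Ψ x i j) (-(Ψ x * A x) i j) (Icc a b) x) ∧
      (∀ x ∈ Icc a b, Φ x * Ψ x = 1) ∧ ∀ x ∈ Icc a b, Ψ x * Φ x = 1 := by
  have key : ∀ B : ℝ → Matrix ι ι ℂ, (∀ i j, ContDiffOn ℝ ∞ (fun x => B x i j) (Icc a b)) →
      ∃ Y : ι → ℝ → ι → ℂ, (∀ j, Y j a = Pi.single j 1) ∧ (∀ j, ContDiffOn ℝ ∞ (Y j) (Icc a b)) ∧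
        ∀ j, ∀ x ∈ Icc a b, HasDerivWithinAt (Y j) ((B x).mulVec (Y j x)) (Icc a b) x := by
    intro B hB
    have hBc : ContinuousOn B (Icc a b) :=
      continuousOn_pi.2 fun i => continuousOn_pi.2 fun j => (hB i j).continuousOn
    choose Y hY0 hY using fun j : ι =>
      exists_real_solution hab hBc (h := fun _ => 0) continuousOn_const (Pi.single j 1)
    refine ⟨Y, hY0, fun j => contDiffOn_solution hab hB contDiffOn_const (hY j), fun j x hx => ?_⟩
    simpa using hY j x hx
  obtain ⟨Y, hY0, hYs, hY⟩ := key A hA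
  -- Solutions of the adjoint system `Z' = -Aᵀ Z` are the rows of `Ψ`. Then `ΨΦ` has derivative zero
  -- and equals the identity at `a`.
  obtain ⟨Z, hZ0, hZs, hZ⟩ := key (fun x => -(A x).transpose) fun i j => (hA j i).neg
  let Φ : ℝ → Matrix ι ι ℂ := fun x => Matrix.of fun i j => Y j x i
  let Ψ : ℝ → Matrix ι ι ℂ := fun x => Matrix.of fun i j => Z i x j
  have hΦ : ∀ x ∈ Icc a b, ∀ i j, HasDerivWithinAt (fun x => Φ x i j)
      ((A x * Φ x) i j) (Icc a b) x := fun x hx i j =>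
    hasDerivWithinAt_pi.1 (hY j x hx) i
  have hΨ : ∀ x ∈ Icc a b, ∀ i j, HasDerivWithinAt (fun x => Ψ x i j)
      (-(Ψ x * A x) i j) (Icc a b) x := fun x hx i j => by
    refine (hasDerivWithinAt_pi.1 (hZ i x hx) j).congr_deriv ?_
    simp [Ψ, Matrix.mulVec, dotProduct, Matrix.mul_apply, mul_comm]
  have h1 : ∀ x ∈ Icc a b, Ψ x * Φ x = 1 := by
    intro x hx
    ext i j
    have hd : ∀ x ∈ Icc a b, HasDerivWithinAt (fun x => (Ψ x * Φ x) i j) 0 (Icc a b) x := by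
      intro x hx
      have h2 := HasDerivWithinAt.fun_sum (u := Finset.univ)
        fun l _ => (hΨ x hx i l).fun_mul (hΦ x hx l j)
      simp only [Matrix.mul_apply (M := Ψ _) (N := Φ _)]
      refine h2.congr_deriv ?_
      have h3 : ((Ψ x * A x) * Φ x) i j = (Ψ x * (A x * Φ x)) i j := by rw [Matrix.mul_assoc]
      rw [Matrix.mul_apply, Matrix.mul_apply (N := A x * _)] at h3
      rw [Finset.sum_add_distrib]
      simp only [neg_mul, Finset.sum_neg_distrib, h3]
      simp
    have h2 := (convex_Icc a b).norm_image_sub_le_of_norm_hasDerivWithin_le (C := 0) hd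
      (fun _ _ => by simp) (left_mem_Icc.2 hab.le) hx
    rw [zero_mul, norm_le_zero_iff, sub_eq_zero] at h2
    rw [h2]
    simp [Φ, Ψ, Matrix.mul_apply, hY0, hZ0, Matrix.one_apply, Pi.single_apply, eq_comm]
  exact ⟨Φ, Ψ, fun i j => contDiffOn_pi.1 (hYs j) i, fun i j => contDiffOn_pi.1 (hZs i) j, hΦ, hΨ,
    fun x hx => mul_eq_one_comm.1 (h1 x hx), h1⟩

/-- The product of `Y` with the inverse fundamental matrix is constant. The equation is assumed only
on a convex subset, because continuation needs uniqueness on the intersection of `[a, b]` with a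
ball. -/
theorem solution_eq_zero (hab : a < b) {A : ℝ → Matrix ι ι ℂ} {Y : ℝ → ι → ℂ} {s : Set ℝ}
    (hA : ∀ i j, ContDiffOn ℝ ∞ (fun x => A x i j) (Icc a b)) (hs : Convex ℝ s)
    (hsab : s ⊆ Icc a b) (hY : ∀ x ∈ s, HasDerivWithinAt Y ((A x).mulVec (Y x)) s x)
    {x₀ : ℝ} (hx₀ : x₀ ∈ s) (hY0 : Y x₀ = 0) {x : ℝ} (hx : x ∈ s) : Y x = 0 := by
  obtain ⟨Φ, Ψ, -, -, -, hΨ, hΦΨ, -⟩ := exists_fundamental_matrix hab hA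
  have hd : ∀ x ∈ s, HasDerivWithinAt (fun x => (Ψ x).mulVec (Y x)) 0 s x := by
    intro x hx
    rw [hasDerivWithinAt_pi]
    intro i
    have h2 := HasDerivWithinAt.fun_sum (u := Finset.univ)
        fun l _ => ((hΨ x (hsab hx) i l).mono hsab).fun_mul (hasDerivWithinAt_pi.1 (hY x hx) l)
    simp only [Matrix.mulVec, dotProduct]
    refine h2.congr_deriv ?_
    have h3 : ((Ψ x * A x).mulVec (Y x)) i = (Ψ x).mulVec ((A x).mulVec (Y x)) i := by simp
    rw [Matrix.mulVec, dotProduct, Matrix.mulVec, dotProduct] at h3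
    rw [Finset.sum_add_distrib]
    simp only [neg_mul, Finset.sum_neg_distrib, h3]
    simp
  have h2 := hs.norm_image_sub_le_of_norm_hasDerivWithin_le (C := 0) hd (fun _ _ => by simp) hx₀ hx
  rw [zero_mul, norm_le_zero_iff, sub_eq_zero, hY0, Matrix.mulVec_zero] at h2
  rw [← Matrix.one_mulVec (Y x), ← hΦΨ x (hsab hx), ← Matrix.mulVec_mulVec, h2,
    Matrix.mulVec_zero]

end LinearSystem

/-! ### The Orr--Sommerfeld operator in the sense of distributions -/

/-- A smooth regular curve parametrized by `[a, b]` with a smooth profile on it. -/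
structure IsShearCurve (a b : ℝ) (γ W : ℝ → ℂ) : Prop where
  lt : a < b
  smooth : ContDiffOn ℝ ∞ γ (Icc a b)
  deriv_ne : ∀ x ∈ Icc a b, derivWithin γ (Icc a b) x ≠ 0
  smooth_profile : ContDiffOn ℝ ∞ W (Icc a b)

variable {γ W : ℝ → ℂ} {α ε : ℝ} {c : ℂ}

theorem IsShearCurve.speed (hγ : IsShearCurve a b γ W) :
    ContDiffOn ℝ ∞ (derivWithin γ (Icc a b)) (Icc a b) :=
  contDiffOn_derivWithin hγ.lt hγ.smooth

theorem IsShearCurve.invSpeed (hγ : IsShearCurve a b γ W) :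
    ContDiffOn ℝ ∞ (fun x => (derivWithin γ (Icc a b) x)⁻¹) (Icc a b) :=
  hγ.speed.inv hγ.deriv_ne

theorem IsShearCurve.curveDeriv (hγ : IsShearCurve a b γ W) {f : ℝ → ℂ}
    (hf : ContDiffOn ℝ ∞ f (Icc a b)) : ContDiffOn ℝ ∞ (curveDeriv a b γ f) (Icc a b) :=
  ((contDiffOn_derivWithin hγ.lt hf).mul hγ.invSpeed).congr fun _ _ => div_eq_mul_inv _ _

theorem IsShearCurve.lap (hγ : IsShearCurve a b γ W) {f : ℝ → ℂ}
    (hf : ContDiffOn ℝ ∞ f (Icc a b)) : ContDiffOn ℝ ∞ (lap a b α γ f) (Icc a b) :=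
  (hγ.curveDeriv (hγ.curveDeriv hf)).sub (contDiffOn_const.mul hf)

theorem IsShearCurve.orrSommerfeld (hγ : IsShearCurve a b γ W) {f : ℝ → ℂ}
    (hf : ContDiffOn ℝ ∞ f (Icc a b)) :
    ContDiffOn ℝ ∞ (orrSommerfeld a b α ε c γ W f) (Icc a b) :=
  ((contDiffOn_const.mul (hγ.lap (hγ.lap hf))).add
    ((hγ.smooth_profile.sub contDiffOn_const).mul (hγ.lap hf))).sub
    ((hγ.curveDeriv (hγ.curveDeriv hγ.smooth_profile)).mul hf)

theorem curveDeriv_congr {f g : ℝ → ℂ} (h : EqOn f g (Icc a b)) :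
    EqOn (curveDeriv a b γ f) (curveDeriv a b γ g) (Icc a b) := fun x hx => by
  simp only [curveDeriv, derivWithin_congr h (h hx)]

theorem lap_congr {f g : ℝ → ℂ} (h : EqOn f g (Icc a b)) :
    EqOn (lap a b α γ f) (lap a b α γ g) (Icc a b) := fun x hx => by
  simp only [lap, h hx, curveDeriv_congr (curveDeriv_congr h) hx]

theorem orrSommerfeld_congr {f g : ℝ → ℂ} (h : EqOn f g (Icc a b)) :
    EqOn (orrSommerfeld a b α ε c γ W f) (orrSommerfeld a b α ε c γ W g) (Icc a b) :=
  fun x hx => by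
    simp only [orrSommerfeld, h hx, lap_congr h hx, lap_congr (lap_congr h) hx]

/-- The transpose of the derivative along a curve, acting on test functions. -/
def derivTestT (γ : ℝ → ℂ) : TestFun a b →ₗ[ℂ] TestFun a b :=
  -(derivTest ∘ₗ mulTest fun x => (derivWithin γ (Icc a b) x)⁻¹)

theorem derivTestT_apply (hγ : IsShearCurve a b γ W) (φ : TestFun a b) :
    ((derivTestT γ φ : TestFun a b) : ℝ → ℂ) = curveDerivT a b γ φ := by
  funext x
  have h1 : (fun y => (φ : 𝓢(ℝ, ℂ)) y / derivWithin γ (Icc a b) y) =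
      (mulTest (fun x => (derivWithin γ (Icc a b) x)⁻¹) φ : 𝓢(ℝ, ℂ)) := by
    funext y
    rw [mulTest_apply hγ.invSpeed, div_eq_inv_mul]
  have h2 : ((derivTestT γ φ : TestFun a b) : 𝓢(ℝ, ℂ)) x =
      -(derivTest (mulTest (fun x => (derivWithin γ (Icc a b) x)⁻¹) φ) : 𝓢(ℝ, ℂ)) x := rfl
  rw [h2, curveDerivT, h1]
  congr 1
  by_cases hx : x ∈ Icc a b
  · rw [derivTest_apply, DifferentiableAt.derivWithin _ (uniqueDiffOn_Icc hγ.lt x hx)]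
    exact (TestFun.contDiff _).differentiable (by simp) x
  · rw [derivWithin_zero_of_notMem_closure (by rwa [closure_Icc]),
      TestFun.eq_zero _ fun h => hx (Ioo_subset_Icc_self h)]

/-- The transpose of `∂² - α²`, acting on test functions. -/
def lapTestT (α : ℝ) (γ : ℝ → ℂ) : TestFun a b →ₗ[ℂ] TestFun a b :=
  derivTestT γ ∘ₗ derivTestT γ - (α : ℂ) ^ 2 • LinearMap.id

theorem lapTestT_apply (hγ : IsShearCurve a b γ W) (φ : TestFun a b) :
    ((lapTestT α γ φ : TestFun a b) : ℝ → ℂ) = lapT a b α γ φ := by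
  funext x
  have h : ((lapTestT α γ φ : TestFun a b) : 𝓢(ℝ, ℂ)) x =
    (derivTestT γ (derivTestT γ φ) : 𝓢(ℝ, ℂ)) x - (α : ℂ) ^ 2 * (φ : 𝓢(ℝ, ℂ)) x := rfl
  rw [h, lapT, derivTestT_apply hγ, derivTestT_apply hγ]

/-- The transpose of the Orr--Sommerfeld operator, acting on test functions. -/
def osTestT (α ε : ℝ) (c : ℂ) (γ W : ℝ → ℂ) : TestFun a b →ₗ[ℂ] TestFun a b :=
  (Complex.I * (α : ℂ)⁻¹ * (ε : ℂ) ^ 2) • lapTestT α γ ∘ₗ lapTestT α γ +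
    lapTestT α γ ∘ₗ mulTest (fun x => W x - c) -
    mulTest (curveDeriv a b γ (curveDeriv a b γ W))

theorem osTestT_apply (hγ : IsShearCurve a b γ W) (φ : TestFun a b) :
    ((osTestT α ε c γ W φ : TestFun a b) : ℝ → ℂ) = orrSommerfeldT a b α ε c γ W φ := by
  funext x
  have h : ((osTestT α ε c γ W φ : TestFun a b) : 𝓢(ℝ, ℂ)) x =
    Complex.I * (α : ℂ)⁻¹ * (ε : ℂ) ^ 2 * (lapTestT α γ (lapTestT α γ φ) : 𝓢(ℝ, ℂ)) x +
      (lapTestT α γ (mulTest (fun x => W x - c) φ) : 𝓢(ℝ, ℂ)) x -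
      (mulTest (curveDeriv a b γ (curveDeriv a b γ W)) φ : 𝓢(ℝ, ℂ)) x := rfl
  have h1 : ((mulTest (fun x => W x - c) φ : TestFun a b) : ℝ → ℂ) =
      fun x => (W x - c) * (φ : 𝓢(ℝ, ℂ)) x :=
    funext (mulTest_apply (hγ.smooth_profile.sub contDiffOn_const) φ)
  rw [h, orrSommerfeldT, lapTestT_apply hγ, lapTestT_apply hγ, lapTestT_apply hγ, h1,
    mulTest_apply (hγ.curveDeriv (hγ.curveDeriv hγ.smooth_profile))]

/-- The derivative along a curve, in the sense of distributions. -/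
def curveDerivF (γ : ℝ → ℂ) : Func a b →ₗ[ℂ] Func a b :=
  mulF (fun x => (derivWithin γ (Icc a b) x)⁻¹) ∘ₗ derivF

/-- The operator `∂² - α²`, in the sense of distributions. -/
def lapF (α : ℝ) (γ : ℝ → ℂ) : Func a b →ₗ[ℂ] Func a b :=
  curveDerivF γ ∘ₗ curveDerivF γ - (α : ℂ) ^ 2 • LinearMap.id

/-- The Orr--Sommerfeld operator, in the sense of distributions. -/
def osF (α ε : ℝ) (c : ℂ) (γ W : ℝ → ℂ) : Func a b →ₗ[ℂ] Func a b :=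
  (Complex.I * (α : ℂ)⁻¹ * (ε : ℂ) ^ 2) • lapF α γ ∘ₗ lapF α γ +
    mulF (fun x => W x - c) ∘ₗ lapF α γ - mulF (curveDeriv a b γ (curveDeriv a b γ W))

theorem curveDerivF_apply (w : Func a b) (φ : TestFun a b) :
    curveDerivF γ w φ = w (derivTestT γ φ) := by
  change -w _ = w (-_)
  rw [map_neg]
  rfl

theorem lapF_apply (w : Func a b) (φ : TestFun a b) : lapF α γ w φ = w (lapTestT α γ φ) := by
  have h1 : lapF α γ w φ = curveDerivF γ (curveDerivF γ w) φ - (α : ℂ) ^ 2 • w φ := rfl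
  have h2 : lapTestT α γ φ = derivTestT γ (derivTestT γ φ) - (α : ℂ) ^ 2 • φ := rfl
  rw [h1, h2, map_sub, map_smul, curveDerivF_apply, curveDerivF_apply]

theorem osF_apply (w : Func a b) (φ : TestFun a b) :
    osF α ε c γ W w φ = w (osTestT α ε c γ W φ) := by
  have h1 : osF α ε c γ W w φ =
    (Complex.I * (α : ℂ)⁻¹ * (ε : ℂ) ^ 2) • lapF α γ (lapF α γ w) φ +
    mulF (fun x => W x - c) (lapF α γ w) φ - mulF (curveDeriv a b γ (curveDeriv a b γ W)) w φ := rfl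
  have h2 : osTestT α ε c γ W φ =
    (Complex.I * (α : ℂ)⁻¹ * (ε : ℂ) ^ 2) • lapTestT α γ (lapTestT α γ φ) +
    lapTestT α γ (mulTest (fun x => W x - c) φ) -
    mulTest (curveDeriv a b γ (curveDeriv a b γ W)) φ := rfl
  rw [h1, h2, map_sub, map_add, map_smul, lapF_apply, lapF_apply, mulF_apply, mulF_apply,
    lapF_apply]

/-- The transpose of a test function is again a test function (`osTestT_apply`), so every `φ` has a
matching `ψ` and the weak formulation loses nothing. -/
theorem weakEq_iff (hγ : IsShearCurve a b γ W) (u w : Func a b) :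
    WeakEq α ε c γ W u w ↔ w = osF α ε c γ W u := by
  constructor
  · intro h
    refine LinearMap.ext fun φ => ?_
    rw [osF_apply]
    exact h φ _ fun x => congrFun (osTestT_apply hγ φ) x
  · rintro rfl φ ψ h
    rw [osF_apply]
    congr 1
    exact TestFun.ext fun x => by rw [h, osTestT_apply hγ]

theorem MemSob.curveDerivF (hab : a < b) {s : ℝ} {w : Func a b} (h : MemSob (s + 1) w) :
    MemSob s (curveDerivF γ w) := by
  have := (h.derivF).mulF hab fun x => (derivWithin γ (Icc a b) x)⁻¹
  rwa [add_sub_cancel_right] at this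

theorem MemSob.lapF (hab : a < b) {s : ℝ} {w : Func a b} (h : MemSob (s + 2) w) :
    MemSob s (lapF α γ w) := by
  have h1 : MemSob (s + 1 + 1) w := h.mono (by linarith)
  have h2 := (h1.curveDerivF (γ := γ) hab).curveDerivF (γ := γ) hab
  have h3 := h2.add ((h.mono (s' := s) (by linarith)).smul (-(α : ℂ) ^ 2))
  convert! h3 using 1
  simp [OrrSommerfeld.lapF, sub_eq_add_neg]

theorem MemSob.osF (hab : a < b) {s : ℝ} {w : Func a b} (h : MemSob (s + 4) w) :
    MemSob s (osF α ε c γ W w) := by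
  have h1 : MemSob (s + 2) (OrrSommerfeld.lapF α γ w) :=
    (h.mono (s' := s + 2 + 2) (by linarith)).lapF hab
  have h2 : MemSob s (OrrSommerfeld.lapF α γ w) := h1.mono (by linarith)
  have h3 : MemSob s w := h.mono (by linarith)
  have h4 := (((h1.lapF (α := α) (γ := γ) hab).smul (Complex.I * (α : ℂ)⁻¹ * (ε : ℂ) ^ 2)).add
    (h2.mulF hab fun x => W x - c)).add
    ((h3.mulF hab (curveDeriv a b γ (curveDeriv a b γ W))).smul (-1))
  convert! h4 using 1
  simp [OrrSommerfeld.osF, sub_eq_add_neg]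

/-- A transposed operator that maps `H^s` to `H^t` is bounded between these spaces. -/
theorem exists_clm_of_forall_memSob {s t : ℝ} (F : Func a b →ₗ[ℂ] Func a b)
    (F' : TestFun a b → TestFun a b) (hF : ∀ w φ, F w φ = w (F' φ))
    (h : ∀ w, MemSob s w → MemSob t (F w)) :
    ∃ T : Sob a b s →L[ℂ] Sob a b t, ∀ u, (T u).toFunc = F u.toFunc := by
  choose T hT using fun u : Sob a b s => (h _ (memSob_toFunc u)).exists_sob
  let T' : Sob a b s →ₗ[ℂ] Sob a b t :=
    { toFun := T
      map_add' := fun u v => Sob.toFunc_injective (by simp [hT])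
      map_smul' := fun k u => Sob.toFunc_injective (by simp [hT]) }
  have hlim : ∀ {r : ℝ} {u : ℕ → Sob a b r} {v : Sob a b r} (φ : TestFun a b),
      Filter.Tendsto u Filter.atTop (𝓝 v) →
      Filter.Tendsto (fun n => (u n).toFunc φ) Filter.atTop (𝓝 (v.toFunc φ)) := by
    intro r u v φ hu
    have hc : Continuous fun u : Sob a b r => u.toFunc φ :=
      AddMonoidHomClass.continuous_of_bound
        ((LinearMap.applyₗ φ).comp (Sob.toFunc (a := a) (b := b) (s := r)))
        (sobNorm (-r) φ) fun u => (u.norm_toFunc_le φ).trans_eq (mul_comm _ _)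
    exact (hc.tendsto v).comp hu
  -- Closed graph theorem: against a fixed test function both sides pass to the limit, since `F`
  -- acts through its transpose.
  refine ⟨⟨T', T'.continuous_of_seq_closed_graph fun u x y hu hTu => ?_⟩, hT⟩
  refine Sob.toFunc_injective (LinearMap.ext fun φ => ?_)
  refine tendsto_nhds_unique (hlim φ hTu) ?_
  have h1 : ∀ n, (T' (u n)).toFunc φ = (u n).toFunc (F' φ) := fun n => by
    rw [← hF, ← hT]; rfl
  have h2 : (T' x).toFunc φ = x.toFunc (F' φ) := by rw [← hF, ← hT]; rfl
  simp only [Function.comp_apply, h1, h2]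
  exact hlim _ hu

theorem exists_sob_osF (hab : a < b) (α ε : ℝ) (c : ℂ) (γ W : ℝ → ℂ) (t : ℝ) :
    ∃ T : Sob a b (t + 4) →L[ℂ] Sob a b t, ∀ u, (T u).toFunc = osF α ε c γ W u.toFunc :=
  exists_clm_of_forall_memSob _ (osTestT α ε c γ W) osF_apply fun _ hw => hw.osF hab

theorem curveDerivF_funF (hγ : IsShearCurve a b γ W) {f : ℝ → ℂ}
    (hf : ContDiffOn ℝ ∞ f (Icc a b)) :
    curveDerivF γ (funF f hf.continuousOn) =
      funF (curveDeriv a b γ f) (hγ.curveDeriv hf).continuousOn := by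
  have h1 := derivF_funF hγ.lt hf.continuousOn
    (contDiffOn_derivWithin hγ.lt hf).continuousOn
    (fun x hx => ((hf.differentiableOn (by simp)) x (Ioo_subset_Icc_self hx)).hasDerivWithinAt.hasDerivAt
      (Icc_mem_nhds hx.1 hx.2))
  rw [curveDerivF, LinearMap.comp_apply, h1, mulF_funF _ hγ.invSpeed]
  refine LinearMap.ext fun φ => ?_
  simp only [funF, curveDeriv, LinearMap.coe_mk, AddHom.coe_mk, div_eq_inv_mul]

theorem funF_congr {f g : ℝ → ℂ} {hf : ContinuousOn f (Icc a b)} {hg : ContinuousOn g (Icc a b)}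
    (h : EqOn f g (Icc a b)) : funF f hf = funF g hg :=
  LinearMap.ext fun φ => setIntegral_congr_fun measurableSet_Ioo fun x hx => by
    simp only [h (Ioo_subset_Icc_self hx)]

theorem funF_add {f g : ℝ → ℂ} (hf : ContinuousOn f (Icc a b)) (hg : ContinuousOn g (Icc a b)) :
    funF (fun x => f x + g x) (hf.add hg) = funF f hf + funF g hg := by
  refine LinearMap.ext fun φ => ?_
  have h : ∀ {f : ℝ → ℂ}, ContinuousOn f (Icc a b) →
      IntegrableOn (fun x => (φ : 𝓢(ℝ, ℂ)) x * f x) (Ioo a b) := fun hf =>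
    (((φ : 𝓢(ℝ, ℂ)).continuous.continuousOn.mul hf).integrableOn_Icc).mono_set Ioo_subset_Icc_self
  change ∫ x in Ioo a b, (φ : 𝓢(ℝ, ℂ)) x * (f x + g x) =
    (∫ x in Ioo a b, (φ : 𝓢(ℝ, ℂ)) x * f x) + ∫ x in Ioo a b, (φ : 𝓢(ℝ, ℂ)) x * g x
  rw [← integral_add (h hf) (h hg)]
  simp [mul_add]

theorem funF_const_mul {f : ℝ → ℂ} (k : ℂ) (hf : ContinuousOn f (Icc a b)) :
    funF (fun x => k * f x) ((continuousOn_const (c := k)).mul hf) = k • funF f hf := by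
  have h : ContDiffOn ℝ ∞ (fun _ : ℝ => k) (Icc a b) := contDiffOn_const
  rw [← mulF_const, mulF_funF hf h]

theorem lapF_funF (hγ : IsShearCurve a b γ W) {f : ℝ → ℂ} (hf : ContDiffOn ℝ ∞ f (Icc a b)) :
    lapF α γ (funF f hf.continuousOn) = funF (lap a b α γ f) (hγ.lap hf).continuousOn := by
  rw [lapF, LinearMap.sub_apply, LinearMap.comp_apply, curveDerivF_funF hγ hf,
    curveDerivF_funF hγ (hγ.curveDeriv hf), LinearMap.smul_apply, LinearMap.id_apply,
    sub_eq_iff_eq_add, ← funF_const_mul, ← funF_add (hγ.lap hf).continuousOn]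
  exact funF_congr fun x _ => by simp [lap]

theorem osF_funF (hγ : IsShearCurve a b γ W) {f : ℝ → ℂ} (hf : ContDiffOn ℝ ∞ f (Icc a b)) :
    osF α ε c γ W (funF f hf.continuousOn) =
      funF (orrSommerfeld a b α ε c γ W f) (hγ.orrSommerfeld hf).continuousOn := by
  have hWc : ContDiffOn ℝ ∞ (fun x => W x - c) (Icc a b) := hγ.smooth_profile.sub contDiffOn_const
  have hL := hγ.lap (α := α) hf
  have hLL := hγ.lap (α := α) hL
  have hW2 := hγ.curveDeriv (hγ.curveDeriv hγ.smooth_profile)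
  rw [osF, LinearMap.sub_apply, LinearMap.add_apply, LinearMap.smul_apply, LinearMap.comp_apply,
    LinearMap.comp_apply, lapF_funF hγ hf, lapF_funF hγ hL, mulF_funF _ hWc, mulF_funF _ hW2,
    sub_eq_iff_eq_add, ← funF_const_mul, ← funF_add
      (f := fun x => Complex.I * (α : ℂ)⁻¹ * (ε : ℂ) ^ 2 * lap a b α γ (lap a b α γ f) x)
      (g := fun x => (W x - c) * lap a b α γ f x) (continuousOn_const.mul hLL.continuousOn)
      (hWc.continuousOn.mul hL.continuousOn),
    ← funF_add (g := fun x => curveDeriv a b γ (curveDeriv a b γ W) x * f x)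
      (hγ.orrSommerfeld hf).continuousOn (hW2.continuousOn.mul hf.continuousOn)]
  exact funF_congr fun x _ => by simp [orrSommerfeld]

/-! ### Reduction to a first order system -/

/-- The leading coefficient of the Orr--Sommerfeld operator. -/
def leadCoeff (α ε : ℝ) : ℂ := Complex.I * (α : ℂ)⁻¹ * (ε : ℂ) ^ 2

theorem leadCoeff_ne_zero (hα : α ≠ 0) (hε : ε ≠ 0) : leadCoeff α ε ≠ 0 := by
  simp [leadCoeff, hα, hε]

/-- The matrix of the system `∂ Y = B Y` for `Y = (u, ∂u, (∂² - α²)u, ∂(∂² - α²)u)`, where `v` and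
`w` are the values of `U - c` and `U''`. -/
def coreMatrix (α : ℝ) (κ v w : ℂ) : Matrix (Fin 4) (Fin 4) ℂ :=
  !![0, 1, 0, 0; (α : ℂ) ^ 2, 0, 1, 0; 0, 0, 0, 1; κ⁻¹ * w, 0, (α : ℂ) ^ 2 - κ⁻¹ * v, 0]

/-- The matrix of the first order system with respect to the parameter of the curve. -/
def sysMatrix (a b α ε : ℝ) (c : ℂ) (γ W : ℝ → ℂ) (x : ℝ) : Matrix (Fin 4) (Fin 4) ℂ :=
  derivWithin γ (Icc a b) x •
    coreMatrix α (leadCoeff α ε) (W x - c) (curveDeriv a b γ (curveDeriv a b γ W) x)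

/-- The inhomogeneous term of the first order system. -/
def sysSource (a b α ε : ℝ) (γ F : ℝ → ℂ) (x : ℝ) : Fin 4 → ℂ :=
  ![0, 0, 0, derivWithin γ (Icc a b) x * (leadCoeff α ε)⁻¹ * F x]

/-- The vector of the unknowns of the first order system. -/
def sysVec (a b α : ℝ) (γ f : ℝ → ℂ) (x : ℝ) : Fin 4 → ℂ :=
  ![f x, curveDeriv a b γ f x, lap a b α γ f x, curveDeriv a b γ (lap a b α γ f) x]

theorem sysMatrix_mulVec_add (F : ℝ → ℂ) (x : ℝ) (v : Fin 4 → ℂ) :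
    (sysMatrix a b α ε c γ W x).mulVec v + sysSource a b α ε γ F x =
      ![derivWithin γ (Icc a b) x * v 1, derivWithin γ (Icc a b) x * (v 2 + (α : ℂ) ^ 2 * v 0),
        derivWithin γ (Icc a b) x * v 3, derivWithin γ (Icc a b) x * ((leadCoeff α ε)⁻¹ *
          curveDeriv a b γ (curveDeriv a b γ W) x * v 0 +
          ((α : ℂ) ^ 2 - (leadCoeff α ε)⁻¹ * (W x - c)) * v 2 + (leadCoeff α ε)⁻¹ * F x)] := by
  ext i
  fin_cases i <;>
    simp [sysMatrix, sysSource, coreMatrix, dotProduct, Fin.sum_univ_four] <;> ring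

theorem sysSource_zero (x : ℝ) : sysSource a b α ε γ (fun _ => 0) x = 0 := by
  ext i
  fin_cases i <;> simp [sysSource]

theorem contDiffOn_sysMatrix (hγ : IsShearCurve a b γ W) (i j : Fin 4) :
    ContDiffOn ℝ ∞ (fun x => sysMatrix a b α ε c γ W x i j) (Icc a b) := by
  have h1 := hγ.speed
  have h2 := hγ.curveDeriv (hγ.curveDeriv hγ.smooth_profile)
  have h3 := hγ.smooth_profile
  simp only [sysMatrix, Matrix.smul_apply, smul_eq_mul]
  refine h1.mul ?_
  fin_cases i <;> fin_cases j <;> simp only [coreMatrix, Matrix.of_apply, Fin.zero_eta, Fin.mk_one,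
    Fin.reduceFinMk, Matrix.cons_val] <;> fun_prop

theorem contDiffOn_sysSource (hγ : IsShearCurve a b γ W) {F : ℝ → ℂ}
    (hF : ContDiffOn ℝ ∞ F (Icc a b)) : ContDiffOn ℝ ∞ (sysSource a b α ε γ F) (Icc a b) := by
  have h1 := hγ.speed
  rw [contDiffOn_pi]
  intro i
  fin_cases i <;> simp only [sysSource, Fin.zero_eta, Fin.mk_one,
    Fin.reduceFinMk, Matrix.cons_val] <;> fun_prop

theorem hasDerivWithinAt_curveDeriv (hγ : IsShearCurve a b γ W) {f : ℝ → ℂ}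
    (hf : ContDiffOn ℝ ∞ f (Icc a b)) {x : ℝ} (hx : x ∈ Icc a b) :
    HasDerivWithinAt f (derivWithin γ (Icc a b) x * curveDeriv a b γ f x) (Icc a b) x := by
  refine (hf.differentiableOn (by simp) x hx).hasDerivWithinAt.congr_deriv ?_
  rw [curveDeriv, mul_div_cancel₀ _ (hγ.deriv_ne x hx)]

theorem curveDeriv_eq_of_hasDerivWithinAt (hγ : IsShearCurve a b γ W) {f : ℝ → ℂ} {y : ℂ} {x : ℝ}
    (hx : x ∈ Icc a b)
    (h : HasDerivWithinAt f (derivWithin γ (Icc a b) x * y) (Icc a b) x) :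
    curveDeriv a b γ f x = y := by
  rw [curveDeriv, h.derivWithin (uniqueDiffOn_Icc hγ.lt x hx),
    mul_div_cancel_left₀ _ (hγ.deriv_ne x hx)]

/-- The first three rows only name the successive unknowns; the last is the equation solved for its
top order term, which uses `leadCoeff α ε ≠ 0`. -/
theorem sysVec_hasDerivWithinAt (hα : α ≠ 0) (hε : ε ≠ 0) (hγ : IsShearCurve a b γ W)
    {f F : ℝ → ℂ} (hf : ContDiffOn ℝ ∞ f (Icc a b)) {x : ℝ} (hx : x ∈ Icc a b)
    (hF : orrSommerfeld a b α ε c γ W f x = F x) :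
    HasDerivWithinAt (sysVec a b α γ f) ((sysMatrix a b α ε c γ W x).mulVec (sysVec a b α γ f x) +
      sysSource a b α ε γ F x) (Icc a b) x := by
  have hκ := leadCoeff_ne_zero hα hε
  have h0 := hasDerivWithinAt_curveDeriv hγ hf hx
  have h1 := hasDerivWithinAt_curveDeriv hγ (hγ.curveDeriv hf) hx
  have h2 := hasDerivWithinAt_curveDeriv hγ (hγ.lap (α := α) hf) hx
  have h3 := hasDerivWithinAt_curveDeriv hγ (hγ.curveDeriv (hγ.lap (α := α) hf)) hx
  have h4 : curveDeriv a b γ (curveDeriv a b γ (lap a b α γ f)) x =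
    lap a b α γ (lap a b α γ f) x + (α : ℂ) ^ 2 * lap a b α γ f x := by simp [lap]
  have h5 : orrSommerfeld a b α ε c γ W f x = leadCoeff α ε * lap a b α γ (lap a b α γ f) x +
    (W x - c) * lap a b α γ f x - curveDeriv a b γ (curveDeriv a b γ W) x * f x := rfl
  rw [sysMatrix_mulVec_add, hasDerivWithinAt_pi]
  intro i
  fin_cases i
  · exact h0
  · refine h1.congr_deriv ?_
    simp [sysVec, lap]
  · exact h2
  · refine h3.congr_deriv ?_
    simp only [sysVec, Fin.reduceFinMk, Matrix.cons_val]
    rw [h4, ← hF, h5]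
    field_simp
    ring

/-- Conversely, the first three rows force a solution of the system to be the vector built from its
component 0, and the fourth row then becomes the equation for that component. -/
theorem sysVec_of_hasDerivWithinAt (hα : α ≠ 0) (hε : ε ≠ 0) (hγ : IsShearCurve a b γ W)
    {Y : ℝ → Fin 4 → ℂ} {F : ℝ → ℂ}
    (hY : ∀ x ∈ Icc a b, HasDerivWithinAt Y
      ((sysMatrix a b α ε c γ W x).mulVec (Y x) + sysSource a b α ε γ F x) (Icc a b) x) :
    EqOn (sysVec a b α γ fun x => Y x 0) Y (Icc a b) ∧
      ∀ x ∈ Icc a b, orrSommerfeld a b α ε c γ W (fun x => Y x 0) x = F x := by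
  have hκ := leadCoeff_ne_zero hα hε
  simp only [sysMatrix_mulVec_add] at hY
  have h0 : EqOn (curveDeriv a b γ fun x => Y x 0) (fun x => Y x 1) (Icc a b) := fun x hx => by
    exact curveDeriv_eq_of_hasDerivWithinAt hγ hx
      (hasDerivWithinAt_pi.1 (hY x hx) 0)
  have h1 : EqOn (curveDeriv a b γ fun x => Y x 1) (fun x => Y x 2 + (α : ℂ) ^ 2 * Y x 0)
      (Icc a b) := fun x hx => by
    exact curveDeriv_eq_of_hasDerivWithinAt hγ hx
      (hasDerivWithinAt_pi.1 (hY x hx) 1)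
  have h2 : EqOn (curveDeriv a b γ fun x => Y x 2) (fun x => Y x 3) (Icc a b) := fun x hx => by
    exact curveDeriv_eq_of_hasDerivWithinAt hγ hx
      (hasDerivWithinAt_pi.1 (hY x hx) 2)
  have h3 : EqOn (curveDeriv a b γ fun x => Y x 3) (fun x => (leadCoeff α ε)⁻¹ *
      curveDeriv a b γ (curveDeriv a b γ W) x * Y x 0 +
      ((α : ℂ) ^ 2 - (leadCoeff α ε)⁻¹ * (W x - c)) * Y x 2 + (leadCoeff α ε)⁻¹ * F x)
      (Icc a b) := fun x hx => by
    exact curveDeriv_eq_of_hasDerivWithinAt hγ hx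
      (hasDerivWithinAt_pi.1 (hY x hx) 3)
  have hL : EqOn (lap a b α γ fun x => Y x 0) (fun x => Y x 2) (Icc a b) := fun x hx => by
    rw [lap, curveDeriv_congr h0 hx, h1 hx]
    ring
  have hDL : EqOn (curveDeriv a b γ (lap a b α γ fun x => Y x 0)) (fun x => Y x 3) (Icc a b) :=
    (curveDeriv_congr hL).trans h2
  refine ⟨fun x hx => ?_, fun x hx => ?_⟩
  · ext i
    fin_cases i
    · rfl
    · exact h0 hx
    · exact hL hx
    · exact hDL hx
  · have h5 : orrSommerfeld a b α ε c γ W (fun x => Y x 0) x =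
      leadCoeff α ε * lap a b α γ (lap a b α γ fun x => Y x 0) x +
      (W x - c) * lap a b α γ (fun x => Y x 0) x -
      curveDeriv a b γ (curveDeriv a b γ W) x * Y x 0 := rfl
    rw [h5, hL hx, lap_congr hL hx, lap, curveDeriv_congr h2 hx, h3 hx]
    field_simp
    ring

/-- The Cauchy problem for the Orr--Sommerfeld equation. -/
theorem exists_orrSommerfeld_eq (hα : α ≠ 0) (hε : ε ≠ 0) (c : ℂ) (hγ : IsShearCurve a b γ W)
    {F : ℝ → ℂ} (hF : ContDiffOn ℝ ∞ F (Icc a b)) (v : Fin 4 → ℂ) :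
    ∃ f : ℝ → ℂ, ContDiffOn ℝ ∞ f (Icc a b) ∧ sysVec a b α γ f a = v ∧
      ∀ x ∈ Icc a b, orrSommerfeld a b α ε c γ W f x = F x := by
  obtain ⟨Y, hY0, hY⟩ := exists_real_solution hγ.lt (continuousOn_pi.2 fun i => continuousOn_pi.2
    fun j => (contDiffOn_sysMatrix (α := α) (ε := ε) (c := c) hγ i j).continuousOn)
    (contDiffOn_sysSource (α := α) (ε := ε) hγ hF).continuousOn v
  have hYs := contDiffOn_solution hγ.lt (contDiffOn_sysMatrix hγ) (contDiffOn_sysSource hγ hF) hY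
  obtain ⟨h1, h2⟩ := sysVec_of_hasDerivWithinAt hα hε hγ hY
  exact ⟨fun x => Y x 0, contDiffOn_pi.1 hYs 0, by rw [h1 (left_mem_Icc.2 hγ.lt.le), hY0], h2⟩

theorem orrSommerfeld_unique (hα : α ≠ 0) (hε : ε ≠ 0) (hγ : IsShearCurve a b γ W)
    {f : ℝ → ℂ} (hf : ContDiffOn ℝ ∞ f (Icc a b)) (h0 : sysVec a b α γ f a = 0)
    (h : ∀ x ∈ Icc a b, orrSommerfeld a b α ε c γ W f x = 0) : ∀ x ∈ Icc a b, f x = 0 := by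
  intro x hx
  have := solution_eq_zero hγ.lt (contDiffOn_sysMatrix (α := α) (ε := ε) (c := c) hγ)
    (convex_Icc a b) subset_rfl (fun x hx => by
      have := sysVec_hasDerivWithinAt (F := fun _ => 0) hα hε hγ hf hx (h x hx)
      rwa [sysSource_zero, add_zero] at this) (left_mem_Icc.2 hγ.lt.le) h0 hx
  exact congrFun this 0

/-! ### Solvability and regularity in the sense of distributions -/

section System

variable {ι : Type*} [Fintype ι]

/-- The action of a matrix of functions on a vector of distributions. -/
def matF (A : ℝ → Matrix ι ι ℂ) (w : ι → Func a b) (i : ι) : Func a b :=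
  ∑ j, mulF (fun x => A x i j) (w j)

theorem contDiffOn_matrix_mul {A B : ℝ → Matrix ι ι ℂ}
    (hA : ∀ i j, ContDiffOn ℝ ∞ (fun x => A x i j) (Icc a b))
    (hB : ∀ i j, ContDiffOn ℝ ∞ (fun x => B x i j) (Icc a b)) (i j : ι) :
    ContDiffOn ℝ ∞ (fun x => (A x * B x) i j) (Icc a b) := by
  simp only [Matrix.mul_apply]
  exact ContDiffOn.sum fun l _ => (hA i l).mul (hB l j)

theorem matF_matF {A B : ℝ → Matrix ι ι ℂ}
    (hA : ∀ i j, ContDiffOn ℝ ∞ (fun x => A x i j) (Icc a b))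
    (hB : ∀ i j, ContDiffOn ℝ ∞ (fun x => B x i j) (Icc a b)) (w : ι → Func a b) :
    matF A (matF B w) = matF (fun x => A x * B x) w := by
  funext i
  simp only [matF, map_sum, Matrix.mul_apply]
  rw [Finset.sum_comm]
  refine Finset.sum_congr rfl fun j _ => ?_
  rw [mulF_sum _ fun l => (hA i l).mul (hB l j)]
  exact Finset.sum_congr rfl fun l _ => mulF_mulF (hA i l) (hB l j) _

theorem matF_congr {A B : ℝ → Matrix ι ι ℂ}
    (hA : ∀ i j, ContDiffOn ℝ ∞ (fun x => A x i j) (Icc a b)) (h : EqOn A B (Icc a b))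
    (w : ι → Func a b) : matF A w = matF B w :=
  funext fun i => Finset.sum_congr rfl fun j _ => mulF_congr (hA i j) (fun x hx => by simp [h hx]) _

theorem matF_one [DecidableEq ι] (w : ι → Func a b) : matF (fun _ => 1) w = w := by
  funext i
  simp only [matF, mulF_const, Matrix.one_apply, ite_smul, one_smul, zero_smul]
  simp

theorem matF_neg {A : ℝ → Matrix ι ι ℂ} (hA : ∀ i j, ContDiffOn ℝ ∞ (fun x => A x i j) (Icc a b))
    (w : ι → Func a b) : matF (fun x => -A x) w = -matF A w := by
  funext i
  simp only [matF, Pi.neg_apply, ← Finset.sum_neg_distrib, Matrix.neg_apply]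
  refine Finset.sum_congr rfl fun j _ => ?_
  have h := mulF_add (hA i j) (hA i j).neg (w j)
  have h0 := mulF_const 0 (w j)
  simp only [add_neg_cancel] at h
  rw [zero_smul] at h0
  rw [h0] at h
  exact (neg_eq_of_add_eq_zero_right h.symm).symm

theorem derivF_matF (hab : a < b) {A A' : ℝ → Matrix ι ι ℂ}
    (hA : ∀ i j, ContDiffOn ℝ ∞ (fun x => A x i j) (Icc a b))
    (hA' : ∀ x ∈ Icc a b, ∀ i j, HasDerivWithinAt (fun x => A x i j) (A' x i j) (Icc a b) x)
    (w : ι → Func a b) :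
    (fun i => derivF (matF A w i)) = matF A' w + matF A fun i => derivF (w i) := by
  funext i
  simp only [matF, map_sum, Pi.add_apply, ← Finset.sum_add_distrib]
  refine Finset.sum_congr rfl fun j _ => ?_
  rw [derivF_mulF hab (hA i j), mulF_congr (contDiffOn_derivWithin hab (hA i j))
    fun x hx => (hA' x hx i j).derivWithin (uniqueDiffOn_Icc hab x hx)]

theorem memSob_matF (hab : a < b) {s : ℝ} {w : ι → Func a b} (A : ℝ → Matrix ι ι ℂ)
    (hw : ∀ i, MemSob s (w i)) (i : ι) : MemSob s (matF A w i) :=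
  MemSob.sum _ fun j => (hw j).mulF hab _

variable [DecidableEq ι]

/-- Variation of constants for a linear system of distributions. -/
theorem exists_system_solution (hab : a < b) {A : ℝ → Matrix ι ι ℂ} {s : ℝ} {h : ι → Func a b}
    (hA : ∀ i j, ContDiffOn ℝ ∞ (fun x => A x i j) (Icc a b)) (hh : ∀ i, MemSob s (h i)) :
    ∃ Y : ι → Func a b, (∀ i, MemSob (s + 1) (Y i)) ∧
      (fun i => derivF (Y i)) = matF A Y + h := by
  obtain ⟨Φ, Ψ, hΦs, hΨs, hΦ, -, hΦΨ, -⟩ := exists_fundamental_matrix hab hA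
  -- With `Y = Φ Z` the system reduces to `Z' = Ψ h`, solved by primitives component by component.
  choose Z hZ hZs using fun i => (memSob_matF hab Ψ hh i).exists_primitive hab
  refine ⟨matF Φ Z, memSob_matF hab Φ hZs, ?_⟩
  rw [derivF_matF hab hΦs hΦ, funext hZ, matF_matF hA hΦs]
  congr 1
  rw [matF_matF hΦs hΨs, matF_congr (contDiffOn_matrix_mul hΦs hΨs) hΦΨ, matF_one]

/-- Distributional solutions of a homogeneous linear system are smooth. -/
theorem exists_eq_funF_of_system (hab : a < b) {A : ℝ → Matrix ι ι ℂ} {Y : ι → Func a b}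
    (hA : ∀ i j, ContDiffOn ℝ ∞ (fun x => A x i j) (Icc a b))
    (hY : (fun i => derivF (Y i)) = matF A Y) (i : ι) :
    ∃ (f : ℝ → ℂ) (hf : ContDiffOn ℝ ∞ f (Icc a b)), Y i = funF f hf.continuousOn := by
  obtain ⟨Φ, Ψ, hΦs, hΨs, -, hΨ, hΦΨ, -⟩ := exists_fundamental_matrix hab hA
  -- `Ψ Y` has derivative zero, so by du Bois-Reymond it is a vector of constants, and `Y = Φ (Ψ Y)`
  -- is smooth.
  have hZ : (fun i => derivF (matF Ψ Y i)) = 0 := by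
    rw [derivF_matF hab hΨs (A' := fun x => -(Ψ x * A x)) hΨ, hY, matF_matF hΨs hA,
      matF_neg (contDiffOn_matrix_mul hΨs hA), neg_add_cancel]
  choose k hk using fun i => eq_const_of_derivF_eq_zero hab (congrFun hZ i)
  have h1 : Y = matF Φ fun i => k i • funF (fun _ => 1) continuousOn_const := by
    rw [← funext hk]
    rw [matF_matF hΦs hΨs, matF_congr (contDiffOn_matrix_mul hΦs hΨs) hΦΨ, matF_one]
  have h2 : ∀ j, ContDiffOn ℝ ∞ (fun x => Φ x i j * k j) (Icc a b) := fun j =>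
    (hΦs i j).mul contDiffOn_const
  have h3 : ContDiffOn ℝ ∞ (fun x => ∑ j, Φ x i j * k j) (Icc a b) := ContDiffOn.sum fun j _ => h2 j
  refine ⟨_, h3, ?_⟩
  have h4 : funF _ h3.continuousOn =
      mulF (fun x => ∑ j, Φ x i j * k j) (funF (fun _ => 1) continuousOn_const) := by
    rw [mulF_funF _ h3]
    simp
  rw [h4, mulF_sum _ h2]
  conv_lhs => rw [h1]
  refine Finset.sum_congr rfl fun j _ => ?_
  change mulF (fun x => Φ x i j) (k j • funF (fun _ => 1) continuousOn_const) = _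
  rw [← mulF_const, mulF_mulF (hΦs i j) contDiffOn_const]

end System

/-! ### The distributional equation as a first order system. -/

/-- The vector of the unknowns of the first order system, for distributions. -/
def sysVecF (α : ℝ) (γ : ℝ → ℂ) (u : Func a b) : Fin 4 → Func a b :=
  ![u, curveDerivF γ u, lapF α γ u, curveDerivF γ (lapF α γ u)]

theorem mulF_speed_curveDerivF (hγ : IsShearCurve a b γ W) (u : Func a b) :
    mulF (derivWithin γ (Icc a b)) (curveDerivF γ u) = derivF u := by
  have h1 : ContDiffOn ℝ ∞ (fun _ : ℝ => (1 : ℂ)) (Icc a b) := contDiffOn_const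
  rw [curveDerivF, LinearMap.comp_apply, mulF_mulF hγ.speed hγ.invSpeed,
    ← mulF_congr h1 fun x hx => (mul_inv_cancel₀ (hγ.deriv_ne x hx)).symm, mulF_const, one_smul]

theorem curveDerivF_eq_of_derivF_eq (hγ : IsShearCurve a b γ W) {u v : Func a b}
    (h : derivF u = mulF (derivWithin γ (Icc a b)) v) : curveDerivF γ u = v := by
  have h1 : ContDiffOn ℝ ∞ (fun _ : ℝ => (1 : ℂ)) (Icc a b) := contDiffOn_const
  rw [curveDerivF, LinearMap.comp_apply, h, mulF_mulF hγ.invSpeed hγ.speed,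
    ← mulF_congr h1 fun x hx => (inv_mul_cancel₀ (hγ.deriv_ne x hx)).symm, mulF_const, one_smul]

theorem matF_sysMatrix (hγ : IsShearCurve a b γ W) (w : Fin 4 → Func a b) :
    matF (sysMatrix a b α ε c γ W) w =
      ![mulF (derivWithin γ (Icc a b)) (w 1),
        mulF (derivWithin γ (Icc a b)) (w 2 + (α : ℂ) ^ 2 • w 0),
        mulF (derivWithin γ (Icc a b)) (w 3), mulF (derivWithin γ (Icc a b))
          ((leadCoeff α ε)⁻¹ • mulF (curveDeriv a b γ (curveDeriv a b γ W)) (w 0) +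
          ((α : ℂ) ^ 2 • w 2 - (leadCoeff α ε)⁻¹ • mulF (fun x => W x - c) (w 2)))] := by
  have h1 := hγ.speed
  have h2 := hγ.curveDeriv (hγ.curveDeriv hγ.smooth_profile)
  have h3 : ContDiffOn ℝ ∞ (fun x => W x - c) (Icc a b) := hγ.smooth_profile.sub contDiffOn_const
  have hc : ∀ k : ℂ, ContDiffOn ℝ ∞ (fun _ : ℝ => k) (Icc a b) := fun k => contDiffOn_const
  have hmul : ∀ {f : ℝ → ℂ} (u : Func a b), ContDiffOn ℝ ∞ f (Icc a b) →
      mulF (fun x => derivWithin γ (Icc a b) x * f x) u =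
        mulF (derivWithin γ (Icc a b)) (mulF f u) := fun u hf => (mulF_mulF h1 hf u).symm
  have hc' : ∀ (k : ℂ) (u : Func a b), mulF (fun x => derivWithin γ (Icc a b) x * k) u =
        mulF (derivWithin γ (Icc a b)) (k • u) := fun k u => by
    rw [hmul u (hc k), mulF_const]
  funext i
  simp only [matF, sysMatrix, Matrix.smul_apply, smul_eq_mul, Fin.sum_univ_four]
  fin_cases i <;> simp only [coreMatrix, Matrix.of_apply, Fin.zero_eta, Fin.mk_one,
    Fin.reduceFinMk, Matrix.cons_val, hc', zero_smul, one_smul, map_zero, zero_add, add_zero]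
  · rw [← map_add, add_comm]
  · rw [hmul _ ((hc _).mul h2), hmul _ ((hc _).sub ((hc _).mul h3)), ← map_add,
      ← mulF_mulF (hc _) h2, mulF_const]
    congr 2
    rw [show (fun x => (α : ℂ) ^ 2 - (leadCoeff α ε)⁻¹ * (W x - c)) =
      fun x => (α : ℂ) ^ 2 + -(leadCoeff α ε)⁻¹ * (W x - c)
        from funext fun x => by ring,
    mulF_add (hc _) ((hc _).mul h3), ← mulF_mulF (hc _) h3, mulF_const, mulF_const, neg_smul,
      sub_eq_add_neg]

theorem osF_eq (u : Func a b) : osF α ε c γ W u = leadCoeff α ε • lapF α γ (lapF α γ u) +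
    mulF (fun x => W x - c) (lapF α γ u) - mulF (curveDeriv a b γ (curveDeriv a b γ W)) u := rfl

theorem lapF_eq (u : Func a b) :
    lapF α γ u = curveDerivF γ (curveDerivF γ u) - (α : ℂ) ^ 2 • u := rfl

/-- Variation of constants gains only one derivative in each component. The structure of the system
supplies the other three for component 0. -/
theorem exists_osF_eq (hα : α ≠ 0) (hε : ε ≠ 0) (hγ : IsShearCurve a b γ W) {t : ℝ}
    {f : Func a b} (hf : MemSob t f) : ∃ u, MemSob (t + 4) u ∧ osF α ε c γ W u = f := by
  have hκ := leadCoeff_ne_zero hα hε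
  set g := mulF (derivWithin γ (Icc a b)) ((leadCoeff α ε)⁻¹ • f) with hg
  have hgs : MemSob t g := (hf.smul _).mulF hγ.lt _
  obtain ⟨Y, hYs, hY⟩ := exists_system_solution hγ.lt
    (contDiffOn_sysMatrix (α := α) (ε := ε) (c := c) hγ) (h := ![0, 0, 0, g]) (s := t) (by
      intro i
      fin_cases i
      exacts [MemSob.zero, MemSob.zero, MemSob.zero, hgs])
  rw [matF_sysMatrix hγ] at hY
  have h0 : derivF (Y 0) = mulF (derivWithin γ (Icc a b)) (Y 1) := by simpa using congrFun hY 0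
  have h1 : derivF (Y 1) = mulF (derivWithin γ (Icc a b)) (Y 2 + (α : ℂ) ^ 2 • Y 0) := by
    simpa using congrFun hY 1
  have h2 : derivF (Y 2) = mulF (derivWithin γ (Icc a b)) (Y 3) := by simpa using congrFun hY 2
  have h3 : derivF (Y 3) = mulF (derivWithin γ (Icc a b))
      ((leadCoeff α ε)⁻¹ • mulF (curveDeriv a b γ (curveDeriv a b γ W)) (Y 0) +
      ((α : ℂ) ^ 2 • Y 2 - (leadCoeff α ε)⁻¹ • mulF (fun x => W x - c) (Y 2)) +
      (leadCoeff α ε)⁻¹ • f) := by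
    rw [map_add]
    exact congrFun hY 3
  have hreg : ∀ {s : ℝ} {u v : Func a b}, MemSob s v →
      derivF u = mulF (derivWithin γ (Icc a b)) v → MemSob (s + 1) u := by
    intro s u v hv huv
    refine MemSob.of_derivF hγ.lt ?_
    rw [huv]
    exact hv.mulF hγ.lt _
  -- From order `t + 1`: components 2 and 0 reach `t + 2`, then component 1 reaches `t + 3`, and
  -- finally component 0 reaches `t + 4`.
  have hm2 := hreg (hYs 3) h2
  have hm0 := hreg (hYs 1) h0
  have hm1 := hreg (hm2.add (hm0.smul _)) h1
  have hm0' := hreg hm1 h0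
  refine ⟨Y 0, hm0'.mono (by linarith), ?_⟩
  have hL : lapF α γ (Y 0) = Y 2 := by
    rw [lapF_eq, curveDerivF_eq_of_derivF_eq hγ h0, curveDerivF_eq_of_derivF_eq hγ h1,
      add_sub_cancel_right]
  rw [osF_eq, hL, lapF_eq, curveDerivF_eq_of_derivF_eq hγ h2, curveDerivF_eq_of_derivF_eq hγ h3]
  simp only [smul_sub, smul_add, smul_inv_smul₀ hκ]
  abel

/-- A distributional solution gives a distributional solution of the homogeneous system, hence a
smooth one; the equation then holds pointwise up to the endpoints by continuity. Consequently the
kernel is the same at every Sobolev order. -/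
theorem exists_classical_of_osF_eq_zero (hα : α ≠ 0) (hε : ε ≠ 0) (hγ : IsShearCurve a b γ W)
    {u : Func a b} (hu : osF α ε c γ W u = 0) :
    ∃ (f : ℝ → ℂ) (hf : ContDiffOn ℝ ∞ f (Icc a b)), u = funF f hf.continuousOn ∧
      ∀ x ∈ Icc a b, orrSommerfeld a b α ε c γ W f x = 0 := by
  have hκ := leadCoeff_ne_zero hα hε
  obtain ⟨f, hf, hfu⟩ := exists_eq_funF_of_system hγ.lt (Y := sysVecF α γ u)
    (contDiffOn_sysMatrix (α := α) (ε := ε) (c := c) hγ) (by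
      rw [matF_sysMatrix hγ]
      funext i
      fin_cases i
      · exact (mulF_speed_curveDerivF hγ u).symm
      · refine (mulF_speed_curveDerivF hγ (curveDerivF γ u)).symm.trans ?_
        simp [sysVecF, lapF_eq]
      · exact (mulF_speed_curveDerivF hγ (lapF α γ u)).symm
      · refine (mulF_speed_curveDerivF hγ (curveDerivF γ (lapF α γ u))).symm.trans ?_
        simp only [sysVecF, Fin.reduceFinMk, Matrix.cons_val]
        congr 1
        have h1 : curveDerivF γ (curveDerivF γ (lapF α γ u)) =
          lapF α γ (lapF α γ u) + (α : ℂ) ^ 2 • lapF α γ u := by simp [lapF_eq (lapF α γ u)]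
        have h2 : leadCoeff α ε • lapF α γ (lapF α γ u) =
            mulF (curveDeriv a b γ (curveDeriv a b γ W)) u -
              mulF (fun x => W x - c) (lapF α γ u) := by
          rw [osF_eq, sub_eq_zero] at hu
          rw [← hu, add_sub_cancel_right]
        rw [h1, ← inv_smul_smul₀ hκ (lapF α γ (lapF α γ u)), h2, smul_sub]
        abel) 0
  refine ⟨f, hf, hfu, ?_⟩
  have h1 : sysVecF α γ u 0 = u := rfl
  have h2 := hγ.orrSommerfeld (α := α) (ε := ε) (c := c) hf
  have h3 : funF (fun _ => 0) continuousOn_const = (0 : Func a b) :=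
    LinearMap.ext fun φ => by simp [funF]
  refine eqOn_of_funF_eq (g := fun _ => 0) hγ.lt h2.continuousOn continuousOn_const ?_
  rw [h3, ← osF_funF hγ hf, ← hfu, h1, hu]

/-! ### Restricting a surjective operator to a subspace of finite codimension. -/

section Fredholm

variable {X Y : Type*} [NormedAddCommGroup X] [NormedSpace ℂ X]
  [NormedAddCommGroup Y] [NormedSpace ℂ Y] {n : ℕ}

theorem isFredholm_subtypeL {τ : X →L[ℂ] (Fin n → ℂ)} : τ.ker.subtypeL.IsFredholm where
  isStrictMap := (τ.ker.isEmbedding_subtype).isStrictMap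
  isClosed_range := by
    have : τ.ker.subtypeL.range = τ.ker := Submodule.range_subtype _
    rw [this]
    exact τ.isClosed_ker
  finite_ker := by
    have : τ.ker.subtypeL.ker = ⊥ := Submodule.ker_subtype _
    rw [this]
    infer_instance
  finite_coker := by
    have : τ.ker.subtypeL.range = τ.ker := Submodule.range_subtype _
    rw [this]
    exact Module.Finite.equiv τ.toLinearMap.quotKerEquivRange.symm
  closedComplemented_ker := by
    have : τ.ker.subtypeL.ker = ⊥ := Submodule.ker_subtype _
    rw [this]
    exact Submodule.closedComplemented_bot

variable [CompleteSpace X] [CompleteSpace Y]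

/-- The open mapping theorem makes the operator strict, and a finite dimensional kernel is
complemented. -/
theorem isFredholm_of_surjective {P : X →L[ℂ] Y} (hP : Function.Surjective P)
    [FiniteDimensional ℂ P.ker] : P.IsFredholm where
  isStrictMap := (P.isOpenMap hP).isStrictMap P.continuous
  isClosed_range := by
    rw [LinearMap.range_eq_top.2 hP]
    exact isClosed_univ
  finite_ker := inferInstance
  finite_coker := by
    rw [LinearMap.range_eq_top.2 hP]
    infer_instance
  closedComplemented_ker := Submodule.ClosedComplemented.of_finiteDimensional _

/-- The restriction of a surjective operator with a kernel of dimension `n` to a closed subspace of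
codimension `n`. -/
theorem isFredholm_restrict {P : X →L[ℂ] Y} (hP : Function.Surjective P)
    [FiniteDimensional ℂ P.ker] (hn : Module.finrank ℂ P.ker = n) {τ : X →L[ℂ] (Fin n → ℂ)}
    (hτ : Function.Surjective τ) {S : Submodule ℂ X} (hS : S = LinearMap.ker τ.toLinearMap) :
    (P ∘L S.subtypeL).IsFredholm ∧ (P ∘L S.subtypeL).toLinearMap.index = 0 ∧
      ((P ∘L S.subtypeL).IsInvertible ↔ ∀ u ∈ S, P u = 0 → u = 0) := by
  subst hS
  have h1 := isFredholm_of_surjective hP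
  have h2 := isFredholm_subtypeL (τ := τ)
  obtain ⟨p, hp⟩ := h1.exists_isQuasiInverse
  obtain ⟨q, hq⟩ := h2.exists_isQuasiInverse
  have hF : (P ∘L τ.ker.subtypeL).IsFredholm :=
    ContinuousLinearMap.IsFredholm.of_isQuasiInverse (v := q ∘L p) (hq.comp hp)
  have hidx : (P ∘L τ.ker.subtypeL).toLinearMap.index = 0 := by
    have := h1.finite_coker
    have := h2.finite_coker
    have := h2.finite_ker
    -- The index is additive under composition: `P` contributes `n` and the inclusion of the
    -- codimension `n` subspace contributes `-n`.
    have h3 : P.toLinearMap.index = n := by rw [LinearMap.index_of_surjective hP, ← hn]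
    have h4 : τ.ker.subtypeL.toLinearMap.index = -n := by
      rw [LinearMap.index_of_injective Subtype.val_injective]
      have : τ.ker.subtypeL.range = τ.ker := Submodule.range_subtype _
      rw [this, (τ.toLinearMap.quotKerEquivOfSurjective hτ).finrank_eq]
      simp
    have h5 := LinearMap.index_comp (f := τ.ker.subtypeL.toLinearMap) P.toLinearMap
    rw [h3, h4] at h5
    rw [ContinuousLinearMap.toLinearMap_comp, h5]
    simp
  refine ⟨hF, hidx, ?_, ?_⟩
  · rintro ⟨e, he⟩ u hu hPu
    have h3 : e ⟨u, hu⟩ = 0 := by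
      have : (e : τ.ker →L[ℂ] Y) ⟨u, hu⟩ = P u := by rw [he]; rfl
      exact this.trans hPu
    exact congrArg Subtype.val ((map_eq_zero_iff e e.injective).1 h3)
  · intro h
    have hker : (P ∘L τ.ker.subtypeL).ker = ⊥ := by
      rw [LinearMap.ker_eq_bot']
      exact fun u hu => Subtype.ext (h u u.2 hu)
    -- With index zero, a trivial kernel forces a trivial cokernel.
    have hrange : (P ∘L τ.ker.subtypeL).range = ⊤ := by
      have := hF.finite_coker
      rw [LinearMap.index_eq_finrank_sub, hker, finrank_bot, sub_eq_zero] at hidx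
      have h0 : Module.finrank ℂ (Y ⧸ (P ∘L τ.ker.subtypeL).range) = 0 := by
        exact_mod_cast hidx.symm
      rw [Module.finrank_zero_iff] at h0
      exact Submodule.Quotient.subsingleton_iff.1 h0
    have : CompleteSpace τ.ker := τ.isClosed_ker.completeSpace_coe
    exact ⟨ContinuousLinearEquiv.ofBijective _ hker hrange,
      ContinuousLinearEquiv.coe_ofBijective _ hker hrange⟩

end Fredholm

/-! ### The operators on smooth functions -/

theorem derivWithin_eq_zero_of_notMem {f : ℝ → ℂ} {x : ℝ} (hx : x ∉ Icc a b) :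
    derivWithin f (Icc a b) x = 0 :=
  derivWithin_zero_of_notMem_closure (by rwa [closure_Icc])

theorem Smooth.ext_Icc {f g : Smooth a b} (h : EqOn (f : ℝ → ℂ) g (Icc a b)) : f = g := by
  refine Subtype.ext (funext fun x => ?_)
  by_cases hx : x ∈ Icc a b
  · exact h hx
  · rw [f.2.2 _ hx, g.2.2 _ hx]

theorem Smooth.exists_eqOn {f : ℝ → ℂ} (hf : ContDiffOn ℝ ∞ f (Icc a b)) :
    ∃ g : Smooth a b, EqOn (g : ℝ → ℂ) f (Icc a b) :=
  ⟨⟨(Icc a b).indicator f, hf.congr fun _ hx => indicator_of_mem hx f,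
    fun _ hx => indicator_of_notMem hx f⟩, fun _ hx => indicator_of_mem hx f⟩

theorem Smooth.derivWithin_add (f g : Smooth a b) (x : ℝ) :
    derivWithin ((f : ℝ → ℂ) + (g : ℝ → ℂ)) (Icc a b) x =
      derivWithin (f : ℝ → ℂ) (Icc a b) x + derivWithin (g : ℝ → ℂ) (Icc a b) x := by
  by_cases hx : x ∈ Icc a b
  · exact _root_.derivWithin_add (f.2.1.differentiableOn (by simp) x hx)
      (g.2.1.differentiableOn (by simp) x hx)
  · simp only [derivWithin_eq_zero_of_notMem hx, add_zero]

/-- The derivative along a curve, acting on smooth functions. -/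
def IsShearCurve.derivS (hγ : IsShearCurve a b γ W) : Smooth a b →ₗ[ℂ] Smooth a b where
  toFun f := ⟨OrrSommerfeld.curveDeriv a b γ f, hγ.curveDeriv f.2.1, fun x hx => by
    rw [OrrSommerfeld.curveDeriv, derivWithin_eq_zero_of_notMem hx, zero_div]⟩
  map_add' f g := Subtype.ext (funext fun x => by
    simp only [OrrSommerfeld.curveDeriv, Submodule.coe_add, Pi.add_apply]
    rw [Smooth.derivWithin_add, add_div])
  map_smul' k f := Subtype.ext (funext fun x => by
    simp [OrrSommerfeld.curveDeriv, derivWithin_const_smul_field, mul_div_assoc])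

/-- The operator `∂² - α²`, acting on smooth functions. -/
def IsShearCurve.lapS (hγ : IsShearCurve a b γ W) (α : ℝ) : Smooth a b →ₗ[ℂ] Smooth a b :=
  hγ.derivS ∘ₗ hγ.derivS - (α : ℂ) ^ 2 • LinearMap.id

theorem IsShearCurve.coe_derivS (hγ : IsShearCurve a b γ W) (f : Smooth a b) :
    (hγ.derivS f : ℝ → ℂ) = OrrSommerfeld.curveDeriv a b γ f := rfl

theorem IsShearCurve.coe_lapS (hγ : IsShearCurve a b γ W) (f : Smooth a b) :
    (hγ.lapS α f : ℝ → ℂ) = OrrSommerfeld.lap a b α γ f := rfl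

/-- The Orr--Sommerfeld operator, acting on smooth functions. -/
def IsShearCurve.osS (hγ : IsShearCurve a b γ W) (α ε : ℝ) (c : ℂ) :
    Smooth a b →ₗ[ℂ] Smooth a b where
  toFun f := ⟨OrrSommerfeld.orrSommerfeld a b α ε c γ W f, hγ.orrSommerfeld f.2.1,
    fun x hx => by
      rw [OrrSommerfeld.orrSommerfeld, ← hγ.coe_lapS, ← hγ.coe_lapS, (hγ.lapS α _).2.2 _ hx,
        (hγ.lapS α f).2.2 _ hx, f.2.2 _ hx]
      ring⟩
  map_add' f g := Subtype.ext (funext fun x => by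
    simp only [OrrSommerfeld.orrSommerfeld, Submodule.coe_add, Pi.add_apply, ← hγ.coe_lapS]
    rw [← Submodule.coe_add, ← hγ.coe_lapS, ← hγ.coe_lapS, map_add, map_add]
    simp only [Submodule.coe_add, Pi.add_apply]
    ring)
  map_smul' k f := Subtype.ext (funext fun x => by
    simp only [OrrSommerfeld.orrSommerfeld, Submodule.coe_smul, Pi.smul_apply, ← hγ.coe_lapS,
      RingHom.id_apply]
    rw [← Submodule.coe_smul, ← hγ.coe_lapS, ← hγ.coe_lapS, map_smul, map_smul]
    simp only [Submodule.coe_smul, Pi.smul_apply, smul_eq_mul]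
    ring)

theorem IsShearCurve.coe_osS (hγ : IsShearCurve a b γ W) (f : Smooth a b) :
    (hγ.osS α ε c f : ℝ → ℂ) = OrrSommerfeld.orrSommerfeld a b α ε c γ W f := rfl

/-- The Cauchy data at the left endpoint. -/
def IsShearCurve.cauchyData (hγ : IsShearCurve a b γ W) (α : ℝ) :
    Smooth a b →ₗ[ℂ] (Fin 4 → ℂ) where
  toFun f := sysVec a b α γ f a
  map_add' f g := by
    have h1 := map_add hγ.derivS f g
    have h2 := map_add (hγ.lapS α) f g
    have h3 := map_add hγ.derivS (hγ.lapS α f) (hγ.lapS α g)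
    rw [← h2] at h3
    ext i
    fin_cases i
    exacts [rfl, congrFun (congrArg Subtype.val h1) a, congrFun (congrArg Subtype.val h2) a,
      congrFun (congrArg Subtype.val h3) a]
  map_smul' k f := by
    have h1 := map_smul hγ.derivS k f
    have h2 := map_smul (hγ.lapS α) k f
    have h3 := map_smul hγ.derivS k (hγ.lapS α f)
    rw [← h2] at h3
    ext i
    fin_cases i
    exacts [rfl, congrFun (congrArg Subtype.val h1) a, congrFun (congrArg Subtype.val h2) a,
      congrFun (congrArg Subtype.val h3) a]

theorem sysVec_congr {f g : ℝ → ℂ} (h : EqOn f g (Icc a b)) :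
    EqOn (sysVec a b α γ f) (sysVec a b α γ g) (Icc a b) := fun x hx => by
  simp only [sysVec, h hx, curveDeriv_congr h hx, lap_congr h hx, curveDeriv_congr (lap_congr h) hx]

theorem IsShearCurve.exists_osS_eq (hγ : IsShearCurve a b γ W) (hα : α ≠ 0) (hε : ε ≠ 0) (c : ℂ)
    (F : Smooth a b) (v : Fin 4 → ℂ) :
    ∃ f : Smooth a b, hγ.osS α ε c f = F ∧ hγ.cauchyData α f = v := by
  obtain ⟨f, hf, hv, hF⟩ := exists_orrSommerfeld_eq hα hε c hγ F.2.1 v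
  obtain ⟨g, hg⟩ := Smooth.exists_eqOn hf
  refine ⟨g, Smooth.ext_Icc fun x hx => ?_, ?_⟩
  · rw [hγ.coe_osS, orrSommerfeld_congr hg hx, hF x hx]
  · exact (sysVec_congr hg (left_mem_Icc.2 hγ.lt.le)).trans hv

theorem IsShearCurve.eq_zero_of_osS (hγ : IsShearCurve a b γ W) (hα : α ≠ 0) (hε : ε ≠ 0)
    {f : Smooth a b} (hf : hγ.osS α ε c f = 0) (h0 : hγ.cauchyData α f = 0) : f = 0 :=
  Smooth.ext_Icc (orrSommerfeld_unique hα hε hγ f.2.1 h0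
    fun x _ => congrFun (congrArg Subtype.val hf) x)

/-- Existence and uniqueness for the Cauchy problem at `a`, a problem of order four. -/
theorem IsShearCurve.exists_ker_osS_equiv (hγ : IsShearCurve a b γ W) (hα : α ≠ 0) (hε : ε ≠ 0)
    (c : ℂ) : Nonempty (LinearMap.ker (hγ.osS α ε c) ≃ₗ[ℂ] (Fin 4 → ℂ)) := by
  refine ⟨LinearEquiv.ofBijective ((hγ.cauchyData α).comp (Submodule.subtype _)) ?_⟩
  refine ⟨(injective_iff_map_eq_zero _).2 fun f hf =>
    Subtype.ext (hγ.eq_zero_of_osS hα hε f.2 hf), fun v => ?_⟩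
  obtain ⟨f, hf, hv⟩ := hγ.exists_osS_eq hα hε c 0 v
  exact ⟨⟨f, hf⟩, hv⟩

theorem IsShearCurve.finrank_ker_osS (hγ : IsShearCurve a b γ W) (hα : α ≠ 0) (hε : ε ≠ 0) (c : ℂ) :
    FiniteDimensional ℂ (LinearMap.ker (hγ.osS α ε c)) ∧
      Module.finrank ℂ (LinearMap.ker (hγ.osS α ε c)) = 4 := by
  obtain ⟨e⟩ := hγ.exists_ker_osS_equiv hα hε c
  exact ⟨Module.Finite.equiv e.symm, by rw [e.finrank_eq]; simp⟩

/-- The boundary values of smooth functions. -/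
def bdryS (a b : ℝ) : Smooth a b →ₗ[ℂ] (Fin 4 → ℂ) where
  toFun f := bdry a b f
  map_add' f g := by
    ext i
    fin_cases i <;> simp [bdry, Smooth.derivWithin_add]
  map_smul' k f := by
    ext i
    fin_cases i <;> simp [bdry, derivWithin_const_smul_field]

theorem bdryS_apply (f : Smooth a b) : bdryS a b f = bdry a b f := rfl

theorem bdry_congr (hab : a ≤ b) {f g : ℝ → ℂ} (h : EqOn f g (Icc a b)) :
    bdry a b f = bdry a b g := by
  have ha := left_mem_Icc.2 hab
  have hb := right_mem_Icc.2 hab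
  simp only [bdry, h ha, h hb, derivWithin_congr h (h ha), derivWithin_congr h (h hb)]

/-- Cubic interpolation of the boundary values. -/
theorem bdryS_surjective (hab : a < b) : Function.Surjective (bdryS a b) := by
  intro v
  set h : ℂ := (b : ℂ) - a with hh
  have hh0 : h ≠ 0 := by
    rw [hh, sub_ne_zero]
    exact_mod_cast hab.ne'
  -- `p` and `q` are the value and the slope at `b` that the linear part leaves over; `C` and `D`
  -- solve `C h² + D h³ = p` and `2 C h + 3 D h² = q`.
  set p := v 1 - v 0 - v 2 * h with hp
  set q := v 3 - v 2 with hq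
  set C := (3 * p - q * h) / h ^ 2 with hC
  set D := (q * h - 2 * p) / h ^ 3 with hD
  set f : ℝ → ℂ := fun x => v 0 + v 2 * (x - a) + C * (x - a) ^ 2 + D * (x - a) ^ 3 with hf
  have hfs : ContDiff ℝ ∞ f := by
    have : ContDiff ℝ ∞ fun x : ℝ => (x : ℂ) := Complex.ofRealCLM.contDiff
    fun_prop
  have hfd : ∀ x : ℝ, HasDerivAt f (v 2 + C * (2 * (x - a)) + D * (3 * (x - a) ^ 2)) x := by
    intro x
    have h1 : HasDerivAt (fun x : ℝ => (x : ℂ) - a) 1 x :=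
      (Complex.ofRealCLM.hasDerivAt (x := x)).sub_const _
    refine ((((h1.const_mul (v 2)).const_add (v 0)).add ((h1.pow 2).const_mul C)).add
      ((h1.pow 3).const_mul D)).congr_deriv ?_
    simp
  have hdw : ∀ x ∈ Icc a b, derivWithin f (Icc a b) x =
      v 2 + C * (2 * (x - a)) + D * (3 * (x - a) ^ 2) := fun x hx =>
    (hfd x).hasDerivWithinAt.derivWithin (uniqueDiffOn_Icc hab x hx)
  obtain ⟨g, hg⟩ := Smooth.exists_eqOn (a := a) (b := b) hfs.contDiffOn
  refine ⟨g, ?_⟩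
  rw [bdryS_apply, bdry_congr hab.le hg, bdry, hdw a (left_mem_Icc.2 hab.le),
    hdw b (right_mem_Icc.2 hab.le)]
  ext i
  fin_cases i
  · simp [hf]
  · change v 0 + v 2 * h + C * h ^ 2 + D * h ^ 3 = v 1
    rw [hC, hD]
    field_simp
    rw [hp]
    ring
  · simp
  · change v 2 + C * (2 * h) + D * (3 * h ^ 2) = v 3
    rw [hC, hD]
    field_simp
    rw [hq]
    ring

/-- The distribution given by a smooth function. -/
def Smooth.toFunc : Smooth a b →ₗ[ℂ] Func a b where
  toFun f := funF f f.2.1.continuousOn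
  map_add' f g := funF_add f.2.1.continuousOn g.2.1.continuousOn
  map_smul' k f := funF_const_mul k f.2.1.continuousOn

theorem Smooth.toFunc_injective (hab : a < b) :
    Function.Injective (Smooth.toFunc (a := a) (b := b)) := fun f g h =>
  Smooth.ext_Icc (eqOn_of_funF_eq hab f.2.1.continuousOn g.2.1.continuousOn h)

theorem Smooth.exists_toSob (hab : a < b) (s : ℝ) :
    ∃ J : Smooth a b →ₗ[ℂ] Sob a b s, ∀ f, (J f).toFunc = (Smooth.toFunc f) := by
  choose J hJ using fun f : Smooth a b => (memSob_funF hab s f.2.1).exists_sob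
  exact ⟨⟨⟨J, fun f g => Sob.toFunc_injective (by
    rw [map_add, hJ, hJ, hJ]; exact map_add Smooth.toFunc f g)⟩, fun k f => Sob.toFunc_injective (by
      change (J (k • f)).toFunc = (k • J f).toFunc
      rw [map_smul, hJ, hJ]; exact map_smul Smooth.toFunc k f)⟩, hJ⟩

theorem IsShearCurve.osF_toFunc (hγ : IsShearCurve a b γ W) (f : Smooth a b) :
    osF α ε c γ W (Smooth.toFunc f) = Smooth.toFunc (hγ.osS α ε c f) := osF_funF hγ f.2.1

theorem IsShearCurve.exists_smooth_of_osF_eq_zero (hγ : IsShearCurve a b γ W) (hα : α ≠ 0)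
    (hε : ε ≠ 0) {u : Func a b} (hu : osF α ε c γ W u = 0) :
    ∃ f : Smooth a b, hγ.osS α ε c f = 0 ∧ u = (Smooth.toFunc f) := by
  obtain ⟨f, hf, hfu, hf0⟩ := exists_classical_of_osF_eq_zero hα hε hγ hu
  obtain ⟨g, hg⟩ := Smooth.exists_eqOn hf
  refine ⟨g, Smooth.ext_Icc fun x hx => ?_, hfu.trans (funF_congr (hg := g.2.1.continuousOn) hg.symm)⟩
  rw [hγ.coe_osS, orrSommerfeld_congr hg hx, hf0 x hx]
  rfl

/-- The Orr--Sommerfeld operator with the Dirichlet and Neumann conditions is Fredholm of index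
zero, and it is invertible unless there are smooth eigenfunctions. -/
theorem IsShearCurve.exists_isFredholm (hγ : IsShearCurve a b γ W) (hα : α ≠ 0) (hε : ε ≠ 0)
    (c : ℂ) {s t : ℝ} (hst : s = t + 4) (ht : -5 / 2 < t) :
    ∃ T : SobDN a b s →L[ℂ] Sob a b t, IsOrrSommerfeld α ε c γ W T ∧ T.IsFredholm ∧
      T.toLinearMap.index = 0 ∧
      (T.IsInvertible ↔ ∀ f, hγ.osS α ε c f = 0 → bdryS a b f = 0 → f = 0) := by
  subst hst
  obtain ⟨P, hP⟩ := exists_sob_osF hγ.lt α ε c γ W t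
  -- The condition `t > -5/2` is `t + 4 > 3/2`, the range in which the four traces are continuous.
  obtain ⟨τ, hτ, hS⟩ := Sob.exists_trace (s := t + 4) hγ.lt (by linarith)
  obtain ⟨J, hJ⟩ := Smooth.exists_toSob hγ.lt (t + 4)
  have hJi : Function.Injective J := fun f g h => Smooth.toFunc_injective hγ.lt (by
    rw [← hJ, ← hJ, h])
  have hPs : Function.Surjective P := by
    intro f
    obtain ⟨u, hu, huf⟩ := exists_osF_eq (α := α) (ε := ε) (c := c) hα hε hγ (memSob_toFunc f)
    obtain ⟨v, hv⟩ := hu.exists_sob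
    exact ⟨v, Sob.toFunc_injective (by rw [hP, hv, huf])⟩
  have hPJ : ∀ f, P (J f) = 0 ↔ hγ.osS α ε c f = 0 := by
    intro f
    rw [← (map_eq_zero_iff _ (Sob.toFunc_injective (a := a) (b := b) (s := t))), hP, hJ,
      hγ.osF_toFunc, map_eq_zero_iff _ (Smooth.toFunc_injective hγ.lt)]
  -- Without boundary conditions the kernel on the full Sobolev space is the image of the smooth
  -- solutions, so it has dimension 4, the number of traces.
  have hker : LinearMap.ker P.toLinearMap = (LinearMap.ker (hγ.osS α ε c)).map J := by
    ext u
    rw [Submodule.mem_map]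
    constructor
    · intro hu
      have h1 : osF α ε c γ W u.toFunc = 0 := by
        rw [← hP]
        have : P u = 0 := hu
        rw [this, map_zero]
      obtain ⟨f, hf, hfu⟩ := hγ.exists_smooth_of_osF_eq_zero hα hε h1
      exact ⟨f, hf, Sob.toFunc_injective (by rw [hJ, hfu])⟩
    · rintro ⟨f, hf, rfl⟩
      exact (hPJ f).2 hf
  obtain ⟨hfd, hfr⟩ := hγ.finrank_ker_osS hα hε c
  have e := Submodule.equivMapOfInjective J hJi (LinearMap.ker (hγ.osS α ε c))
  rw [← hker] at e
  have hfd' : FiniteDimensional ℂ (LinearMap.ker P.toLinearMap) := Module.Finite.equiv e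
  have hτJ : ∀ f, τ (J f) = bdryS a b f := fun f =>
    hτ _ _ (contDiffOn_infty.1 f.2.1 1)
      ((represents_iff f.2.1.continuousOn).2 (hJ f))
  have hτs : Function.Surjective τ := fun v => by
    obtain ⟨f, hf⟩ := bdryS_surjective hγ.lt v
    exact ⟨J f, by rw [hτJ, hf]⟩
  obtain ⟨h1, h2, h3⟩ := isFredholm_restrict hPs (e.finrank_eq.symm.trans hfr) hτs hS
  refine ⟨P ∘L (SobDN a b (t + 4)).subtypeL, fun u => ?_, h1, h2, h3.trans ?_⟩
  · rw [weakEq_iff hγ]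
    exact hP u
  · rw [hS]
    constructor
    · intro h f hf hb
      refine hJi ?_
      rw [map_zero]
      exact h _ ((hτJ f).trans hb) ((hPJ f).2 hf)
    · intro h u hu hPu
      have h4 : u ∈ LinearMap.ker P.toLinearMap := hPu
      rw [hker] at h4
      obtain ⟨f, hf, rfl⟩ := h4
      rw [h f hf ((hτJ f).symm.trans hu), map_zero]

theorem IsOrrSommerfeld.unique (hγ : IsShearCurve a b γ W) {s t : ℝ}
    {T T' : SobDN a b s →L[ℂ] Sob a b t} (h : IsOrrSommerfeld α ε c γ W T)
    (h' : IsOrrSommerfeld α ε c γ W T') : T = T' :=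
  ContinuousLinearMap.ext fun u => Sob.toFunc_injective
    (((weakEq_iff hγ _ _).1 (h u)).trans ((weakEq_iff hγ _ _).1 (h' u)).symm)

variable {U : ℝ → ℝ}

/-! ### The energy estimate on the undeformed segment -/

theorem derivWithin_ofReal (hab : a < b) {x : ℝ} (hx : x ∈ Icc a b) :
    derivWithin (fun x : ℝ => (x : ℂ)) (Icc a b) x = 1 :=
  (Complex.ofRealCLM.hasDerivAt (x := x)).hasDerivWithinAt.derivWithin (uniqueDiffOn_Icc hab x hx)

theorem isShearCurve_ofReal (hab : a < b) (hU : ContDiffOn ℝ ∞ U (Icc a b)) :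
    IsShearCurve a b (fun x => (x : ℂ)) (fun x => (U x : ℂ)) where
  lt := hab
  smooth := Complex.ofRealCLM.contDiff.contDiffOn
  deriv_ne x hx := by rw [derivWithin_ofReal hab hx]; exact one_ne_zero
  smooth_profile := Complex.ofRealCLM.contDiff.comp_contDiffOn hU

theorem Smooth.memLp (f : Smooth a b) :
    MemLp (f : ℝ → ℂ) 2 (volume.restrict (Icc a b)) := by
  have hc : ContinuousOn (f : ℝ → ℂ) (Icc a b) := f.2.1.continuousOn
  obtain ⟨C, hC⟩ := isCompact_Icc.exists_bound_of_continuousOn hc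
  refine MemLp.of_bound (hc.aestronglyMeasurable measurableSet_Icc) C ?_
  exact (ae_restrict_iff' measurableSet_Icc).2 (Filter.Eventually.of_forall hC)

/-- Smooth functions as elements of `L²`. -/
def Smooth.toL2 (a b : ℝ) : Smooth a b →ₗ[ℂ] Lp ℂ 2 (volume.restrict (Icc a b)) where
  toFun f := (Smooth.memLp f).toLp f
  map_add' f g := MemLp.toLp_add (Smooth.memLp f) (Smooth.memLp g)
  map_smul' k f := MemLp.toLp_const_smul k (Smooth.memLp f)

theorem Smooth.coeFn_toL2 (f : Smooth a b) :
    Smooth.toL2 a b f =ᵐ[volume.restrict (Icc a b)] (f : ℝ → ℂ) := (Smooth.memLp f).coeFn_toLp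

theorem Smooth.inner_toL2 (hab : a < b) (f g : Smooth a b) :
    inner ℂ (Smooth.toL2 a b g) (Smooth.toL2 a b f) =
      ∫ x in a..b, (f : ℝ → ℂ) x * star ((g : ℝ → ℂ) x) := by
  rw [MeasureTheory.L2.inner_def, intervalIntegral.integral_of_le hab.le,
    ← integral_Icc_eq_integral_Ioc]
  refine integral_congr_ae ?_
  filter_upwards [Smooth.coeFn_toL2 f, Smooth.coeFn_toL2 g] with x hf hg
  rw [hf, hg]
  rfl

theorem derivS_hasDerivWithinAt (hab : a < b) (hU : ContDiffOn ℝ ∞ U (Icc a b)) (f : Smooth a b)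
    {x : ℝ} (hx : x ∈ Icc a b) :
    HasDerivWithinAt (f : ℝ → ℂ) (((isShearCurve_ofReal hab hU).derivS f : ℝ → ℂ) x) (Icc a b) x := by
  have h := hasDerivWithinAt_curveDeriv (isShearCurve_ofReal hab hU) f.2.1 hx
  rwa [derivWithin_ofReal hab hx, one_mul] at h

theorem inner_derivS (hab : a < b) (hU : ContDiffOn ℝ ∞ U (Icc a b)) (f g : Smooth a b)
    (ha : (g : ℝ → ℂ) a = 0) (hb : (g : ℝ → ℂ) b = 0) :
    inner ℂ (Smooth.toL2 a b g) (Smooth.toL2 a b ((isShearCurve_ofReal hab hU).derivS f)) =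
      -inner ℂ (Smooth.toL2 a b ((isShearCurve_ofReal hab hU).derivS g)) (Smooth.toL2 a b f) := by
  set hγ := isShearCurve_ofReal hab hU
  rw [Smooth.inner_toL2 hab, Smooth.inner_toL2 hab]
  have hc : ∀ f : Smooth a b, ContinuousOn (f : ℝ → ℂ) (uIcc a b) := fun f => by
    rw [uIcc_of_le hab.le]
    exact f.2.1.continuousOn
  have hd : ∀ f : Smooth a b, ∀ x ∈ Ioo (min a b) (max a b),
      HasDerivWithinAt (f : ℝ → ℂ) ((hγ.derivS f : ℝ → ℂ) x) (Ioi x) x := fun f x hx => by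
    rw [min_eq_left hab.le, max_eq_right hab.le] at hx
    exact ((derivS_hasDerivWithinAt hab hU f (Ioo_subset_Icc_self hx)).hasDerivAt
      (Icc_mem_nhds hx.1 hx.2)).hasDerivWithinAt
  have h := intervalIntegral.integral_deriv_mul_eq_sub_of_hasDeriv_right (hc f) (hc g).star (hd f)
    (fun x hx => (hd g x hx).star) (hc _).intervalIntegrable (hc _).star.intervalIntegrable
  have hi : ∀ f g : Smooth a b,
      IntervalIntegrable (fun x => (f : ℝ → ℂ) x * star ((g : ℝ → ℂ) x)) volume a b :=
    fun f g => ((hc f).mul (hc g).star).intervalIntegrable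
  rw [intervalIntegral.integral_add (hi _ _) (hi _ _), ha, hb] at h
  simp only [star_zero, mul_zero, sub_zero] at h
  exact eq_neg_of_add_eq_zero_left h

/-- Two integrations by parts. All four boundary conditions are put on `g` and none on `f`, because
later `f` will be `(∂² - α²)` of a function, whose boundary values are unknown. -/
theorem inner_lapS (hab : a < b) (hU : ContDiffOn ℝ ∞ U (Icc a b)) (f g : Smooth a b)
    (hg : bdryS a b g = 0) :
    inner ℂ (Smooth.toL2 a b g) (Smooth.toL2 a b ((isShearCurve_ofReal hab hU).lapS α f)) =
      inner ℂ (Smooth.toL2 a b ((isShearCurve_ofReal hab hU).lapS α g)) (Smooth.toL2 a b f) ∧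
    inner ℂ (Smooth.toL2 a b g) (Smooth.toL2 a b ((isShearCurve_ofReal hab hU).lapS α f)) =
      -inner ℂ (Smooth.toL2 a b ((isShearCurve_ofReal hab hU).derivS g))
        (Smooth.toL2 a b ((isShearCurve_ofReal hab hU).derivS f)) -
      (α : ℂ) ^ 2 * inner ℂ (Smooth.toL2 a b g) (Smooth.toL2 a b f) := by
  set hγ := isShearCurve_ofReal hab hU
  have h0 : ∀ i, bdry a b g i = 0 := fun i => congrFun hg i
  have hd : ∀ x ∈ Icc a b, (hγ.derivS g : ℝ → ℂ) x = derivWithin g (Icc a b) x := fun x hx => by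
    rw [hγ.coe_derivS, curveDeriv, derivWithin_ofReal hab hx, div_one]
  have h1 := inner_derivS hab hU (hγ.derivS f) g (h0 0) (h0 1)
  have h2 := inner_derivS hab hU f (hγ.derivS g) ((hd a (left_mem_Icc.2 hab.le)).trans (h0 2))
    ((hd b (right_mem_Icc.2 hab.le)).trans (h0 3))
  have hL : ∀ f, hγ.lapS α f = hγ.derivS (hγ.derivS f) - (α : ℂ) ^ 2 • f := fun _ => rfl
  have h3 : (starRingEnd ℂ) ((α : ℂ) ^ 2) = (α : ℂ) ^ 2 := by simp
  constructor
  · rw [hL, hL, map_sub, map_sub, inner_sub_right, inner_sub_left, map_smul, map_smul,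
      inner_smul_right, inner_smul_left, h1, h2, neg_neg, h3]
  · rw [hL, map_sub, inner_sub_right, map_smul, inner_smul_right, h1]

/-- Cauchy--Schwarz for `f(x) = ∫ f'` over `(a, x]`: the inner product of `f'` with an indicator
function. -/
theorem Smooth.norm_apply_le (hab : a < b) (hU : ContDiffOn ℝ ∞ U (Icc a b)) (f : Smooth a b)
    (ha : (f : ℝ → ℂ) a = 0) (x : ℝ) :
    ‖(f : ℝ → ℂ) x‖ ≤
      Real.sqrt (b - a) * ‖Smooth.toL2 a b ((isShearCurve_ofReal hab hU).derivS f)‖ := by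
  by_cases hx : x ∈ Icc a b
  swap
  · rw [f.2.2 x hx, norm_zero]
    positivity
  set hγ := isShearCurve_ofReal hab hU
  have hs : Ioc a x ⊆ Icc a b := fun y hy => ⟨hy.1.le, hy.2.trans hx.2⟩
  have hc : ∀ f : Smooth a b, ContinuousOn (f : ℝ → ℂ) (Icc a x) := fun f =>
    f.2.1.continuousOn.mono (Icc_subset_Icc_right hx.2)
  have h1 : ∫ y in a..x, (hγ.derivS f : ℝ → ℂ) y = (f : ℝ → ℂ) x := by
    rw [intervalIntegral.integral_eq_sub_of_hasDerivAt_of_le hx.1 (hc f), ha, sub_zero]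
    · intro y hy
      have hy' : y ∈ Ioo a b := ⟨hy.1, hy.2.trans_le hx.2⟩
      exact (derivS_hasDerivWithinAt hab hU f (Ioo_subset_Icc_self hy')).hasDerivAt
        (Icc_mem_nhds hy'.1 hy'.2)
    · refine ContinuousOn.intervalIntegrable ?_
      rw [uIcc_of_le hx.1]
      exact hc _
  have hfin : volume.restrict (Icc a b) (Ioc a x) ≠ ⊤ := by finiteness
  have h2 := MeasureTheory.L2.inner_indicatorConstLp_one (𝕜 := ℂ) (μ := volume.restrict (Icc a b))
    (measurableSet_Ioc (a := a) (b := x)) hfin (Smooth.toL2 a b (hγ.derivS f))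
  have h3 : ∫ y in Ioc a x, Smooth.toL2 a b (hγ.derivS f) y ∂(volume.restrict (Icc a b)) =
      (f : ℝ → ℂ) x := by
    rw [← h1, intervalIntegral.integral_of_le hx.1,
      setIntegral_congr_ae (g := (hγ.derivS f : ℝ → ℂ)) measurableSet_Ioc
        ((Smooth.coeFn_toL2 (hγ.derivS f)).mono fun y hy _ => hy),
      Measure.restrict_restrict measurableSet_Ioc, inter_eq_left.2 hs]
  rw [h3] at h2
  rw [← h2]
  refine (norm_inner_le_norm _ _).trans ?_
  gcongr
  refine norm_indicatorConstLp_le.trans ?_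
  rw [norm_one, one_mul, measureReal_restrict_apply measurableSet_Ioc, inter_eq_left.2 hs,
    Real.volume_real_Ioc_of_le hx.1, Real.sqrt_eq_rpow]
  simp only [ENNReal.toReal_ofNat]
  exact Real.rpow_le_rpow (by linarith [hx.1]) (by linarith [hx.2]) (by norm_num)

theorem inner_self_eq_ofReal {H : Type*} [NormedAddCommGroup H] [InnerProductSpace ℂ H] (v : H) :
    inner ℂ v v = ((‖v‖ ^ 2 : ℝ) : ℂ) := by
  rw [inner_self_eq_norm_sq_to_K]
  norm_cast

theorem Smooth.norm_toL2_sq (hab : a < b) (f : Smooth a b) :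
    ‖Smooth.toL2 a b f‖ ^ 2 = ∫ x in a..b, ‖(f : ℝ → ℂ) x‖ ^ 2 := by
  have h := inner_self_eq_ofReal (Smooth.toL2 a b f)
  rw [Smooth.inner_toL2 hab] at h
  have h1 : ∀ x, (f : ℝ → ℂ) x * star ((f : ℝ → ℂ) x) = ((‖(f : ℝ → ℂ) x‖ ^ 2 : ℝ) : ℂ) := fun x => by
    rw [RCLike.star_def, RCLike.mul_conj]
    norm_cast
  simp_rw [h1] at h
  rw [intervalIntegral.integral_ofReal] at h
  exact_mod_cast h.symm

theorem Smooth.intervalIntegrable_norm_sq (hab : a < b) (f : Smooth a b) :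
    IntervalIntegrable (fun x => ‖(f : ℝ → ℂ) x‖ ^ 2) volume a b := by
  refine ContinuousOn.intervalIntegrable ?_
  rw [uIcc_of_le hab.le]
  exact f.2.1.continuousOn.norm.pow 2

/-- Multiplication by a smooth function. -/
def Smooth.mul {g : ℝ → ℂ} (hg : ContDiffOn ℝ ∞ g (Icc a b)) : Smooth a b →ₗ[ℂ] Smooth a b where
  toFun f := ⟨fun x => g x * (f : ℝ → ℂ) x, hg.mul f.2.1, fun x hx => by simp [f.2.2 x hx]⟩
  map_add' f h := Subtype.ext (funext fun x => mul_add _ _ _)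
  map_smul' k f := Subtype.ext (funext fun x => mul_left_comm _ _ _)

theorem Smooth.exists_norm_mul_le (hab : a < b) {g : ℝ → ℂ} (hg : ContDiffOn ℝ ∞ g (Icc a b)) :
    ∃ M, 0 ≤ M ∧ ∀ f, ‖Smooth.toL2 a b (Smooth.mul hg f)‖ ≤ M * ‖Smooth.toL2 a b f‖ := by
  obtain ⟨M, hM⟩ := isCompact_Icc.exists_bound_of_continuousOn hg.continuousOn
  have hM0 : 0 ≤ M := (norm_nonneg _).trans (hM a (left_mem_Icc.2 hab.le))
  refine ⟨M, hM0, fun f => ?_⟩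
  refine (sq_le_sq₀ (norm_nonneg _) (by positivity)).1 ?_
  rw [mul_pow, Smooth.norm_toL2_sq hab, Smooth.norm_toL2_sq hab,
    ← intervalIntegral.integral_const_mul]
  refine intervalIntegral.integral_mono_on hab.le (Smooth.intervalIntegrable_norm_sq hab _)
    ((Smooth.intervalIntegrable_norm_sq hab _).const_mul _) fun x hx => ?_
  rw [← mul_pow]
  change ‖g x * (f : ℝ → ℂ) x‖ ^ 2 ≤ _
  rw [norm_mul]
  gcongr
  exact hM x hx

/-- A Hilbert--Schmidt bound for operators that map `L²` to bounded functions. -/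
theorem sum_norm_sq_le (hab : a < b) {V : Type*} [AddCommGroup V] [Module ℂ V]
    (A ι : V →ₗ[ℂ] Smooth a b) {C : ℝ}
    (hA : ∀ v x, ‖(A v : ℝ → ℂ) x‖ ≤ C * ‖Smooth.toL2 a b (ι v)‖) {n : ℕ} (e : Fin n → V)
    (he : Orthonormal ℂ fun j => Smooth.toL2 a b (ι (e j))) :
    ∑ j, ‖Smooth.toL2 a b (A (e j))‖ ^ 2 ≤ (b - a) * C ^ 2 := by
  have key : ∀ x, ∑ j, ‖(A (e j) : ℝ → ℂ) x‖ ^ 2 ≤ C ^ 2 := by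
    intro x
    set s := ∑ j, ‖(A (e j) : ℝ → ℂ) x‖ ^ 2 with hs
    have hs0 : 0 ≤ s := Finset.sum_nonneg fun _ _ => by positivity
    -- At a fixed point `x`, test the sup bound on `∑ conj(A eⱼ(x)) eⱼ`. With `s = ∑ |A eⱼ(x)|²` it
    -- reads `s ≤ C √s`, hence `s ≤ C²`; integration over `[a, b]` follows.
    set t : Fin n → ℂ := fun j => star ((A (e j) : ℝ → ℂ) x) with ht
    have h1 : (A (∑ j, t j • e j) : ℝ → ℂ) x = s := by
      rw [map_sum]
      simp only [map_smul, Submodule.coe_sum, Finset.sum_apply, Submodule.coe_smul, Pi.smul_apply,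
        smul_eq_mul, hs, ht]
      push_cast
      refine Finset.sum_congr rfl fun j _ => ?_
      rw [RCLike.star_def, RCLike.conj_mul]
      rfl
    have h2 : ‖Smooth.toL2 a b (ι (∑ j, t j • e j))‖ ^ 2 = s := by
      simp only [map_sum, map_smul]
      have h3 := he.inner_sum t t Finset.univ
      rw [inner_self_eq_ofReal] at h3
      have h4 : ∑ i, (starRingEnd ℂ) (t i) * t i = (s : ℂ) := by
        simp only [hs, ht]
        push_cast
        refine Finset.sum_congr rfl fun j _ => ?_
        rw [RCLike.conj_mul, norm_star]
        rfl
      rw [h4] at h3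
      exact_mod_cast h3
    have h3 := hA (∑ j, t j • e j) x
    rw [h1, Complex.norm_real, Real.norm_of_nonneg hs0] at h3
    have h4 : s ^ 2 ≤ C ^ 2 * s := by
      calc s ^ 2 ≤ (C * ‖Smooth.toL2 a b (ι (∑ j, t j • e j))‖) ^ 2 := by gcongr
        _ = C ^ 2 * s := by rw [mul_pow, h2]
    nlinarith
  simp_rw [Smooth.norm_toL2_sq hab]
  rw [← intervalIntegral.integral_finsetSum fun j _ => Smooth.intervalIntegrable_norm_sq hab _]
  have hint : IntervalIntegrable (fun x => ∑ j, ‖(A (e j) : ℝ → ℂ) x‖ ^ 2) volume a b := by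
    have h := IntervalIntegrable.sum Finset.univ
      fun j _ => Smooth.intervalIntegrable_norm_sq hab (A (e j))
    convert! h using 1
    funext x
    simp
  refine (intervalIntegral.integral_mono_on hab.le hint intervalIntegrable_const
    fun x _ => key x).trans_eq ?_
  simp

theorem IsShearCurve.osS_eq {γ W : ℝ → ℂ} (hγ : IsShearCurve a b γ W) (f : Smooth a b) :
    hγ.osS α ε c f = leadCoeff α ε • hγ.lapS α (hγ.lapS α f) +
      Smooth.mul hγ.smooth_profile (hγ.lapS α f) - c • hγ.lapS α f -
      Smooth.mul (hγ.curveDeriv (hγ.curveDeriv hγ.smooth_profile)) f := by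
  refine Subtype.ext (funext fun x => ?_)
  change _ + (W x - c) * _ - _ = _ + W x * _ - c * _ - _
  rw [sub_mul, ← add_sub_assoc]
  rfl

/-- Pairing with `f` gives `iα⁻¹ε² ‖q‖² + iτ (‖f'‖² + α² ‖f‖²)` for `q = (∂² - α²) f`, up to terms
in `U` and `U''`. Both main terms are positive multiples of `i`, so the imaginary part controls
them, and a large `τ` absorbs the rest. The right-hand side is `⟨q, g⟩`, in which no derivative of
`g` remains. -/
theorem exists_energy_estimate (hab : a < b) (hU : ContDiffOn ℝ ∞ U (Icc a b)) (hα : 0 < α) (hε : 0 < ε) :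
    ∃ C τ₀ : ℝ, 0 ≤ C ∧ ∀ τ ≥ τ₀, ∀ f g : Smooth a b, bdryS a b f = 0 → bdryS a b g = 0 →
      (isShearCurve_ofReal hab hU).osS α ε (Complex.I * τ) f =
        (isShearCurve_ofReal hab hU).lapS α g →
      ‖Smooth.toL2 a b ((isShearCurve_ofReal hab hU).derivS f)‖ ≤ C * ‖Smooth.toL2 a b g‖ := by
  set hγ := isShearCurve_ofReal hab hU
  obtain ⟨M, hM0, hM⟩ := Smooth.exists_norm_mul_le hab hγ.smooth_profile
  obtain ⟨N, hN0, hN⟩ := Smooth.exists_norm_mul_le hab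
    (hγ.curveDeriv (hγ.curveDeriv hγ.smooth_profile))
  -- Half of the coefficient of `‖q‖²`: one `δ ‖q‖²` absorbs the term with `U`, the other the
  -- pairing with `g`.
  set δ := ε ^ 2 / (2 * α) with hδ
  have hδ0 : 0 < δ := by positivity
  refine ⟨(2 * Real.sqrt δ)⁻¹, 1 + (M ^ 2 / (4 * δ) + N) / α ^ 2, by positivity, ?_⟩
  intro τ hτ f g hf hg hfg
  set v := Smooth.toL2 a b f
  set w := Smooth.toL2 a b g
  set q := Smooth.toL2 a b (hγ.lapS α f)
  set d := Smooth.toL2 a b (hγ.derivS f)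
  set m := Smooth.toL2 a b (Smooth.mul hγ.smooth_profile (hγ.lapS α f))
  set l := Smooth.toL2 a b
    (Smooth.mul (hγ.curveDeriv (hγ.curveDeriv hγ.smooth_profile)) f)
  have h1 : inner ℂ v (Smooth.toL2 a b (hγ.lapS α g)) = inner ℂ q w :=
    (inner_lapS hab hU g f hf).1
  have h2 : inner ℂ v (Smooth.toL2 a b (hγ.lapS α (hγ.lapS α f))) = inner ℂ q q :=
    (inner_lapS hab hU (hγ.lapS α f) f hf).1
  have h3 : inner ℂ v q = -inner ℂ d d - (α : ℂ) ^ 2 * inner ℂ v v :=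
    (inner_lapS hab hU f f hf).2
  have h4 := congrArg (fun f => inner ℂ v (Smooth.toL2 a b f)) hfg
  simp only [hγ.osS_eq, map_add, map_sub, map_smul, inner_add_right, inner_sub_right,
    inner_smul_right] at h4
  rw [h1, h2, h3] at h4
  rw [inner_self_eq_ofReal, inner_self_eq_ofReal, inner_self_eq_ofReal] at h4
  have h5 : 2 * δ * ‖q‖ ^ 2 + τ * (‖d‖ ^ 2 + α ^ 2 * ‖v‖ ^ 2) =
      (inner ℂ q w - inner ℂ v m + inner ℂ v l).im := by
    have h6 : leadCoeff α ε = Complex.I * ((2 * δ : ℝ) : ℂ) := by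
      rw [leadCoeff, hδ]
      push_cast
      field_simp
    have h7 : inner ℂ q w - inner ℂ v m + inner ℂ v l =
        Complex.I * ((2 * δ * ‖q‖ ^ 2 + τ * (‖d‖ ^ 2 + α ^ 2 * ‖v‖ ^ 2) : ℝ) : ℂ) := by
      rw [← h4, h6]
      push_cast
      ring
    rw [h7, Complex.I_mul_im, Complex.ofReal_re]
  have h6 : (inner ℂ q w - inner ℂ v m + inner ℂ v l).im ≤
      ‖q‖ * ‖w‖ + ‖v‖ * (M * ‖q‖) + ‖v‖ * (N * ‖v‖) := by
    refine (Complex.im_le_norm _).trans ?_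
    refine (norm_add_le _ _).trans (add_le_add ((norm_sub_le _ _).trans (add_le_add ?_ ?_)) ?_)
    · exact norm_inner_le_norm _ _
    · exact (norm_inner_le_norm _ _).trans (by gcongr; exact hM _)
    · exact (norm_inner_le_norm _ _).trans (by gcongr; exact hN _)
  rw [← h5] at h6
  have hδδ : δ * (M ^ 2 / (4 * δ)) = M ^ 2 / 4 := by field_simp
  -- Young's inequality by completing the square; the leftover multiple of `‖v‖²` is what `τ₀` has
  -- to dominate.
  have h7 : M * ‖v‖ * ‖q‖ ≤ δ * ‖q‖ ^ 2 + M ^ 2 / (4 * δ) * ‖v‖ ^ 2 := by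
    have h8 : δ * ‖q‖ ^ 2 + M ^ 2 / (4 * δ) * ‖v‖ ^ 2 - M * ‖v‖ * ‖q‖ =
        (2 * δ * ‖q‖ - M * ‖v‖) ^ 2 / (4 * δ) := by
      field_simp
      ring
    have h9 : 0 ≤ (2 * δ * ‖q‖ - M * ‖v‖) ^ 2 / (4 * δ) := by positivity
    linarith
  have h8 : ‖q‖ * ‖w‖ ≤ δ * ‖q‖ ^ 2 + ‖w‖ ^ 2 / (4 * δ) := by
    have h8 : δ * ‖q‖ ^ 2 + ‖w‖ ^ 2 / (4 * δ) - ‖q‖ * ‖w‖ =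
        (2 * δ * ‖q‖ - ‖w‖) ^ 2 / (4 * δ) := by
      field_simp
      ring
    have h9 : 0 ≤ (2 * δ * ‖q‖ - ‖w‖) ^ 2 / (4 * δ) := by positivity
    linarith
  have h9 : ‖d‖ ^ 2 + α ^ 2 * ‖v‖ ^ 2 + (M ^ 2 / (4 * δ) + N) * ‖v‖ ^ 2 ≤
      τ * (‖d‖ ^ 2 + α ^ 2 * ‖v‖ ^ 2) := by
    have h10 : 0 ≤ (M ^ 2 / (4 * δ) + N) / α ^ 2 * ‖d‖ ^ 2 := by positivity
    calc _ ≤ (1 + (M ^ 2 / (4 * δ) + N) / α ^ 2) * (‖d‖ ^ 2 + α ^ 2 * ‖v‖ ^ 2) := by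
          have h11 : (M ^ 2 / (4 * δ) + N) / α ^ 2 * (α ^ 2 * ‖v‖ ^ 2) =
              (M ^ 2 / (4 * δ) + N) * ‖v‖ ^ 2 := by field_simp
          linarith
      _ ≤ _ := by gcongr
  have h10 : ‖d‖ ^ 2 ≤ ‖w‖ ^ 2 / (4 * δ) := by
    have : 0 ≤ α ^ 2 * ‖v‖ ^ 2 := by positivity
    linarith
  refine (sq_le_sq₀ (norm_nonneg _) (by positivity)).1 (h10.trans_eq ?_)
  rw [mul_pow, inv_pow, mul_pow, Real.sq_sqrt hδ0.le]
  ring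

/-! ### Eigenvalues of Hilbert--Schmidt operators -/

section HilbertSchmidt

variable {V H : Type*} [AddCommGroup V] [Module ℂ V] [NormedAddCommGroup H] [InnerProductSpace ℂ H]

/-- The operator `A` has a finite Hilbert--Schmidt norm, at most `B`, with respect to the inner
product on `V` that is induced by `E`. -/
def HilbertSchmidtBound (A : V →ₗ[ℂ] V) (E : V →ₗ[ℂ] H) (B : ℝ) : Prop :=
  ∀ (n : ℕ) (e : Fin n → V), (Orthonormal ℂ fun j => E (e j)) → ∑ j, ‖E (A (e j))‖ ^ 2 ≤ B ^ 2

variable {A : V →ₗ[ℂ] V} {E : V →ₗ[ℂ] H} {B : ℝ}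

/-- Compute the trace in an orthonormal basis of the image of `S`, and apply Cauchy--Schwarz to the
sum. Only finite dimensional invariant subspaces occur, so `V` need not be complete and `A` need not
extend to `H`. -/
theorem HilbertSchmidtBound.norm_trace_le (hA : HilbertSchmidtBound A E B) (hB : 0 ≤ B)
    (hE : Function.Injective E) (S : Submodule ℂ V) [FiniteDimensional ℂ S]
    (hS : ∀ v ∈ S, A v ∈ S) :
    ‖LinearMap.trace ℂ S (A.restrict hS)‖ ≤ B * Real.sqrt (Module.finrank ℂ S) := by
  let e := Submodule.equivMapOfInjective E hE S
  have : FiniteDimensional ℂ (S.map E) := Module.Finite.equiv e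
  let o := stdOrthonormalBasis ℂ (S.map E)
  have he : ∀ v : S, (e v : H) = E v := fun v => Submodule.coe_equivMapOfInjective_apply E hE S v
  have h1 : ∀ i, E (e.symm (o i) : V) = o i := fun i => by
    rw [← he, e.apply_symm_apply]
  have h2 : Orthonormal ℂ fun i => E (e.symm (o i) : V) := by
    simp_rw [h1]
    exact o.orthonormal.comp_linearIsometry (S.map E).subtypeₗᵢ
  have h3 := hA _ (fun i => (e.symm (o i) : V)) h2
  have hn : Module.finrank ℂ (S.map E) = Module.finrank ℂ S := e.finrank_eq.symm
  rw [← LinearMap.trace_conj' _ e, LinearMap.trace_eq_sum_inner _ o]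
  have h4 : ∀ i, ‖inner ℂ (o i) (e.conj (A.restrict hS) (o i))‖ ≤ ‖E (A (e.symm (o i) : V))‖ := by
    intro i
    refine (norm_inner_le_norm _ _).trans_eq ?_
    rw [o.orthonormal.1 i, one_mul, ← he ⟨A (e.symm (o i)), hS _ (e.symm (o i)).2⟩]
    rfl
  refine (norm_sum_le_of_le _ fun i _ => h4 i).trans ?_
  rw [← abs_of_nonneg (Finset.sum_nonneg fun i _ => norm_nonneg (E (A (e.symm (o i) : V))))]
  refine Real.abs_le_sqrt ?_ |>.trans_eq (b := Real.sqrt (B ^ 2 * Module.finrank ℂ S)) ?_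
  · refine sq_sum_le_card_mul_sum_sq.trans ?_
    rw [Finset.card_univ, Fintype.card_fin, ← hn, mul_comm]
    gcongr
  · rw [Real.sqrt_mul (sq_nonneg B), Real.sqrt_sq hB]

theorem natCast_le_of_mul_le_mul_sqrt {d : ℕ} {x : ℝ} (hx : 0 < x)
    (h : d * x ≤ B * Real.sqrt d) : (d : ℝ) ≤ (B / x) ^ 2 := by
  rcases Nat.eq_zero_or_pos d with rfl | hd
  · simp
    positivity
  have hd' : 0 < Real.sqrt d := Real.sqrt_pos.2 (by exact_mod_cast hd)
  have h1 : Real.sqrt d ≤ B / x := by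
    rw [le_div_iff₀ hx]
    refine le_of_mul_le_mul_left ?_ hd'
    rw [← mul_assoc, Real.mul_self_sqrt d.cast_nonneg, mul_comm (Real.sqrt d)]
    exact h
  calc (d : ℝ) = Real.sqrt d ^ 2 := (Real.sq_sqrt d.cast_nonneg).symm
    _ ≤ _ := by gcongr

/-- `f` maps `ker f^(k+1)` into `ker f^k`, and what it kills lies in `ker f`. -/
theorem finiteDimensional_ker_pow (f : V →ₗ[ℂ] V) [FiniteDimensional ℂ (LinearMap.ker f)] (k : ℕ) :
    FiniteDimensional ℂ (LinearMap.ker (f ^ k)) := by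
  induction k with
  | zero =>
    rw [pow_zero]
    have : LinearMap.ker (1 : V →ₗ[ℂ] V) = ⊥ := LinearMap.ker_id
    rw [this]
    infer_instance
  | succ k ih =>
    rw [← Submodule.fg_iff_finiteDimensional] at ih ⊢
    refine Submodule.fg_of_fg_map_of_fg_inf_ker f ?_ ?_
    · have : IsNoetherian ℂ (LinearMap.ker (f ^ k)) := isNoetherian_of_fg_of_noetherian _ ih
      refine Submodule.FG.of_le (T := LinearMap.ker (f ^ k)) ih ?_
      rintro _ ⟨v, hv, rfl⟩
      rw [SetLike.mem_coe, LinearMap.mem_ker, pow_succ] at hv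
      exact hv
    · exact Submodule.FG.of_le (Submodule.fg_iff_finiteDimensional _ |>.2 inferInstance) inf_le_right

/-- On `ker (A - μ)^k`, of dimension `d`, the operator is `μ` plus a nilpotent, so its trace is
`dμ`. Then `d |μ| ≤ B √d` bounds `d` independently of `k`, and the increasing chain of kernels
stabilizes. -/
theorem HilbertSchmidtBound.finiteDimensional_maxGenEigenspace (hA : HilbertSchmidtBound A E B)
    (hB : 0 ≤ B) (hE : Function.Injective E) {μ : ℂ} (hμ : μ ≠ 0)
    [FiniteDimensional ℂ (LinearMap.ker (A - μ • (1 : Module.End ℂ V)))] :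
    FiniteDimensional ℂ (Module.End.maxGenEigenspace A μ) := by
  set f : Module.End ℂ V := A - μ • 1 with hf
  have hfd := finiteDimensional_ker_pow f
  have hbd : ∀ k, (Module.finrank ℂ (LinearMap.ker (f ^ k)) : ℝ) ≤ (B / ‖μ‖) ^ 2 := by
    intro k
    have := hfd k
    have hcomm : Commute A (f ^ k) := by
      refine Commute.pow_right ?_ k
      exact (Commute.refl A).sub_right ((Commute.one_right A).smul_right μ)
    have hS : ∀ v ∈ LinearMap.ker (f ^ k), A v ∈ LinearMap.ker (f ^ k) := by
      intro v hv
      rw [LinearMap.mem_ker] at hv ⊢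
      rw [← Module.End.mul_apply, ← hcomm.eq, Module.End.mul_apply, hv, map_zero]
    have hfS : ∀ v ∈ LinearMap.ker (f ^ k), f v ∈ LinearMap.ker (f ^ k) := by
      intro v hv
      rw [LinearMap.mem_ker] at hv ⊢
      rw [← Module.End.mul_apply, ← pow_succ, pow_succ', Module.End.mul_apply, hv, map_zero]
    have hnil : IsNilpotent (f.restrict hfS) := by
      refine ⟨k, LinearMap.ext fun v => Subtype.ext ?_⟩
      rw [Module.End.pow_restrict]
      exact v.2
    have htr : LinearMap.trace ℂ _ (A.restrict hS) = Module.finrank ℂ (LinearMap.ker (f ^ k)) * μ := by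
      have h1 := (LinearMap.isNilpotent_trace_of_isNilpotent hnil).eq_zero
      have h2 : A.restrict hS = f.restrict hfS + μ • LinearMap.id := by
        ext v
        simp [hf]
      rw [h2, map_add, h1, map_smul, LinearMap.trace_id, zero_add, smul_eq_mul, mul_comm]
    have h3 := hA.norm_trace_le hB hE _ hS
    rw [htr, norm_mul, Complex.norm_natCast] at h3
    exact natCast_le_of_mul_le_mul_sqrt (norm_pos_iff.2 hμ) h3
  obtain ⟨k, hk⟩ : ∃ k, ∀ j, Module.finrank ℂ (LinearMap.ker (f ^ j)) ≤
      Module.finrank ℂ (LinearMap.ker (f ^ k)) := by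
    have h1 : BddAbove (range fun j => Module.finrank ℂ (LinearMap.ker (f ^ j))) := by
      refine ⟨⌊(B / ‖μ‖) ^ 2⌋₊, ?_⟩
      rintro _ ⟨j, rfl⟩
      exact Nat.le_floor (hbd j)
    obtain ⟨k, hk⟩ := Nat.sSup_mem (range_nonempty _) h1
    exact ⟨k, fun j => (le_csSup h1 ⟨j, rfl⟩).trans_eq hk.symm⟩
  have hle : Module.End.maxGenEigenspace A μ ≤ LinearMap.ker (f ^ k) := by
    intro v hv
    obtain ⟨j, hj⟩ := (Module.End.mem_maxGenEigenspace A μ v).1 hv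
    have h2 : LinearMap.ker (f ^ k) ≤ LinearMap.ker (f ^ (j + k)) := by
      intro w hw
      rw [LinearMap.mem_ker] at hw ⊢
      rw [pow_add, Module.End.mul_apply, hw, map_zero]
    have := hfd (j + k)
    rw [Submodule.eq_of_le_of_finrank_le h2 (hk _), LinearMap.mem_ker, add_comm, pow_add,
      Module.End.mul_apply, hj, map_zero]
  have := hfd k
  exact Submodule.finiteDimensional_of_le hle

/-- On the span of one eigenvector per eigenvalue the trace is the sum of the eigenvalues. All lie
within `|μ₀|/2` of `μ₀`, so the sum cannot cancel and is at least `|μ₀|/2` times their number. -/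
theorem HilbertSchmidtBound.card_eigenvalues_le (hA : HilbertSchmidtBound A E B) (hB : 0 ≤ B)
    (hE : Function.Injective E) {μ₀ : ℂ} (hμ₀ : μ₀ ≠ 0) (s : Finset ℂ)
    (hs : ∀ μ ∈ s, Module.End.HasEigenvalue A μ ∧ ‖μ - μ₀‖ ≤ ‖μ₀‖ / 2) :
    (s.card : ℝ) ≤ (B / (‖μ₀‖ / 2)) ^ 2 := by
  choose! v hv using fun μ hμ => (hs μ hμ).1.exists_hasEigenvector
  have hli : LinearIndependent ℂ fun μ : s => v μ :=
    Module.End.eigenvectors_linearIndependent' A (fun μ : s => (μ : ℂ)) Subtype.val_injective _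
      fun μ => hv μ μ.2
  obtain ⟨S, hSdef, b, hbv⟩ : ∃ S : Submodule ℂ V,
      S = Submodule.span ℂ (range fun μ : s => v μ) ∧
        ∃ b : Module.Basis s ℂ S, ∀ μ : s, (b μ : V) = v μ :=
    ⟨_, rfl, Module.Basis.span hli, fun μ => by rw [Module.Basis.span_apply]⟩
  have : FiniteDimensional ℂ S := Module.Finite.of_basis b
  have hAv : ∀ μ : s, A (v μ) = (μ : ℂ) • v μ := fun μ => (hv μ μ.2).apply_eq_smul
  have hS : ∀ w ∈ S, A w ∈ S := by
    intro w hw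
    rw [hSdef] at hw
    induction hw using Submodule.span_induction with
    | mem x hx =>
      obtain ⟨μ, rfl⟩ := hx
      simp only [hAv]
      exact S.smul_mem _ (hSdef ▸ Submodule.subset_span ⟨μ, rfl⟩)
    | zero => simp
    | add x y _ _ hx hy => rw [map_add]; exact S.add_mem hx hy
    | smul k x _ hx => rw [map_smul]; exact S.smul_mem _ hx
  have hb : ∀ μ : s, A.restrict hS (b μ) = (μ : ℂ) • b μ := fun μ => Subtype.ext (by
    rw [LinearMap.restrict_apply]
    simp only [hbv, hAv, Submodule.coe_smul])
  have htr : LinearMap.trace ℂ S (A.restrict hS) = ∑ μ : s, (μ : ℂ) := by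
    rw [LinearMap.trace_eq_matrix_trace ℂ b]
    refine Finset.sum_congr rfl fun μ _ => ?_
    rw [Matrix.diag_apply, LinearMap.toMatrix_apply, hb]
    simp
  have hfr : Module.finrank ℂ S = s.card := by
    rw [Module.finrank_eq_card_basis b, Fintype.card_coe]
  have h1 := hA.norm_trace_le hB hE S hS
  rw [htr, hfr, Finset.sum_coe_sort s fun μ => μ] at h1
  refine natCast_le_of_mul_le_mul_sqrt (by positivity) (le_trans ?_ h1)
  have h2 : ‖∑ μ ∈ s, μ - s.card * μ₀‖ ≤ s.card * (‖μ₀‖ / 2) := by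
    rw [← nsmul_eq_mul, ← Finset.sum_const, ← Finset.sum_sub_distrib]
    refine (norm_sum_le_of_le _ fun μ hμ => (hs μ hμ).2).trans_eq ?_
    simp
  have h3 : ‖(s.card : ℂ) * μ₀‖ = s.card * ‖μ₀‖ := by simp
  have h4 := norm_sub_norm_le ((s.card : ℂ) * μ₀) (∑ μ ∈ s, μ)
  rw [norm_sub_rev] at h4
  linarith

end HilbertSchmidt

/-! ### Generalized eigenfunctions -/

/-- The spaces of smooth functions that are closed under the relation that generates the
generalized eigenfunctions. -/
def IsShearCurve.IsGenClosed (hγ : IsShearCurve a b γ W) (α ε : ℝ) (c : ℂ)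
    (S : Submodule ℂ (Smooth a b)) : Prop :=
  ∀ f, ∀ g ∈ S, hγ.osS α ε c f = hγ.lapS α g → bdryS a b f = 0 → f ∈ S

/-- The generalized eigenfunctions, as a space of smooth functions. -/
def IsShearCurve.genS (hγ : IsShearCurve a b γ W) (α ε : ℝ) (c : ℂ) : Submodule ℂ (Smooth a b) :=
  sInf {S | hγ.IsGenClosed α ε c S}

theorem IsShearCurve.isGenClosed_genS (hγ : IsShearCurve a b γ W) :
    hγ.IsGenClosed α ε c (hγ.genS α ε c) := by
  intro f g hg hfg hf
  rw [IsShearCurve.genS, Submodule.mem_sInf] at hg ⊢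
  exact fun S hS => hS f g (hg S hS) hfg hf

theorem IsShearCurve.genS_le (hγ : IsShearCurve a b γ W) {S : Submodule ℂ (Smooth a b)}
    (hS : hγ.IsGenClosed α ε c S) : hγ.genS α ε c ≤ S := sInf_le hS

theorem IsShearCurve.bdryS_eq_zero_iff (hγ : IsShearCurve a b γ W) (f : Smooth a b) :
    bdryS a b f = 0 ↔ (f : ℝ → ℂ) a = 0 ∧ (f : ℝ → ℂ) b = 0 ∧
      OrrSommerfeld.curveDeriv a b γ f a = 0 ∧ OrrSommerfeld.curveDeriv a b γ f b = 0 := by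
  have ha := hγ.deriv_ne a (left_mem_Icc.2 hγ.lt.le)
  have hb := hγ.deriv_ne b (right_mem_Icc.2 hγ.lt.le)
  rw [bdryS_apply, funext_iff, Fin.forall_fin_succ, Fin.forall_fin_succ, Fin.forall_fin_succ,
    Fin.forall_fin_succ]
  simp [bdry, OrrSommerfeld.curveDeriv, ha, hb]

/-- Elements of `Smooth` vanish off `[a, b]`, so pointwise equations on `[a, b]` are equalities of
elements, and the minimal subspace may be formed inside `Smooth`, where the operators are linear
maps. -/
theorem IsShearCurve.genEigenspace_eq (hγ : IsShearCurve a b γ W) :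
    genEigenspace a b α ε c γ W = (hγ.genS α ε c).map (Smooth a b).subtype := by
  apply le_antisymm
  · refine sInf_le ⟨?_, ?_⟩
    · rintro _ ⟨f, -, rfl⟩
      exact f.2
    · rintro f hf _ ⟨g, hg, rfl⟩ hfg h1 h2 h3 h4
      refine ⟨⟨f, hf⟩, hγ.isGenClosed_genS ⟨f, hf⟩ g hg (Smooth.ext_Icc hfg) ?_, rfl⟩
      exact (hγ.bdryS_eq_zero_iff ⟨f, hf⟩).2 ⟨h1, h2, h3, h4⟩
  · refine le_sInf fun S ⟨hS, hcl⟩ => ?_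
    rw [Submodule.map_le_iff_le_comap]
    refine hγ.genS_le fun f g hg hfg hf => ?_
    obtain ⟨h1, h2, h3, h4⟩ := (hγ.bdryS_eq_zero_iff f).1 hf
    exact hcl f f.2 g hg (fun x _ => congrFun (congrArg Subtype.val hfg) x) h1 h2 h3 h4

theorem IsShearCurve.genEigenspaceEquiv (hγ : IsShearCurve a b γ W) :
    Nonempty (genEigenspace a b α ε c γ W ≃ₗ[ℂ] hγ.genS α ε c) := by
  rw [hγ.genEigenspace_eq]
  exact ⟨(Submodule.equivMapOfInjective _ Subtype.val_injective _).symm⟩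

/-- The zero space is closed under the generating relation exactly when the homogeneous boundary
value problem has only the trivial solution. -/
theorem IsShearCurve.genS_eq_bot_iff (hγ : IsShearCurve a b γ W) :
    hγ.genS α ε c = ⊥ ↔ ∀ f, hγ.osS α ε c f = 0 → bdryS a b f = 0 → f = 0 := by
  constructor
  · intro h f hf hb
    have := hγ.isGenClosed_genS (α := α) (ε := ε) (c := c) f 0 (Submodule.zero_mem _)
      (by rw [hf, map_zero]) hb
    rwa [h, Submodule.mem_bot] at this
  · intro h
    refine le_bot_iff.1 (hγ.genS_le fun f g hg hfg hb => ?_)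
    rw [Submodule.mem_bot] at hg ⊢
    rw [hg, map_zero] at hfg
    exact h f hfg hb

/-- The boundary map on the four dimensional solution space is injective by hypothesis, hence onto
`ℂ⁴`; a homogeneous solution can thus correct the boundary values of any particular one. -/
theorem IsShearCurve.exists_osS_eq_bdry (hγ : IsShearCurve a b γ W) (hα : α ≠ 0) (hε : ε ≠ 0)
    (h : ∀ f, hγ.osS α ε c f = 0 → bdryS a b f = 0 → f = 0) (F : Smooth a b) :
    ∃ f, hγ.osS α ε c f = F ∧ bdryS a b f = 0 := by
  obtain ⟨f, hf, -⟩ := hγ.exists_osS_eq hα hε c F 0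
  obtain ⟨e⟩ := hγ.exists_ker_osS_equiv hα hε c
  let T : (Fin 4 → ℂ) →ₗ[ℂ] (Fin 4 → ℂ) :=
    (bdryS a b).comp ((LinearMap.ker (hγ.osS α ε c)).subtype.comp e.symm.toLinearMap)
  have hT : Function.Injective T := (injective_iff_map_eq_zero T).2 fun v hv => by
    have h3 : (e.symm v : Smooth a b) = 0 := h _ (LinearMap.mem_ker.1 (e.symm v).2) hv
    exact e.symm.map_eq_zero_iff.1 (Subtype.ext h3)
  obtain ⟨v, hv⟩ := LinearMap.injective_iff_surjective.1 hT (bdryS a b f)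
  obtain ⟨g, hg, hgv⟩ : ∃ g, hγ.osS α ε c g = 0 ∧ bdryS a b g = bdryS a b f :=
    ⟨e.symm v, LinearMap.mem_ker.1 (e.symm v).2, hv⟩
  refine ⟨f - g, ?_, ?_⟩
  · rw [map_sub, hf, hg, sub_zero]
  · rw [map_sub, hgv, sub_self]

/-! ### The operator `P⁻¹(∂² - α²)`, finiteness and discreteness. -/

variable (a b) in
/-- The smooth functions that satisfy the Dirichlet and Neumann conditions. -/
def SmoothDN : Type := LinearMap.ker (bdryS a b)

instance : AddCommGroup (SmoothDN a b) := Submodule.addCommGroup (LinearMap.ker (bdryS a b))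
instance : Module ℂ (SmoothDN a b) := Submodule.module (LinearMap.ker (bdryS a b))

variable (a b) in
/-- The inclusion of the smooth functions with Dirichlet and Neumann conditions. -/
def SmoothDN.incl : SmoothDN a b →ₗ[ℂ] Smooth a b where
  toFun f := f.1
  map_add' _ _ := rfl
  map_smul' _ _ := rfl

instance : CoeOut (SmoothDN a b) (Smooth a b) := ⟨SmoothDN.incl a b⟩

theorem SmoothDN.incl_injective : Function.Injective (SmoothDN.incl a b) := Subtype.val_injective

theorem SmoothDN.bdryS_incl (f : SmoothDN a b) : bdryS a b (SmoothDN.incl a b f) = 0 := f.2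

/-- A smooth function with Dirichlet and Neumann conditions. -/
def SmoothDN.mk (f : Smooth a b) (hf : bdryS a b f = 0) : SmoothDN a b := ⟨f, hf⟩

theorem SmoothDN.incl_mk (f : Smooth a b) (hf : bdryS a b f = 0) :
    SmoothDN.incl a b (SmoothDN.mk f hf) = f :=
  rfl

/-- For `c = iτ`, `τ` large, the operator `A = P⁻¹ (∂² - α²)` with the Dirichlet and Neumann
conditions exists and maps `L²` to bounded functions. -/
theorem exists_resolvent (hab : a < b) (hU : ContDiffOn ℝ ∞ U (Icc a b)) (hα : 0 < α) (hε : 0 < ε) :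
    ∃ C τ₀ : ℝ, 0 ≤ C ∧ ∀ τ ≥ τ₀, ∃ A : Module.End ℂ (SmoothDN a b),
      (∀ f g : SmoothDN a b, f = A g ↔
        (isShearCurve_ofReal hab hU).osS α ε (Complex.I * τ) f =
          (isShearCurve_ofReal hab hU).lapS α g) ∧
      HilbertSchmidtBound A ((Smooth.toL2 a b).comp (SmoothDN.incl a b)) C := by
  obtain ⟨C, τ₀, hC, H⟩ := exists_energy_estimate hab hU hα hε
  set hγ := isShearCurve_ofReal hab hU
  -- One square root comes from the sup bound by `‖f'‖`, the other from integrating the pointwise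
  -- bound over `[a, b]`.
  refine ⟨Real.sqrt (b - a) * (Real.sqrt (b - a) * C), τ₀, by positivity, fun τ hτ => ?_⟩
  have hsup : ∀ f g : Smooth a b, bdryS a b f = 0 → bdryS a b g = 0 →
      hγ.osS α ε (Complex.I * τ) f = hγ.lapS α g →
      ∀ x, ‖(f : ℝ → ℂ) x‖ ≤ Real.sqrt (b - a) * C * ‖Smooth.toL2 a b g‖ := by
    intro f g hf hg hfg x
    refine (Smooth.norm_apply_le hab hU f (congrFun hf 0) x).trans ?_
    rw [mul_assoc]
    gcongr
    exact H τ hτ f g hf hg hfg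
  have hinj : ∀ f, hγ.osS α ε (Complex.I * τ) f = 0 → bdryS a b f = 0 → f = 0 := by
    intro f hf hb
    refine Subtype.ext (funext fun x => ?_)
    have := hsup f 0 hb (map_zero _) (by rw [hf, map_zero]) x
    simpa using this
  have hinj' : ∀ f g : SmoothDN a b, hγ.osS α ε (Complex.I * τ) f =
      hγ.osS α ε (Complex.I * τ) g → f = g := by
    intro f g hfg
    refine sub_eq_zero.1 (SmoothDN.incl_injective ?_)
    rw [map_zero]
    exact hinj _ (by rw [map_sub, map_sub, hfg, sub_self]) (SmoothDN.bdryS_incl _)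
  choose A hA hAb using fun g : SmoothDN a b =>
    hγ.exists_osS_eq_bdry hα.ne' hε.ne' hinj (hγ.lapS α g)
  let A' : Module.End ℂ (SmoothDN a b) :=
    { toFun := fun g => SmoothDN.mk (A g) (hAb g)
      map_add' := fun f g => hinj' _ _ (by
        simp only [map_add, SmoothDN.incl_mk, hA])
      map_smul' := fun k f => hinj' _ _ (by
        simp only [map_smul, SmoothDN.incl_mk, hA, RingHom.id_apply]) }
  refine ⟨A', fun f g => ⟨?_, fun h => hinj' _ _ (h.trans (hA g).symm)⟩, ?_⟩
  · rintro rfl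
    exact hA g
  · intro n e he
    refine (sum_norm_sq_le hab ((SmoothDN.incl a b).comp A') (SmoothDN.incl a b)
      (C := Real.sqrt (b - a) * C) (fun g x => ?_) e he).trans_eq ?_
    · exact hsup _ _ (hAb g) (SmoothDN.bdryS_incl g) (hA g) x
    · rw [mul_pow, mul_pow, mul_pow, Real.sq_sqrt (by linarith)]

theorem Smooth.toL2_injective (hab : a < b) : Function.Injective (Smooth.toL2 a b) := by
  refine (injective_iff_map_eq_zero _).2 fun f hf => Smooth.ext_Icc ?_
  have h1 : (f : ℝ → ℂ) =ᵐ[volume.restrict (Icc a b)] 0 := by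
    filter_upwards [Smooth.coeFn_toL2 f, Lp.coeFn_zero ℂ 2 (volume.restrict (Icc a b))] with x hx hx'
    rw [← hx, hf, hx']
  have h2 : (f : ℝ → ℂ) =ᵐ[volume.restrict (Ioo a b)] 0 :=
    ae_restrict_of_ae_restrict_of_subset Ioo_subset_Icc_self h1
  have h3 : EqOn (f : ℝ → ℂ) 0 (Ioo a b) := Measure.eqOn_open_of_ae_eq h2 isOpen_Ioo
    (f.2.1.continuousOn.mono Ioo_subset_Icc_self) continuousOn_const
  refine h3.of_subset_closure f.2.1.continuousOn continuousOn_const Ioo_subset_Icc_self ?_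
  rw [closure_Ioo hab.ne]

theorem osS_sub_smul (hγ : IsShearCurve a b γ W) (c₀ c : ℂ) (f : Smooth a b) :
    hγ.osS α ε c f = hγ.osS α ε c₀ f - (c - c₀) • hγ.lapS α f := by
  rw [hγ.osS_eq, hγ.osS_eq]
  module

/-- The relation between the Orr--Sommerfeld problem and the eigenvalue problem for the
operator `A`. -/
theorem osS_eq_lapS_iff (hγ : IsShearCurve a b γ W) {c₀ : ℂ}
    {A : Module.End ℂ (SmoothDN a b)}
    (hA : ∀ f g : SmoothDN a b, f = A g ↔ hγ.osS α ε c₀ f = hγ.lapS α g)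
    (f g : SmoothDN a b) :
    hγ.osS α ε c f = hγ.lapS α g ↔ f = A (g + (c - c₀) • f) := by
  rw [hA, osS_sub_smul hγ c₀, sub_eq_iff_eq_add]
  simp only [map_add, map_smul]

/-- With `μ = (c - iτ)⁻¹`, the relation that generates the space reads `(A - μ) f = -μ A g`. It
raises the height of a generalized eigenvector by at most one, so everything generated stays in the
maximal generalized eigenspace of `A` at `μ`. -/
theorem finiteDimensional_genS (hab : a < b) (hU : ContDiffOn ℝ ∞ U (Icc a b)) (hα : 0 < α)
    (hε : 0 < ε) (c : ℂ) :
    FiniteDimensional ℂ ((isShearCurve_ofReal hab hU).genS α ε c) := by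
  set hγ := isShearCurve_ofReal hab hU
  obtain ⟨C, τ₀, hC, H⟩ := exists_resolvent hab hU hα hε
  -- The second bound guarantees `c ≠ iτ`, so that `μ` is defined and non-zero.
  set τ := max τ₀ (‖c‖ + 1) with hτ
  obtain ⟨A, hA, hHS⟩ := H τ (le_max_left _ _)
  have hc : c - Complex.I * τ ≠ 0 := by
    rw [sub_ne_zero]
    intro h
    have h1 : ‖c‖ = |τ| := by rw [h]; simp
    have h2 : ‖c‖ + 1 ≤ τ := le_max_right _ _
    rw [abs_of_nonneg (by linarith [norm_nonneg c])] at h1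
    linarith
  set μ := (c - Complex.I * τ)⁻¹ with hμ
  have hμ0 : μ ≠ 0 := inv_ne_zero hc
  have hE : Function.Injective ((Smooth.toL2 a b).comp (SmoothDN.incl a b)) :=
    (Smooth.toL2_injective hab).comp SmoothDN.incl_injective
  have hker : FiniteDimensional ℂ (LinearMap.ker (A - μ • (1 : Module.End ℂ (SmoothDN a b)))) := by
    refine Module.Finite.of_injective ((hγ.cauchyData α).comp ((SmoothDN.incl a b).comp
      (LinearMap.ker (A - μ • (1 : Module.End ℂ (SmoothDN a b)))).subtype))
      ((injective_iff_map_eq_zero _).2 fun ⟨f, hf⟩ hf0 => Subtype.ext (SmoothDN.incl_injective ?_))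
    have h2 : A f = μ • f := sub_eq_zero.1 hf
    have h3 := (osS_eq_lapS_iff (c := c) hγ hA f 0).2 (by
      rw [zero_add, map_smul, h2, smul_smul, hμ, mul_inv_cancel₀ hc, one_smul])
    rw [map_zero, map_zero] at h3
    exact (hγ.eq_zero_of_osS hα.ne' hε.ne' h3 hf0).trans (map_zero _).symm
  have := hHS.finiteDimensional_maxGenEigenspace hC hE hμ0
  have hle : hγ.genS α ε c ≤
      (Module.End.maxGenEigenspace A μ).map (SmoothDN.incl a b) := by
    refine hγ.genS_le ?_
    rintro f _ ⟨g, hg, rfl⟩ hfg hf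
    refine ⟨SmoothDN.mk f hf, ?_, rfl⟩
    rw [SetLike.mem_coe, Module.End.mem_maxGenEigenspace] at hg ⊢
    obtain ⟨k, hk⟩ := hg
    refine ⟨k + 1, ?_⟩
    have h1 := (osS_eq_lapS_iff (c := c) hγ hA (SmoothDN.mk f hf) g).1 hfg
    have h2 : (A - μ • (1 : Module.End ℂ (SmoothDN a b))) (SmoothDN.mk f hf) = (-μ) • A g := by
      rw [map_add, map_smul] at h1
      have h3 : μ • SmoothDN.mk f hf = μ • A g + A (SmoothDN.mk f hf) := by
        conv_lhs => rw [h1]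
        rw [smul_add, smul_smul, hμ, inv_mul_cancel₀ hc, one_smul]
      change A (SmoothDN.mk f hf) - μ • SmoothDN.mk f hf = _
      rw [h3, neg_smul]
      abel
    have hcomm : Commute A ((A - μ • (1 : Module.End ℂ (SmoothDN a b))) ^ k) := by
      refine Commute.pow_right ?_ k
      exact (Commute.refl A).sub_right ((Commute.one_right A).smul_right μ)
    rw [pow_succ, Module.End.mul_apply, h2, map_smul, ← Module.End.mul_apply, ← hcomm.eq,
      Module.End.mul_apply, hk, map_zero, smul_zero]
  exact Submodule.finiteDimensional_of_le hle

/-- A single operator `A` serves all `z` near `c`. The map `z ↦ (z - iτ)⁻¹` is injective and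
continuous there and sends exceptional `z` to eigenvalues of `A` near a non-zero number, of which
there are finitely many. -/
theorem isClosed_and_isDiscrete (hab : a < b) (hU : ContDiffOn ℝ ∞ U (Icc a b)) (hα : 0 < α)
    (hε : 0 < ε) :
    IsClosed {c | (isShearCurve_ofReal hab hU).genS α ε c ≠ ⊥} ∧
      IsDiscrete {c | (isShearCurve_ofReal hab hU).genS α ε c ≠ ⊥} := by
  set hγ := isShearCurve_ofReal hab hU
  obtain ⟨C, τ₀, hC, H⟩ := exists_resolvent hab hU hα hε
  rw [isClosed_and_discrete_iff]
  intro c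
  set τ := max τ₀ (‖c‖ + 1) with hτ
  obtain ⟨A, hA, hHS⟩ := H τ (le_max_left _ _)
  have hc : c - Complex.I * τ ≠ 0 := by
    rw [sub_ne_zero]
    intro h
    have h1 : ‖c‖ = |τ| := by rw [h]; simp
    have h2 : ‖c‖ + 1 ≤ τ := le_max_right _ _
    rw [abs_of_nonneg (by linarith [norm_nonneg c])] at h1
    linarith
  have hE : Function.Injective ((Smooth.toL2 a b).comp (SmoothDN.incl a b)) :=
    (Smooth.toL2_injective hab).comp SmoothDN.incl_injective
  set μ : ℂ → ℂ := fun z => (z - Complex.I * τ)⁻¹ with hμ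
  have hμ0 : μ c ≠ 0 := inv_ne_zero hc
  have hcont : ContinuousAt μ c := ContinuousAt.inv₀ (by fun_prop) hc
  have hev1 : ∀ᶠ z in 𝓝 c, ‖μ z - μ c‖ ≤ ‖μ c‖ / 2 := by
    have := Metric.tendsto_nhds.1 hcont (‖μ c‖ / 2) (by positivity)
    filter_upwards [this] with z hz
    rw [dist_eq_norm] at hz
    exact hz.le
  have hev2 : ∀ᶠ z in 𝓝 c, z - Complex.I * τ ≠ 0 := by
    have : ContinuousAt (fun z : ℂ => z - Complex.I * τ) c := by fun_prop
    exact this.eventually_ne hc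
  have hfin : {z | (‖μ z - μ c‖ ≤ ‖μ c‖ / 2 ∧ z - Complex.I * τ ≠ 0) ∧
      hγ.genS α ε z ≠ ⊥}.Finite := by
    by_contra hinf
    obtain ⟨s, hs, hcard⟩ := Set.Infinite.exists_subset_card_eq hinf
      (⌊(C / (‖μ c‖ / 2)) ^ 2⌋₊ + 1)
    have hinj : Set.InjOn μ s := by
      intro z hz w hw hzw
      simpa [hμ] using hzw
    have hev : ∀ ν ∈ s.image μ, Module.End.HasEigenvalue A ν ∧ ‖ν - μ c‖ ≤ ‖μ c‖ / 2 := by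
      intro ν hν
      obtain ⟨z, hz, rfl⟩ := Finset.mem_image.1 hν
      obtain ⟨⟨h1, h2⟩, h3⟩ := hs hz
      refine ⟨?_, h1⟩
      rw [Ne, hγ.genS_eq_bot_iff] at h3
      push Not at h3
      obtain ⟨f, hf, hb, hf0⟩ := h3
      refine Module.End.hasEigenvalue_of_hasEigenvector (x := (SmoothDN.mk f hb)) ⟨?_, fun h => hf0 ?_⟩
      · rw [Module.End.mem_eigenspace_iff]
        have h4 := (osS_eq_lapS_iff (c := z) hγ hA (SmoothDN.mk f hb) 0).1 (by
          refine hf.trans ?_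
          simp)
        rw [zero_add, map_smul] at h4
        conv_rhs => rw [h4]
        rw [smul_smul, hμ, inv_mul_cancel₀ h2, one_smul]
      · exact congrArg (SmoothDN.incl a b) h
    have h5 := hHS.card_eigenvalues_le hC hE hμ0 _ hev
    rw [Finset.card_image_of_injOn hinj, hcard] at h5
    have h6 := Nat.lt_floor_add_one ((C / (‖μ c‖ / 2)) ^ 2)
    push_cast at h5
    linarith
  rw [Filter.disjoint_principal_right, ← Filter.eventually_mem_set]
  have hev3 : ∀ᶠ z in 𝓝 c, z ∉ {z | (‖μ z - μ c‖ ≤ ‖μ c‖ / 2 ∧ z - Complex.I * τ ≠ 0) ∧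
      hγ.genS α ε z ≠ ⊥} \ {c} :=
    (hfin.subset sdiff_subset).isClosed.isOpen_compl.mem_nhds fun h => h.2 rfl
  rw [eventually_nhdsWithin_iff]
  filter_upwards [hev1, hev2, hev3] with z h1 h2 h3 hz h4
  exact h3 ⟨⟨⟨h1, h2⟩, h4⟩, hz⟩

/-! ### Deformed segments and analytic continuation -/

section Deformation

variable {M ρ : ℝ} {m : ℝ → ℝ} {E : Type*} [NormedAddCommGroup E] [NormedSpace ℂ E]

/-- The parametrization of the deformed segment. -/
def deform (m : ℝ → ℝ) (x : ℝ) : ℂ := (x : ℂ) + Complex.I * (m x : ℂ)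

/-- The complex neighbourhood of size `ρ` of the support of `m`. -/
def complexNhd (m : ℝ → ℝ) (ρ : ℝ) : Set ℂ :=
  Metric.thickening ρ ((fun x : ℝ => (x : ℂ)) '' tsupport m)

/-- The function `m` defines a deformation, of size at most `M`, of the segment `[a, b]` away from
its endpoints. -/
structure IsDeformation (a b M : ℝ) (m : ℝ → ℝ) : Prop where
  lt : a < b
  smooth : ContDiff ℝ ∞ m
  subset : tsupport m ⊆ Ioo a b
  abs_le : ∀ x, |m x| ≤ M

theorem deform_re (x : ℝ) : (deform m x).re = x := by simp [deform]

theorem deform_of_notMem {x : ℝ} (hx : x ∉ tsupport m) : deform m x = x := by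
  simp [deform, image_eq_zero_of_notMem_tsupport hx]

theorem isOpen_complexNhd : IsOpen (complexNhd m ρ) := Metric.isOpen_thickening

theorem mem_complexNhd_iff {z : ℂ} :
    z ∈ complexNhd m ρ ↔ ∃ k ∈ tsupport m, z ∈ Metric.ball (k : ℂ) ρ := by
  simp [complexNhd, Metric.mem_thickening_iff]

theorem ball_subset_complexNhd {k : ℝ} (hk : k ∈ tsupport m) :
    Metric.ball (k : ℂ) ρ ⊆ complexNhd m ρ := fun _ hz => mem_complexNhd_iff.2 ⟨k, hk, hz⟩

theorem complexNhd_mono {ρ' : ℝ} (h : ρ' ≤ ρ) : complexNhd m ρ' ⊆ complexNhd m ρ :=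
  Metric.thickening_mono h _

namespace IsDeformation

theorem pos (hm : IsDeformation a b M m) (hρ : M < ρ) : 0 < ρ :=
  ((abs_nonneg _).trans (hm.abs_le 0)).trans_lt hρ

theorem deform_mem_ball (hm : IsDeformation a b M m) (hρ : M < ρ) (x : ℝ) :
    deform m x ∈ Metric.ball (x : ℂ) ρ := by
  simpa [deform, Complex.dist_eq] using (hm.abs_le x).trans_lt hρ

theorem deform_mem (hm : IsDeformation a b M m) (hρ : M < ρ) {x : ℝ} (hx : x ∈ tsupport m) :
    deform m x ∈ complexNhd m ρ := ball_subset_complexNhd hx (hm.deform_mem_ball hρ x)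

theorem ofReal_mem (hm : IsDeformation a b M m) (hρ : M < ρ) {x : ℝ} (hx : x ∈ tsupport m) :
    (x : ℂ) ∈ complexNhd m ρ :=
  ball_subset_complexNhd hx (Metric.mem_ball_self (hm.pos hρ))

theorem contDiff_deform (hm : IsDeformation a b M m) : ContDiff ℝ ∞ (deform m) :=
  Complex.ofRealCLM.contDiff.add (contDiff_const.mul (Complex.ofRealCLM.contDiff.comp hm.smooth))

theorem hasDerivAt_deform (hm : IsDeformation a b M m) (x : ℝ) :
    HasDerivAt (deform m) (1 + Complex.I * ((deriv m x : ℝ) : ℂ)) x :=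
  Complex.ofRealCLM.hasDerivAt.add
    ((hm.smooth.differentiable (by simp) x).hasDerivAt.ofReal_comp.const_mul _)

theorem uniqueDiff (hm : IsDeformation a b M m) {x : ℝ} (hx : x ∈ Icc a b) :
    UniqueDiffWithinAt ℝ (Icc a b) x := uniqueDiffOn_Icc hm.lt x hx

theorem derivWithin_deform (hm : IsDeformation a b M m) {x : ℝ} (hx : x ∈ Icc a b) :
    derivWithin (deform m) (Icc a b) x = 1 + Complex.I * ((deriv m x : ℝ) : ℂ) :=
  (hm.hasDerivAt_deform x).hasDerivWithinAt.derivWithin (hm.uniqueDiff hx)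

theorem derivWithin_deform_ne (hm : IsDeformation a b M m) {x : ℝ} (hx : x ∈ Icc a b) :
    derivWithin (deform m) (Icc a b) x ≠ 0 := by
  rw [hm.derivWithin_deform hx]
  intro h
  simpa using congrArg Complex.re h

theorem derivWithin_deform_of_notMem (hm : IsDeformation a b M m) {x : ℝ} (hx : x ∈ Icc a b)
    (hx' : x ∉ tsupport m) : derivWithin (deform m) (Icc a b) x = 1 := by
  have h : deriv m x = 0 := deriv_of_notMem_tsupport hx'
  rw [hm.derivWithin_deform hx, h]
  simp

theorem eventually_deform (hm : IsDeformation a b M m) (hρ : M < ρ) {x : ℝ} (hx : x ∈ tsupport m) :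
    ∀ᶠ y in 𝓝 x, y ∈ Icc a b ∧ deform m y ∈ complexNhd m ρ ∧ (y : ℂ) ∈ complexNhd m ρ := by
  have h1 := hm.contDiff_deform.continuous.continuousAt.preimage_mem_nhds
    (isOpen_complexNhd.mem_nhds (hm.deform_mem hρ hx))
  have h2 := Complex.continuous_ofReal.continuousAt.preimage_mem_nhds
    (isOpen_complexNhd.mem_nhds (hm.ofReal_mem hρ hx))
  filter_upwards [Icc_mem_nhds (hm.subset hx).1 (hm.subset hx).2, h1, h2] with y h1 h2 h3
  exact ⟨h1, h2, h3⟩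

theorem notMem_left (hm : IsDeformation a b M m) : a ∉ tsupport m := fun h =>
  lt_irrefl _ (hm.subset h).1

theorem notMem_right (hm : IsDeformation a b M m) : b ∉ tsupport m := fun h =>
  lt_irrefl _ (hm.subset h).2

end IsDeformation

/-- The identity theorem along a curve over the real line. -/
theorem eqOn_of_eventually_curve [CompleteSpace E] {F G : ℂ → E} {B : Set ℂ} (hBo : IsOpen B)
    (hB : IsPreconnected B) (hF : DifferentiableOn ℂ F B) (hG : DifferentiableOn ℂ G B)
    {δ : ℝ → ℂ} (hδ : Continuous δ) (hre : ∀ y, (δ y).re = y) {x : ℝ} (hx : δ x ∈ B)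
    (h : ∀ᶠ y in 𝓝 x, F (δ y) = G (δ y)) : EqOn F G B := by
  refine (hF.analyticOnNhd hBo).eqOn_of_preconnected_of_frequently_eq (hG.analyticOnNhd hBo) hB hx ?_
  -- The real part recovers the parameter, so `δ` is injective and the set of agreement accumulates
  -- at `δ x`.
  have h1 : Filter.Tendsto δ (𝓝[≠] x) (𝓝[≠] (δ x)) := by
    refine hδ.continuousAt.continuousWithinAt.tendsto_nhdsWithin fun y hy hxy => hy ?_
    have := congrArg Complex.re hxy
    rwa [hre, hre] at this
  exact h1.frequently (h.filter_mono nhdsWithin_le_nhds).frequently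

/-- The function `f` on the segment continues to a holomorphic function `F`, which restricts to `g`
on the deformed segment. -/
structure ContinuedBy (a b : ℝ) (m : ℝ → ℝ) (ρ : ℝ) (F : ℂ → E) (f g : ℝ → E) : Prop where
  diff : DifferentiableOn ℂ F (complexNhd m ρ)
  real : ∀ x ∈ Icc a b, (x : ℂ) ∈ complexNhd m ρ → f x = F x
  curve : ∀ x ∈ tsupport m, g x = F (deform m x)
  off : ∀ x ∈ Icc a b, x ∉ tsupport m → g x = f x

namespace ContinuedBy

variable {F : ℂ → E} {f g : ℝ → E}

theorem mono {ρ' : ℝ} (h : ContinuedBy a b m ρ F f g) (hρ : ρ' ≤ ρ) :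
    ContinuedBy a b m ρ' F f g :=
  ⟨h.diff.mono (complexNhd_mono hρ), fun x hx hx' => h.real x hx (complexNhd_mono hρ hx'),
    h.curve, h.off⟩

/-- Near a boundary point of the support both clauses of the definition are needed: off the support
the curve is real, so `f` and `F` agree there. Hence `g` is given by `F` on a full neighbourhood. -/
theorem eventually_curve (h : ContinuedBy a b m ρ F f g) (hm : IsDeformation a b M m) (hρ : M < ρ)
    {x : ℝ} (hx : x ∈ tsupport m) : g =ᶠ[𝓝 x] fun y => F (deform m y) := by
  filter_upwards [hm.eventually_deform hρ hx] with y ⟨h1, h2, h3⟩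
  by_cases hy : y ∈ tsupport m
  · exact h.curve y hy
  · rw [h.off y h1 hy, h.real y h1 h3, deform_of_notMem hy]

theorem eventually_off (h : ContinuedBy a b m ρ F f g) {x : ℝ} (hx : x ∉ tsupport m) :
    g =ᶠ[𝓝[Icc a b] x] f := by
  filter_upwards [self_mem_nhdsWithin, mem_nhdsWithin_of_mem_nhds
    ((isClosed_tsupport m).isOpen_compl.mem_nhds hx)] with y h1 h2
  exact h.off y h1 h2

theorem eventually_real (h : ContinuedBy a b m ρ F f g) {x : ℝ} (hx : (x : ℂ) ∈ complexNhd m ρ) :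
    f =ᶠ[𝓝[Icc a b] x] fun y => F y := by
  filter_upwards [self_mem_nhdsWithin, mem_nhdsWithin_of_mem_nhds
    (Complex.continuous_ofReal.continuousAt.preimage_mem_nhds (isOpen_complexNhd.mem_nhds hx))]
    with y h1 h2
  exact h.real y h1 h2

theorem hasDerivWithinAt_curve (h : ContinuedBy a b m ρ F f g) (hm : IsDeformation a b M m)
    (hρ : M < ρ) {x : ℝ} (hx : x ∈ tsupport m) {F' : E} (hF : HasDerivAt F F' (deform m x)) :
    HasDerivWithinAt g (derivWithin (deform m) (Icc a b) x • F') (Icc a b) x := by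
  have h1 := (h.eventually_curve hm hρ hx)
  rw [hm.derivWithin_deform (Ioo_subset_Icc_self (hm.subset hx))]
  exact ((hF.scomp x (hm.hasDerivAt_deform x)).congr_of_eventuallyEq h1).hasDerivWithinAt

theorem hasDerivWithinAt_real (h : ContinuedBy a b m ρ F f g) {x : ℝ} (hx : x ∈ Icc a b)
    (hx' : (x : ℂ) ∈ complexNhd m ρ) {F' : E} (hF : HasDerivAt F F' x) :
    HasDerivWithinAt f F' (Icc a b) x := by
  have h1 : HasDerivAt (fun y : ℝ => F y) ((1 : ℂ) • F') x :=
    hF.scomp x Complex.ofRealCLM.hasDerivAt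
  rw [one_smul] at h1
  exact h1.hasDerivWithinAt.congr_of_eventuallyEq (h.eventually_real hx') (h.real x hx hx')

/-- By the chain rule, dividing by `γ'` turns the parameter derivative of `F ∘ γ` into `F' ∘ γ`;
continuation therefore commutes with `∂`. -/
theorem curveDeriv {F : ℂ → ℂ} {f g : ℝ → ℂ} (h : ContinuedBy a b m ρ F f g)
    (hm : IsDeformation a b M m) (hρ : M < ρ) :
    ContinuedBy a b m ρ (deriv F) (OrrSommerfeld.curveDeriv a b (fun x => (x : ℂ)) f)
      (OrrSommerfeld.curveDeriv a b (deform m) g) where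
  diff := h.diff.deriv isOpen_complexNhd
  real x hx hx' := by
    have h1 := h.hasDerivWithinAt_real hx hx'
      (h.diff.differentiableAt (isOpen_complexNhd.mem_nhds hx')).hasDerivAt
    rw [OrrSommerfeld.curveDeriv, derivWithin_ofReal hm.lt hx, div_one,
      h1.derivWithin (hm.uniqueDiff hx)]
  curve x hx := by
    have hx' := Ioo_subset_Icc_self (hm.subset hx)
    have h1 := h.hasDerivWithinAt_curve hm hρ hx
      (h.diff.differentiableAt (isOpen_complexNhd.mem_nhds (hm.deform_mem hρ hx))).hasDerivAt
    rw [OrrSommerfeld.curveDeriv, h1.derivWithin (hm.uniqueDiff hx'), smul_eq_mul,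
      mul_div_cancel_left₀ _ (hm.derivWithin_deform_ne hx')]
  off x hx hx' := by
    rw [OrrSommerfeld.curveDeriv, OrrSommerfeld.curveDeriv, derivWithin_ofReal hm.lt hx,
      hm.derivWithin_deform_of_notMem hx hx',
      (h.eventually_off hx').derivWithin_eq (h.off x hx hx')]

theorem contDiffOn [CompleteSpace E] (h : ContinuedBy a b m ρ F f g) (hm : IsDeformation a b M m)
    (hρ : M < ρ) (hf : ContDiffOn ℝ ∞ f (Icc a b)) : ContDiffOn ℝ ∞ g (Icc a b) := by
  intro x hx
  by_cases hx' : x ∈ tsupport m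
  · have h1 : ContDiffAt ℂ ∞ F (deform m x) :=
      (h.diff.analyticOnNhd isOpen_complexNhd _ (hm.deform_mem hρ hx')).contDiffAt
    have h2 : ContDiffAt ℝ ∞ (F ∘ deform m) x :=
      (h1.restrict_scalars ℝ).comp x hm.contDiff_deform.contDiffAt
    exact (h2.congr_of_eventuallyEq (h.eventually_curve hm hρ hx')).contDiffWithinAt
  · exact (hf x hx).congr_of_eventuallyEq (h.eventually_off hx') (h.off x hx hx')

/-- The ball of radius `ρ` about a real point `x` of the support contains `deform m x` as well,
because `|m| ≤ M < ρ`. The identity theorem in this ball carries vanishing from the line to the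
curve. -/
theorem eq_zero_of_real [CompleteSpace E] (h : ContinuedBy a b m ρ F f g)
    (hm : IsDeformation a b M m) (hρ : M < ρ) (hf : ∀ x ∈ Icc a b, f x = 0) :
    ∀ x ∈ Icc a b, g x = 0 := by
  intro x hx
  by_cases hx' : x ∈ tsupport m
  · rw [h.curve x hx']
    refine eqOn_of_eventually_curve (B := Metric.ball (x : ℂ) ρ) (G := fun _ => 0)
      Metric.isOpen_ball (convex_ball _ _).isPreconnected
      (h.diff.mono (ball_subset_complexNhd hx')) (differentiableOn_const 0)
      Complex.continuous_ofReal Complex.ofReal_re (Metric.mem_ball_self (hm.pos hρ)) ?_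
      (hm.deform_mem_ball hρ x)
    filter_upwards [hm.eventually_deform hρ hx'] with y ⟨h1, _, h3⟩
    rw [← h.real y h1 h3, hf y h1]
  · rw [h.off x hx hx', hf x hx]

theorem eq_zero_of_curve [CompleteSpace E] (h : ContinuedBy a b m ρ F f g)
    (hm : IsDeformation a b M m) (hρ : M < ρ) (hg : ∀ x ∈ Icc a b, g x = 0) :
    ∀ x ∈ Icc a b, f x = 0 := by
  intro x hx
  by_cases hx' : x ∈ tsupport m
  · rw [h.real x hx (hm.ofReal_mem hρ hx')]
    refine eqOn_of_eventually_curve (B := Metric.ball (x : ℂ) ρ) (G := fun _ => 0)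
      Metric.isOpen_ball (convex_ball _ _).isPreconnected
      (h.diff.mono (ball_subset_complexNhd hx')) (differentiableOn_const 0)
      hm.contDiff_deform.continuous deform_re (hm.deform_mem_ball hρ x) ?_
      (Metric.mem_ball_self (hm.pos hρ))
    filter_upwards [h.eventually_curve hm hρ hx', hm.eventually_deform hρ hx'] with y h1 h2
    rw [← h1, hg y h2.1]
  · rw [← h.off x hx hx', hg x hx]

end ContinuedBy

/-- Holomorphic functions on balls around the support of `m` that agree on the real line fit
together. -/
theorem exists_glue [CompleteSpace E] (hm : IsDeformation a b M m) {G : ℝ → ℂ → E} {f : ℝ → E}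
    (hG : ∀ k ∈ tsupport m, DifferentiableOn ℂ (G k) (Metric.ball (k : ℂ) ρ))
    (hf : ∀ k ∈ tsupport m, ∀ x ∈ Icc a b, (x : ℂ) ∈ Metric.ball (k : ℂ) ρ → f x = G k x) :
    ∃ F : ℂ → E, ∀ k ∈ tsupport m, EqOn F (G k) (Metric.ball (k : ℂ) ρ) := by
  have key : ∀ k ∈ tsupport m, ∀ l ∈ tsupport m,
      EqOn (G k) (G l) (Metric.ball (k : ℂ) ρ ∩ Metric.ball (l : ℂ) ρ) := by
    intro k hk l hl z hz
    have hkl : |k - l| < 2 * ρ := by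
      have h1 := dist_triangle_left (k : ℂ) l z
      rw [Complex.dist_eq, ← Complex.ofReal_sub, Complex.norm_real, Real.norm_eq_abs] at h1
      have h2 := Metric.mem_ball.1 hz.1
      have h3 := Metric.mem_ball.1 hz.2
      linarith
    -- When two balls meet, the midpoint of their centres is a real point of both and lies in `(a,
    -- b)`. Near it both functions equal `f`, and the intersection is convex.
    have hB : (((k + l) / 2 : ℝ) : ℂ) ∈ Metric.ball (k : ℂ) ρ ∩ Metric.ball (l : ℂ) ρ := by
      rw [abs_lt] at hkl
      constructor <;> rw [Metric.mem_ball, Complex.dist_eq, ← Complex.ofReal_sub,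
        Complex.norm_real, Real.norm_eq_abs, abs_lt] <;> constructor <;> linarith
    refine eqOn_of_eventually_curve (Metric.isOpen_ball.inter Metric.isOpen_ball)
      ((convex_ball _ _).inter (convex_ball _ _)).isPreconnected ((hG k hk).mono inter_subset_left)
      ((hG l hl).mono inter_subset_right) Complex.continuous_ofReal Complex.ofReal_re hB ?_ hz
    have h1 := hm.subset hk
    have h2 := hm.subset hl
    filter_upwards [Icc_mem_nhds (a := a) (b := b) (x := (k + l) / 2) (by linarith [h1.1, h2.1])
      (by linarith [h1.2, h2.2]), Complex.continuous_ofReal.continuousAt.preimage_mem_nhds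
        ((Metric.isOpen_ball.inter Metric.isOpen_ball).mem_nhds hB)] with y hy hy'
    rw [← hf k hk y hy hy'.1, ← hf l hl y hy hy'.2]
  classical
  refine ⟨fun z => if h : ∃ k ∈ tsupport m, z ∈ Metric.ball (k : ℂ) ρ then G h.choose z else 0,
    fun k hk z hz => ?_⟩
  have h : ∃ k ∈ tsupport m, z ∈ Metric.ball (k : ℂ) ρ := ⟨k, hk, hz⟩
  simp only [dif_pos h]
  exact key _ h.choose_spec.1 k hk ⟨h.choose_spec.2, hz⟩

end Deformation

/-! ### Continuation of solutions through the holomorphic system. -/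

section Transfer

variable {M ρ : ℝ} {m : ℝ → ℝ}

theorem differentiableOn_coreMatrix {κ c : ℂ} {v w : ℂ → ℂ} {B : Set ℂ}
    (hv : DifferentiableOn ℂ v B) (hw : DifferentiableOn ℂ w B) (i j : Fin 4) :
    DifferentiableOn ℂ (fun z => coreMatrix α κ (v z - c) (w z) i j) B := by
  fin_cases i <;> fin_cases j <;> simp only [coreMatrix, Matrix.of_apply, Fin.zero_eta, Fin.mk_one,
    Fin.reduceFinMk, Matrix.cons_val] <;> fun_prop

theorem differentiableOn_source {κ : ℂ} {G : ℂ → ℂ} {B : Set ℂ} (hG : DifferentiableOn ℂ G B) :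
    DifferentiableOn ℂ (fun z => (![0, 0, 0, κ * G z] : Fin 4 → ℂ)) B := by
  rw [differentiableOn_pi]
  intro i
  fin_cases i <;> simp only [Fin.zero_eta, Fin.mk_one, Fin.reduceFinMk, Matrix.cons_val] <;>
    fun_prop

/-- A system with holomorphic coefficients in a neighbourhood of a closed ball is solvable in
the ball. -/
theorem exists_holomorphic_solution_of_closedBall {ι : Type*} [Fintype ι] [DecidableEq ι]
    {z₀ : ℂ} {R : ℝ} {B : Set ℂ} {A : ℂ → Matrix ι ι ℂ} {h : ℂ → ι → ℂ}
    (hB : Metric.closedBall z₀ R ⊆ B) (hA : ∀ i j, DifferentiableOn ℂ (fun z => A z i j) B)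
    (hh : DifferentiableOn ℂ h B) (v : ι → ℂ) :
    ∃ Y : ℂ → ι → ℂ, Y z₀ = v ∧
      ∀ z ∈ Metric.ball z₀ R, HasDerivAt Y ((A z).mulVec (Y z) + h z) z := by
  have hb := Metric.ball_subset_closedBall (x := z₀) (ε := R)
  choose C hC using fun i j => (isCompact_closedBall z₀ R).exists_bound_of_continuousOn
    ((hA i j).mono hB).continuousOn
  obtain ⟨D, hD⟩ := (isCompact_closedBall z₀ R).exists_bound_of_continuousOn
    (hh.mono hB).continuousOn
  have h1 : ∀ i j, |C i j| ≤ ∑ i, ∑ j, |C i j| := fun i j =>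
    (Finset.single_le_sum (f := fun j => |C i j|) (fun _ _ => abs_nonneg _) (Finset.mem_univ j)).trans
      (Finset.single_le_sum (f := fun i => ∑ j, |C i j|)
        (fun _ _ => Finset.sum_nonneg fun _ _ => abs_nonneg _) (Finset.mem_univ i))
  have h2 : 0 ≤ ∑ i, ∑ j, |C i j| :=
    Finset.sum_nonneg fun _ _ => Finset.sum_nonneg fun _ _ => abs_nonneg _
  refine exists_holomorphic_solution (C := (∑ i, ∑ j, |C i j|) + |D|)
    (fun i j => (hA i j).mono (hb.trans hB)) (hh.mono (hb.trans hB)) (fun z hz i j => ?_)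
    (fun z hz => ?_) v
  · linarith [hC i j z (hb hz), h1 i j, le_abs_self (C i j), abs_nonneg D]
  · linarith [hD z (hb hz), le_abs_self D]

/-- Solutions of the Orr--Sommerfeld equation on the segment continue to solutions on the deformed
segment. -/
theorem exists_continued_solution (hm : IsDeformation a b M m) (hα : α ≠ 0) (hε : ε ≠ 0)
    {W W' S S' f : ℝ → ℂ} {F G : ℂ → ℂ} (hρ : M < ρ)
    (h0 : IsShearCurve a b (fun x => (x : ℂ)) W) (hγ : IsShearCurve a b (deform m) W')
    (hW : ContinuedBy a b m ρ F W W') (hS : ContinuedBy a b m ρ G S S')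
    (hS' : ContDiffOn ℝ ∞ S' (Icc a b)) (hf : ContDiffOn ℝ ∞ f (Icc a b))
    (hfS : ∀ x ∈ Icc a b, orrSommerfeld a b α ε c (fun x => (x : ℂ)) W f x = S x) :
    ∃ (ρ' : ℝ) (H : ℂ → ℂ) (g : ℝ → ℂ), M < ρ' ∧ ContDiffOn ℝ ∞ g (Icc a b) ∧
      ContinuedBy a b m ρ' H f g ∧
      (∀ x ∈ Icc a b, orrSommerfeld a b α ε c (deform m) W' g x = S' x) ∧
      ∀ x ∈ Icc a b, x ∉ tsupport m →
        sysVec a b α (deform m) g x = sysVec a b α (fun x => (x : ℂ)) f x := by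
  -- A slightly smaller radius keeps closed balls inside the domain of holomorphy, where the
  -- coefficients are bounded, and still reaches the curve.
  obtain ⟨ρ', hρ', hρρ⟩ := exists_between hρ
  have hW2 := (hW.curveDeriv hm hρ).curveDeriv hm hρ
  set F2 := deriv (deriv F)
  set A : ℂ → Matrix (Fin 4) (Fin 4) ℂ := fun z =>
    coreMatrix α (leadCoeff α ε) (F z - c) (F2 z) with hA
  set h : ℂ → Fin 4 → ℂ := fun z => ![0, 0, 0, (leadCoeff α ε)⁻¹ * G z] with hh
  have hY0 : ∀ x ∈ Icc a b, HasDerivWithinAt (sysVec a b α (fun x => (x : ℂ)) f)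
      ((sysMatrix a b α ε c (fun x => (x : ℂ)) W x).mulVec (sysVec a b α (fun x => (x : ℂ)) f x) +
        sysSource a b α ε (fun x => (x : ℂ)) S x) (Icc a b) x := fun x hx =>
    sysVec_hasDerivWithinAt hα hε h0 hf hx (hfS x hx)
  have hreal : ∀ x ∈ Icc a b, (x : ℂ) ∈ complexNhd m ρ →
      sysMatrix a b α ε c (fun x => (x : ℂ)) W x = A x ∧
      sysSource a b α ε (fun x => (x : ℂ)) S x = h x := by
    intro x hx hx'
    simp only [sysMatrix, sysSource, derivWithin_ofReal hm.lt hx, one_smul, one_mul,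
      hW2.real x hx hx', hW.real x hx hx', hS.real x hx hx', hA, hh, and_self]
  have hcurve : ∀ x ∈ tsupport m, ∀ y : Fin 4 → ℂ,
      (sysMatrix a b α ε c (deform m) W' x).mulVec y + sysSource a b α ε (deform m) S' x =
        derivWithin (deform m) (Icc a b) x •
          ((A (deform m x)).mulVec y + h (deform m x)) := by
    intro x hx y
    rw [smul_add, ← Matrix.smul_mulVec, sysMatrix, hW2.curve x hx, hW.curve x hx]
    congr 1
    rw [sysSource, hS.curve x hx, hh]
    ext i
    fin_cases i <;> simp [mul_assoc]
  have hoff : ∀ x ∈ Icc a b, x ∉ tsupport m →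
      sysMatrix a b α ε c (deform m) W' x = sysMatrix a b α ε c (fun x => (x : ℂ)) W x ∧
      sysSource a b α ε (deform m) S' x = sysSource a b α ε (fun x => (x : ℂ)) S x := by
    intro x hx hx'
    simp only [sysMatrix, sysSource, derivWithin_ofReal hm.lt hx,
      hm.derivWithin_deform_of_notMem hx hx', hW2.off x hx hx', hW.off x hx hx', hS.off x hx hx',
      and_self]
  have hball : ∀ k ∈ tsupport m, Metric.closedBall (k : ℂ) ρ' ⊆ complexNhd m ρ := fun k hk =>
    (Metric.closedBall_subset_ball hρρ).trans (ball_subset_complexNhd hk)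
  have hloc : ∀ k ∈ tsupport m, ∃ Y : ℂ → Fin 4 → ℂ,
      (∀ z ∈ Metric.ball (k : ℂ) ρ', HasDerivAt Y ((A z).mulVec (Y z) + h z) z) ∧
      ∀ x ∈ Icc a b, (x : ℂ) ∈ Metric.ball (k : ℂ) ρ' →
        sysVec a b α (fun x => (x : ℂ)) f x = Y x := by
    intro k hk
    obtain ⟨Y, hYk, hY⟩ := exists_holomorphic_solution_of_closedBall (hball k hk)
      (differentiableOn_coreMatrix hW.diff hW2.diff) (differentiableOn_source hS.diff)
      (sysVec a b α (fun x => (x : ℂ)) f k)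
    refine ⟨Y, hY, fun x hx hxk => ?_⟩
    have hs : Icc a b ∩ Metric.ball k ρ' ⊆ Icc a b := inter_subset_left
    have hmem : ∀ x : ℝ, x ∈ Metric.ball k ρ' ↔ (x : ℂ) ∈ Metric.ball (k : ℂ) ρ' := fun x => by
      rw [Metric.mem_ball, Metric.mem_ball, Complex.dist_eq, ← Complex.ofReal_sub,
        Complex.norm_real, Real.dist_eq, Real.norm_eq_abs]
    -- On the real line the holomorphic solution and the vector of `f` solve the same system and
    -- agree at the centre `k`.
    have hzero := solution_eq_zero (Y := fun x => sysVec a b α (fun x => (x : ℂ)) f x - Y x)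
      (s := Icc a b ∩ Metric.ball k ρ') hm.lt
      (contDiffOn_sysMatrix (α := α) (ε := ε) (c := c) h0)
      ((convex_Icc a b).inter (convex_ball _ _)) hs (fun y hy => ?_) (x₀ := k)
      ⟨Ioo_subset_Icc_self (hm.subset hk), Metric.mem_ball_self (hm.pos hρ')⟩
      (by rw [hYk, sub_self]) (x := x) ⟨hx, (hmem x).2 hxk⟩
    · exact sub_eq_zero.1 hzero
    · have hy' := (hmem y).1 hy.2
      obtain ⟨h1, h2⟩ := hreal y hy.1 (hball k hk (Metric.ball_subset_closedBall hy'))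
      have h3 : HasDerivAt (fun x : ℝ => Y x) ((1 : ℂ) • ((A y).mulVec (Y y) + h y)) y :=
        (hY y hy').scomp y Complex.ofRealCLM.hasDerivAt
      refine (((hY0 y hy.1).mono hs).fun_sub h3.hasDerivWithinAt).congr_deriv ?_
      rw [h1, h2, one_smul, Matrix.mulVec_sub, add_sub_add_right_eq_sub]
  choose! Yk hYk hYkf using hloc
  obtain ⟨Y, hY⟩ := exists_glue (ρ := ρ') hm
    (fun k hk z hz => (hYk k hk z hz).differentiableAt.differentiableWithinAt) hYkf
  have hYd : ∀ z ∈ complexNhd m ρ', HasDerivAt Y ((A z).mulVec (Y z) + h z) z := by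
    intro z hz
    obtain ⟨k, hk, hzk⟩ := mem_complexNhd_iff.1 hz
    rw [hY k hk hzk]
    exact (hYk k hk z hzk).congr_of_eventuallyEq
      ((hY k hk).eventuallyEq_of_mem (Metric.isOpen_ball.mem_nhds hzk))
  classical
  -- The holomorphic solution on the deformed part and the original one elsewhere; being a
  -- continuation, `Z` satisfies the system across the transition too.
  set Z : ℝ → Fin 4 → ℂ := fun x =>
    if x ∈ tsupport m then Y (deform m x) else sysVec a b α (fun x => (x : ℂ)) f x with hZ
  have hcont : ContinuedBy a b m ρ' Y (sysVec a b α (fun x => (x : ℂ)) f) Z :=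
    { diff := fun z hz => (hYd z hz).differentiableAt.differentiableWithinAt
      real := fun x hx hx' => by
        obtain ⟨k, hk, hzk⟩ := mem_complexNhd_iff.1 hx'
        rw [hY k hk hzk, hYkf k hk x hx hzk]
      curve := fun x hx => if_pos hx
      off := fun x _ hx => if_neg hx }
  have hZd : ∀ x ∈ Icc a b, HasDerivWithinAt Z
      ((sysMatrix a b α ε c (deform m) W' x).mulVec (Z x) + sysSource a b α ε (deform m) S' x)
      (Icc a b) x := by
    intro x hx
    by_cases hx' : x ∈ tsupport m
    · rw [hcurve x hx', hcont.curve x hx']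
      exact hcont.hasDerivWithinAt_curve hm hρ' hx' (hYd _ (hm.deform_mem hρ' hx'))
    · obtain ⟨h1, h2⟩ := hoff x hx hx'
      rw [h1, h2, hcont.off x hx hx']
      exact (hY0 x hx).congr_of_eventuallyEq (hcont.eventually_off hx') (hcont.off x hx hx')
  obtain ⟨h1, h2⟩ := sysVec_of_hasDerivWithinAt hα hε hγ hZd
  have h3 := contDiffOn_solution hm.lt (contDiffOn_sysMatrix hγ) (contDiffOn_sysSource hγ hS') hZd
  refine ⟨ρ', fun z => Y z 0, fun x => Z x 0, hρ', contDiffOn_pi.1 h3 0, ?_, h2,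
    fun x hx hx' => (h1 hx).trans (hcont.off x hx hx')⟩
  exact
    { diff := differentiableOn_pi.1 hcont.diff 0
      real := fun x hx hx' => congrFun (hcont.real x hx hx') 0
      curve := fun x hx => congrFun (hcont.curve x hx) 0
      off := fun x hx hx' => congrFun (hcont.off x hx hx') 0 }

end Transfer

/-! ### Generalized eigenfunctions on the deformed segment -/

section Comparison

variable {M : ℝ} {m : ℝ → ℝ} {W' : ℝ → ℂ}

/-- The smooth function `g` on the deformed segment is the analytic continuation of `f`. -/
def IsContinuation (a b M : ℝ) (m : ℝ → ℝ) (f g : ℝ → ℂ) : Prop :=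
  ∃ (ρ : ℝ) (F : ℂ → ℂ), M < ρ ∧ ContinuedBy a b m ρ F f g

theorem IsContinuation.zero : IsContinuation a b M m 0 0 :=
  ⟨M + 1, 0, lt_add_one M, differentiableOn_const 0, fun _ _ _ => rfl, fun _ _ => rfl,
    fun _ _ _ => rfl⟩

theorem IsContinuation.add {f g f' g' : ℝ → ℂ} (h : IsContinuation a b M m f g)
    (h' : IsContinuation a b M m f' g') : IsContinuation a b M m (f + f') (g + g') := by
  obtain ⟨ρ, F, hρ, h⟩ := h
  obtain ⟨ρ', F', hρ', h'⟩ := h'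
  have h := h.mono (min_le_left ρ ρ')
  have h' := h'.mono (min_le_right ρ ρ')
  exact ⟨_, F + F', lt_min hρ hρ', h.diff.add h'.diff,
    fun x hx hx' => congrArg₂ (· + ·) (h.real x hx hx') (h'.real x hx hx'),
    fun x hx => congrArg₂ (· + ·) (h.curve x hx) (h'.curve x hx),
    fun x hx hx' => congrArg₂ (· + ·) (h.off x hx hx') (h'.off x hx hx')⟩

theorem IsContinuation.smul {f g : ℝ → ℂ} (k : ℂ) (h : IsContinuation a b M m f g) :
    IsContinuation a b M m (k • f) (k • g) := by
  obtain ⟨ρ, F, hρ, h⟩ := h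
  exact ⟨ρ, k • F, hρ, h.diff.const_smul k,
    fun x hx hx' => congrArg (k • ·) (h.real x hx hx'),
    fun x hx => congrArg (k • ·) (h.curve x hx),
    fun x hx hx' => congrArg (k • ·) (h.off x hx hx')⟩

theorem IsContinuation.sub {f g f' g' : ℝ → ℂ} (h : IsContinuation a b M m f g)
    (h' : IsContinuation a b M m f' g') : IsContinuation a b M m (f - f') (g - g') := by
  have := h.add (h'.smul (-1))
  rwa [neg_one_smul, neg_one_smul, ← sub_eq_add_neg, ← sub_eq_add_neg] at this

theorem IsContinuation.curveDeriv (hm : IsDeformation a b M m) {f g : ℝ → ℂ}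
    (h : IsContinuation a b M m f g) :
    IsContinuation a b M m (OrrSommerfeld.curveDeriv a b (fun x => (x : ℂ)) f)
      (OrrSommerfeld.curveDeriv a b (deform m) g) := by
  obtain ⟨ρ, F, hρ, h⟩ := h
  exact ⟨ρ, _, hρ, h.curveDeriv hm hρ⟩

theorem IsContinuation.lap (hm : IsDeformation a b M m) {f g : ℝ → ℂ}
    (h : IsContinuation a b M m f g) :
    IsContinuation a b M m (OrrSommerfeld.lap a b α (fun x => (x : ℂ)) f)
      (OrrSommerfeld.lap a b α (deform m) g) :=
  ((h.curveDeriv hm).curveDeriv hm).sub (h.smul ((α : ℂ) ^ 2))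

/-- A segment with a profile and a deformation of it. -/
structure IsDeformedPair (a b M : ℝ) (m : ℝ → ℝ) (W W' : ℝ → ℂ) : Prop where
  deformation : IsDeformation a b M m
  shear : IsShearCurve a b (fun x => (x : ℂ)) W
  continuation : IsContinuation a b M m W W'

theorem IsDeformedPair.shear' (h : IsDeformedPair a b M m W W') :
    IsShearCurve a b (deform m) W' where
  lt := h.shear.lt
  smooth := h.deformation.contDiff_deform.contDiffOn
  deriv_ne _ hx := h.deformation.derivWithin_deform_ne hx
  smooth_profile := by
    obtain ⟨ρ, F, hρ, hF⟩ := h.continuation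
    exact hF.contDiffOn h.deformation hρ h.shear.smooth_profile

theorem IsContinuation.unique_right (hm : IsDeformation a b M m) {f g g' : Smooth a b}
    (h : IsContinuation a b M m f g) (h' : IsContinuation a b M m f g') : g = g' := by
  obtain ⟨ρ, F, hρ, hF⟩ := h.sub h'
  exact Smooth.ext_Icc fun x hx => sub_eq_zero.1 (hF.eq_zero_of_real hm hρ
    (fun y _ => sub_self ((f : ℝ → ℂ) y)) x hx)

theorem IsContinuation.unique_left (hm : IsDeformation a b M m) {f f' g : Smooth a b}
    (h : IsContinuation a b M m f g) (h' : IsContinuation a b M m f' g) : f = f' := by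
  obtain ⟨ρ, F, hρ, hF⟩ := h.sub h'
  exact Smooth.ext_Icc fun x hx => sub_eq_zero.1 (hF.eq_zero_of_curve hm hρ
    (fun y _ => sub_self ((g : ℝ → ℂ) y)) x hx)

/-- The endpoints lie outside the support of `m`, where a function and its continuation, and their
derivatives, coincide. -/
theorem IsDeformedPair.bdryS_eq_zero_iff (h : IsDeformedPair a b M m W W') {f g : Smooth a b}
    (hfg : IsContinuation a b M m f g) : bdryS a b f = 0 ↔ bdryS a b g = 0 := by
  obtain ⟨ρ, F, hρ, hF'⟩ := hfg.curveDeriv h.deformation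
  obtain ⟨ρ, F, hρ, hF⟩ := hfg
  have ha := left_mem_Icc.2 h.shear.lt.le
  have hb := right_mem_Icc.2 h.shear.lt.le
  have ha' := h.deformation.notMem_left
  have hb' := h.deformation.notMem_right
  rw [h.shear.bdryS_eq_zero_iff, h.shear'.bdryS_eq_zero_iff, hF.off a ha ha', hF.off b hb hb',
    hF'.off a ha ha', hF'.off b hb hb']

theorem IsDeformedPair.exists_right (h : IsDeformedPair a b M m W W') (hα : α ≠ 0) (hε : ε ≠ 0)
    {S S' f : Smooth a b} (hS : IsContinuation a b M m S S') (hf : h.shear.osS α ε c f = S) :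
    ∃ g : Smooth a b, IsContinuation a b M m f g ∧ h.shear'.osS α ε c g = S' ∧
      h.shear'.cauchyData α g = h.shear.cauchyData α f := by
  obtain ⟨ρ₁, F, hρ₁, hF⟩ := h.continuation
  obtain ⟨ρ₂, G, hρ₂, hG⟩ := hS
  obtain ⟨ρ, H, g, hρ, hg, hH, hgS, hoff⟩ := exists_continued_solution h.deformation hα hε
    (lt_min hρ₁ hρ₂) h.shear h.shear' (hF.mono (min_le_left _ _)) (hG.mono (min_le_right _ _))
    S'.2.1 f.2.1 (fun x _ => congrFun (congrArg Subtype.val hf) x)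
  obtain ⟨g', hg'⟩ := Smooth.exists_eqOn hg
  have ha := left_mem_Icc.2 h.shear.lt.le
  refine ⟨g', ⟨ρ, H, hρ, hH.diff, hH.real, fun x hx => ?_, fun x hx hx' => ?_⟩,
    Smooth.ext_Icc fun x hx => ?_, ?_⟩
  · rw [hg' (Ioo_subset_Icc_self (h.deformation.subset hx)), hH.curve x hx]
  · rw [hg' hx, hH.off x hx hx']
  · exact (orrSommerfeld_congr hg' hx).trans (hgS x hx)
  · exact (sysVec_congr hg' ha).trans (hoff a ha h.deformation.notMem_left)

/-- Solutions need not be continued back from the curve: solve on the segment with the Cauchy data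
of `g` at `a`, continue that solution to the curve, and recognize `g` by uniqueness. -/
theorem IsDeformedPair.exists_left (h : IsDeformedPair a b M m W W') (hα : α ≠ 0) (hε : ε ≠ 0)
    {S S' g : Smooth a b} (hS : IsContinuation a b M m S S') (hg : h.shear'.osS α ε c g = S') :
    ∃ f : Smooth a b, IsContinuation a b M m f g ∧ h.shear.osS α ε c f = S := by
  obtain ⟨f, hf, hfg⟩ := h.shear.exists_osS_eq hα hε c S (h.shear'.cauchyData α g)
  obtain ⟨g', hfg', hg', hgg⟩ := h.exists_right hα hε hS hf
  have : g' - g = 0 := h.shear'.eq_zero_of_osS (c := c) hα hε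
    (by rw [map_sub, hg', hg, sub_self]) (by rw [map_sub, hgg, hfg, sub_self])
  rw [sub_eq_zero] at this
  exact ⟨f, this ▸ hfg', hf⟩

/-- By minimality: the functions that have a continuation among the generalized eigenfunctions of
the curve form a subspace closed under the generating relation, since continuation respects both
operators and the boundary conditions. -/
theorem IsDeformedPair.exists_right_of_mem_genS (h : IsDeformedPair a b M m W W') (hα : α ≠ 0)
    (hε : ε ≠ 0) {f : Smooth a b} (hf : f ∈ h.shear.genS α ε c) :
    ∃ g ∈ h.shear'.genS α ε c, IsContinuation a b M m f g := by
  let S : Submodule ℂ (Smooth a b) :=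
    { carrier := {f | ∃ g ∈ h.shear'.genS α ε c, IsContinuation a b M m f g}
      zero_mem' := ⟨0, Submodule.zero_mem _, IsContinuation.zero⟩
      add_mem' := fun ⟨g, hg, hfg⟩ ⟨g', hg', hfg'⟩ => ⟨g + g', Submodule.add_mem _ hg hg',
        hfg.add hfg'⟩
      smul_mem' := fun k _ ⟨g, hg, hfg⟩ => ⟨k • g, Submodule.smul_mem _ k hg, hfg.smul k⟩ }
  refine h.shear.genS_le (S := S) (fun f f₀ ⟨g₀, hg₀, hfg₀⟩ hf hb => ?_) hf
  obtain ⟨g, hfg, hg, -⟩ := h.exists_right hα hε (S := h.shear.lapS α f₀)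
    (S' := h.shear'.lapS α g₀) (hfg₀.lap h.deformation) hf
  exact ⟨g, h.shear'.isGenClosed_genS g g₀ hg₀ hg ((h.bdryS_eq_zero_iff hfg).1 hb), hfg⟩

theorem IsDeformedPair.exists_left_of_mem_genS (h : IsDeformedPair a b M m W W') (hα : α ≠ 0)
    (hε : ε ≠ 0) {g : Smooth a b} (hg : g ∈ h.shear'.genS α ε c) :
    ∃ f ∈ h.shear.genS α ε c, IsContinuation a b M m f g := by
  let S : Submodule ℂ (Smooth a b) :=
    { carrier := {g | ∃ f ∈ h.shear.genS α ε c, IsContinuation a b M m f g}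
      zero_mem' := ⟨0, Submodule.zero_mem _, IsContinuation.zero⟩
      add_mem' := fun ⟨f, hf, hfg⟩ ⟨f', hf', hfg'⟩ => ⟨f + f', Submodule.add_mem _ hf hf',
        hfg.add hfg'⟩
      smul_mem' := fun k _ ⟨f, hf, hfg⟩ => ⟨k • f, Submodule.smul_mem _ k hf, hfg.smul k⟩ }
  refine h.shear'.genS_le (S := S) (fun g g₀ ⟨f₀, hf₀, hfg₀⟩ hg hb => ?_) hg
  obtain ⟨f, hfg, hf⟩ := h.exists_left hα hε (S := h.shear.lapS α f₀)
    (S' := h.shear'.lapS α g₀) (hfg₀.lap h.deformation) hg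
  exact ⟨f, h.shear.isGenClosed_genS f f₀ hf₀ hf ((h.bdryS_eq_zero_iff hfg).2 hb), hfg⟩

/-- The generalized eigenfunctions on the segment and on the deformed segment correspond to each
other by analytic continuation. -/
theorem IsDeformedPair.exists_genS_equiv (h : IsDeformedPair a b M m W W') (hα : α ≠ 0)
    (hε : ε ≠ 0) (c : ℂ) : Nonempty (h.shear.genS α ε c ≃ₗ[ℂ] h.shear'.genS α ε c) := by
  choose e he hee using fun f : h.shear.genS α ε c => h.exists_right_of_mem_genS hα hε f.2
  choose d hd hdd using fun g : h.shear'.genS α ε c => h.exists_left_of_mem_genS hα hε g.2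
  exact ⟨{
    toFun := fun f => ⟨e f, he f⟩
    map_add' := fun f f' => Subtype.ext
      ((hee (f + f')).unique_right h.deformation ((hee f).add (hee f')))
    map_smul' := fun k f => Subtype.ext
      ((hee (k • f)).unique_right h.deformation ((hee f).smul k))
    invFun := fun g => ⟨d g, hd g⟩
    left_inv := fun f => Subtype.ext ((hdd ⟨e f, he f⟩).unique_left h.deformation (hee f))
    right_inv := fun g => Subtype.ext ((hee ⟨d g, hd g⟩).unique_right h.deformation (hdd g)) }⟩

end Comparison

/-! ### Conclusion: eigenvalues, the deformed pair and the proposition. -/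

theorem mem_eigenvalues_iff (hab : a < b) (hU : ContDiffOn ℝ ∞ U (Icc a b)) (hα : α ≠ 0)
    (hε : ε ≠ 0) :
    c ∈ eigenvalues a b α ε U ↔ (isShearCurve_ofReal hab hU).genS α ε c ≠ ⊥ := by
  have hγ := isShearCurve_ofReal hab hU
  obtain ⟨T, hT, -, -, hinv⟩ := hγ.exists_isFredholm hα hε c (s := 4) (t := 0) (by norm_num)
    (by norm_num)
  rw [Ne, IsShearCurve.genS_eq_bot_iff, ← hinv, eigenvalues, mem_ofPred_eq, not_iff_not]
  refine ⟨fun ⟨T', hT', h⟩ => ?_, fun h => ⟨T, hT, h⟩⟩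
  -- Any operator realizing `P` is the one constructed, since distributions determine elements of
  -- the Sobolev spaces.
  rwa [hT.unique hγ hT']

/-- A function of small size with support in a compact set defines a deformation, and the shear
profile continues to the deformed segment. -/
theorem exists_isDeformedPair (hab : a < b) (hU : ContDiffOn ℝ ∞ U (Icc a b)) {K : Set ℝ}
    (hKab : K ⊆ Ioo a b) {r : ℝ} {V : ℂ → ℂ}
    (hV : DifferentiableOn ℂ V (Metric.thickening r ((fun x : ℝ => (x : ℂ)) '' K)))
    (hVU : ∀ x ∈ Icc a b, V (x : ℂ) = (U x : ℂ)) {m : ℝ → ℝ} (hm : ContDiff ℝ ∞ m)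
    (hmK : tsupport m ⊆ K) (hmr : ∀ x, |m x| < r) :
    ∃ M, IsDeformedPair a b M m (fun x => (U x : ℂ)) (fun x => V (deform m x)) := by
  have hcs : HasCompactSupport m := isCompact_Icc.of_isClosed_subset (isClosed_tsupport m)
    ((hmK.trans hKab).trans Ioo_subset_Icc_self)
  -- By compactness of the support, `|m|` attains a maximum `M < r`. The room between `M` and `r`
  -- allows the radii to shrink later.
  obtain ⟨x₀, hx₀⟩ := hm.continuous.norm.exists_forall_ge_of_hasCompactSupport hcs.norm
  refine ⟨|m x₀|, ⟨hab, hm, hmK.trans hKab, hx₀⟩, isShearCurve_ofReal hab hU, r, V, hmr x₀,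
    hV.mono (Metric.thickening_subset_of_subset r (image_mono hmK)), fun x hx _ => (hVU x hx).symm,
    fun _ _ => rfl, fun x hx hx' => ?_⟩
  rw [deform_of_notMem hx', hVU x hx]

end OrrSommerfeld

end

theorem proposition3p2
    -- the interval `[a, b]`, the smooth shear profile `U`, the wave number `α`
    (a b : ℝ) (hab : a < b) (U : ℝ → ℝ) (hU : ContDiffOn ℝ ∞ U (Icc a b))
    (α : ℝ) (hα : 0 < α)
    -- `U` extends holomorphically to the complex `r`-neighbourhood of the compact `K ⊆ (a, b)`
    (K : Set ℝ) (hK : IsCompact K) (hKab : K ⊆ Ioo a b) (r : ℝ) (hr : 0 < r)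
    (V : ℂ → ℂ)
    (hV : DifferentiableOn ℂ V (Metric.thickening r ((fun x : ℝ => (x : ℂ)) '' K)))
    (hVU : ∀ x ∈ Icc a b, V (x : ℂ) = (U x : ℂ))
    -- the deformed segment `{x + i m(x)}`, with `m` supported in `K` and `|m| < r`
    (m : ℝ → ℝ) (hm : ContDiff ℝ ∞ m) (hmK : tsupport m ⊆ K) (hmr : ∀ x, |m x| < r)
    (γ : ℝ → ℂ) (hγ : ∀ x, γ x = (x : ℂ) + Complex.I * (m x : ℂ))
    (ε : ℝ) (hε : 0 < ε) (k : ℝ) (hk : -5 / 2 < k) :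
    (IsClosed (OrrSommerfeld.eigenvalues a b α ε U) ∧
      IsDiscrete (OrrSommerfeld.eigenvalues a b α ε U)) ∧
    (∀ c : ℂ, ∃ T : OrrSommerfeld.SobDN a b (k + 4) →L[ℂ] OrrSommerfeld.Sob a b k,
      OrrSommerfeld.IsOrrSommerfeld α ε c γ (fun x => V (γ x)) T ∧
      T.IsFredholm ∧ T.toLinearMap.index = 0 ∧
      (T.IsInvertible ↔ c ∉ OrrSommerfeld.eigenvalues a b α ε U)) ∧
    (∀ c : ℂ,
      FiniteDimensional ℂ
        (OrrSommerfeld.genEigenspace a b α ε c (fun x => (x : ℂ)) (fun x => (U x : ℂ))) ∧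
      FiniteDimensional ℂ (OrrSommerfeld.genEigenspace a b α ε c γ (fun x => V (γ x))) ∧
      Module.finrank ℂ
          (OrrSommerfeld.genEigenspace a b α ε c (fun x => (x : ℂ)) (fun x => (U x : ℂ))) =
        Module.finrank ℂ (OrrSommerfeld.genEigenspace a b α ε c γ (fun x => V (γ x))) ∧
      (Module.finrank ℂ
          (OrrSommerfeld.genEigenspace a b α ε c (fun x => (x : ℂ)) (fun x => (U x : ℂ))) ≠ 0 ↔
        c ∈ OrrSommerfeld.eigenvalues a b α ε U)) := by
  obtain ⟨M, h⟩ := OrrSommerfeld.exists_isDeformedPair hab hU hKab hV hVU hm hmK hmr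
  obtain rfl : γ = OrrSommerfeld.deform m := funext hγ
  have hmem := fun c => OrrSommerfeld.mem_eigenvalues_iff (c := c) hab hU hα.ne' hε.ne'
  refine ⟨?_, fun c => ?_, fun c => ?_⟩
  · rw [Set.ext hmem]
    exact OrrSommerfeld.isClosed_and_isDiscrete hab hU hα hε
  · obtain ⟨T, h1, h2, h3, h4⟩ := h.shear'.exists_isFredholm hα.ne' hε.ne' c rfl hk
    refine ⟨T, h1, h2, h3, ?_⟩
    obtain ⟨e⟩ := h.exists_genS_equiv hα.ne' hε.ne' c
    -- Invertibility on the curve and `c ∉ Σ_ε` both say that a space of generalized eigenfunctions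
    -- is trivial, and continuation identifies the two spaces.
    rw [h4, ← h.shear'.genS_eq_bot_iff, hmem, not_not]
    rw [← Submodule.subsingleton_iff_eq_bot, ← Submodule.subsingleton_iff_eq_bot]
    exact e.toEquiv.subsingleton_congr.symm
  · have hfin := OrrSommerfeld.finiteDimensional_genS hab hU hα hε c
    obtain ⟨e⟩ := h.exists_genS_equiv hα.ne' hε.ne' c
    obtain ⟨e₀⟩ := h.shear.genEigenspaceEquiv (α := α) (ε := ε) (c := c)
    obtain ⟨e₁⟩ := h.shear'.genEigenspaceEquiv (α := α) (ε := ε) (c := c)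
    refine ⟨Module.Finite.equiv e₀.symm, Module.Finite.equiv (e.trans e₁.symm),
      ((e₀.trans e).trans e₁.symm).finrank_eq, ?_⟩
    rw [e₀.finrank_eq, hmem, Ne, Submodule.finrank_eq_zero]
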